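/- Let $S\subset\mathbb{P}^6$ be the surface cut out by the nine quadrics $$x_1^2-x_2x_4=x_1x_5-x_3x_4=x_1x_3-x_2x_5=x_1x_6-x_3x_5=x_2x_6-x_3^2=x_4x_6-x_5^2=x_1^2+x_1x_4+x_5x_7=x_1x_2+x_1^2+x_3x_7=x_1x_3+x_1x_5+x_6x_7=0$$ (a split singular del Pezzo surface of degree $6$ with one singularity, of type $\mathbf{A}_1$), and let $U\subset S$ be the complement of the lines (defined over $\overline{\mathbb{Q}}$) that are contained in $S$. For a rational point $x=[x_1:\dots:x_7]$ with $(x_1,\dots,x_7)\in\mathbb{Z}^7$ and $\gcd(x_1,\dots,x_7)=1$ let $H(x)=\max_i|x_i|$, and for real $B$ let $N_U(B)=\#\{x\in U(\mathbb{Q}): H(x)\le B\}$, which is finite. Then there exist constants $c_1,c_2\ge 0$ such that, as $B\to\infty$, $$N_U(B)=c_1B(\log B)^3+c_2B(\log B)^2+O(B\log B),$$ where $$c_1=\frac{\sigma_\infty}{144}\prod_p\Big(1-\frac1p\Big)^4\Big(1+\frac4p+\frac1{p^2}\Big),\qquad \sigma_\infty=6\int_{\{(t,u,v)\in\mathbb{R}^3:\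 t>0,\ 0<u\le 1,\ ut^2\le1,\ uv^2\le 1,\ |tv(t-v)|\le 1\}}\mathrm{d}t\,\mathrm{d}u\,\mathrm{d}v,$$ the product over all primes converges absolutely and the integral is finite. -/

import Mathlib

open MeasureTheory Filter Asymptotics
open scoped LinearAlgebra.Projectivization

namespace A1DelPezzo

/-- The nine quadrics in `x₁, …, x₇` that cut out the surface `S ⊂ ℙ⁶`; the coordinate `xᵢ` is
`x (i - 1)`. -/
def OnSurface {K : Type*} [CommRing K] (x : Fin 7 → K) : Prop :=
  let x₁ := x 0
  let x₂ := x 1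
  let x₃ := x 2
  let x₄ := x 3
  let x₅ := x 4
  let x₆ := x 5
  let x₇ := x 6
  x₁ ^ 2 - x₂ * x₄ = 0 ∧
  x₁ * x₅ - x₃ * x₄ = 0 ∧
  x₁ * x₃ - x₂ * x₅ = 0 ∧
  x₁ * x₆ - x₃ * x₅ = 0 ∧
  x₂ * x₆ - x₃ ^ 2 = 0 ∧
  x₄ * x₆ - x₅ ^ 2 = 0 ∧
  x₁ ^ 2 + x₁ * x₄ + x₅ * x₇ = 0 ∧
  x₁ * x₂ + x₁ ^ 2 + x₃ * x₇ = 0 ∧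
  x₁ * x₃ + x₁ * x₅ + x₆ * x₇ = 0

/-- The equations are homogeneous: they do not depend on the scaling of `x`. -/
theorem onSurface_smul_iff {K : Type*} [Field K] {a : K} (ha : a ≠ 0) (x : Fin 7 → K) :
    OnSurface (a • x) ↔ OnSurface x := by
  have key : ∀ (b : K) (y : Fin 7 → K), OnSurface y → OnSurface (b • y) := by
    rintro b y ⟨h1, h2, h3, h4, h5, h6, h7, h8, h9⟩
    simp only [OnSurface, Pi.smul_apply, smul_eq_mul]
    refine ⟨?_, ?_, ?_, ?_, ?_, ?_, ?_, ?_, ?_⟩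
    · linear_combination b ^ 2 * h1
    · linear_combination b ^ 2 * h2
    · linear_combination b ^ 2 * h3
    · linear_combination b ^ 2 * h4
    · linear_combination b ^ 2 * h5
    · linear_combination b ^ 2 * h6
    · linear_combination b ^ 2 * h7
    · linear_combination b ^ 2 * h8
    · linear_combination b ^ 2 * h9
  refine ⟨fun h => ?_, key a x⟩
  have := key a⁻¹ _ h
  rwa [smul_smul, inv_mul_cancel₀ ha, one_smul] at this

/-- The `K`-points of the surface `S ⊂ ℙ⁶`. -/
def surface (K : Type*) [Field K] : Set (ℙ K (Fin 7 → K)) :=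
  {P | OnSurface P.rep}

/-- Membership in the surface can be tested on any vector of homogeneous coordinates. -/
theorem mk_mem_surface_iff {K : Type*} [Field K] (x : Fin 7 → K) (hx : x ≠ 0) :
    Projectivization.mk K x hx ∈ surface K ↔ OnSurface x := by
  obtain ⟨a, ha⟩ := Projectivization.exists_smul_eq_mk_rep K x hx
  change OnSurface (Projectivization.mk K x hx).rep ↔ OnSurface x
  rw [← ha]
  exact onSurface_smul_iff a.ne_zero x

/-- `L` is (the linear span of) a line of `ℙ⁶` over the field `K` all of whose points lie on the
surface. -/
def IsLineOnSurface {K : Type*} [Field K] (L : Submodule K (Fin 7 → K)) : Prop :=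
  Module.finrank K L = 2 ∧ ∀ x ∈ L, OnSurface x

/-- The rational points of `U`, the complement in `S` of the lines contained in `S` (lines over an
algebraic closure of `ℚ`). -/
def U : Set (ℙ ℚ (Fin 7 → ℚ)) :=
  {P | P ∈ surface ℚ ∧
    ∀ L : Submodule (AlgebraicClosure ℚ) (Fin 7 → AlgebraicClosure ℚ), IsLineOnSurface L →
      (fun i => algebraMap ℚ (AlgebraicClosure ℚ) (P.rep i)) ∉ L}

/-- The height used is the naive one: the maximum norm of primitive integral homogeneous
coordinates. -/
theorem mulHeight_mk_primitive (x : Fin 7 → ℤ) (hx : Finset.univ.gcd x = 1)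
    (h0 : (fun i => (x i : ℚ)) ≠ 0) :
    (Projectivization.mk ℚ (fun i => (x i : ℚ)) h0).mulHeight = ((⨆ i, |x i| : ℤ) : ℝ) := by
  rw [Projectivization.mulHeight_mk]
  exact Rat.mulHeight_eq_max_abs_of_gcd_eq_one hx

/-- The rational points of `U` of height at most `B`. -/
def pointsUpTo (B : ℝ) : Set (ℙ ℚ (Fin 7 → ℚ)) :=
  {P | P ∈ U ∧ P.mulHeight ≤ B}

/-- The counting function `N_U(B)`. -/
noncomputable def countU (B : ℝ) : ℕ := (pointsUpTo B).ncard

/-- The region of `(t, u, v) ∈ ℝ³` whose volume defines `σ_∞`. -/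
def sigmaRegion : Set (ℝ × ℝ × ℝ) :=
  {z | let t := z.1
       let u := z.2.1
       let v := z.2.2
       0 < t ∧ 0 < u ∧ u ≤ 1 ∧ u * t ^ 2 ≤ 1 ∧ u * v ^ 2 ≤ 1 ∧ |t * v * (t - v)| ≤ 1}

/-- The real density `σ_∞`. -/
noncomputable def sigmaInfty : ℝ := 6 * ∫ _ in sigmaRegion, (1 : ℝ)

/-- The local factor `(1 - 1/p)⁴ (1 + 4/p + 1/p²)`. -/
noncomputable def eulerFactor (p : Nat.Primes) : ℝ :=
  (1 - 1 / (p : ℝ)) ^ 4 * (1 + 4 / (p : ℝ) + 1 / (p : ℝ) ^ 2)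

end A1DelPezzo

/-!
The surface is parametrized by the plane, and the rational points are counted by sieving in the
plane. On `S` one has `[x₁ : … : x₇] = param x y z` with `[x : y : z] = [x₃ : x₅ : x₆]` wherever
`x₆ ≠ 0`, and `x₆ = 0` holds exactly on the lines (`exists_line_of_eq_zero`,
`eq_zero_of_mem_line`). So the points of `U` correspond to the primitive triples `(x, y, z)` with
`z > 0`. If `gcd(z, x) = n₁`, `gcd(z, y) = n₂` and `gcd(z, x + y) = n₃`, then these are coprime in
pairs, `z = s n₁ n₂ n₃`, and the coordinates `param x y z` have content `n₁ n₂ n₃`. The condition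
`H ≤ B` then reads `s³ (n₁ n₂ n₃)² ≤ B`, `|x|, |y| ≤ √(B / s)` and `|x y (x + y)| ≤ B n₁ n₂ n₃`
(`mulHeight_param_le_iff`, `finite_pointsUpTo_and_countU_eq`).

For a fixed quadruple `(s, n₁, n₂, n₃)` the admissible pairs `(x, y)` are counted by a sieve, over
`y` for each `x` and then over `x`, where the convexity of `y (x + y)` keeps the number of intervals
bounded (`abs_ncard_pairSet_sub_le`). The result is an arithmetic density times an area, and the
errors add up to `O(B log B)` over all quadruples (`exists_sum_error_le`). The density is expanded
over divisors `d₀ ∣ s`, `dᵢ ∣ nᵢ`, with coefficients `coef` that converge absolutely. This leaves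
the sum `weightedSum` of `1 / (s n₁ n₂ n₃)` weighted with areas only (`sum_density_eq_tsum`).
Writing the areas as integrals over the region `|X Y (X + Y)| ≤ 1` of the square `[-1, 1]²` turns
the sum over `n₁, n₂, n₃` into differences of the function `∑_{a b c ≤ x} 1 / (a b c)`, whose
expansion up to `O(1)` follows from the hyperbola method (`exists_recipSum₃_asymp`). Summing over
`s` (`exists_integral_recipSum₃_sub_asymp`) and over the divisors (`exists_tsum_coef_asymp`) gives
the two terms.

The leading constant is `1 / 72` times the integral of `-log |X Y (X + Y)|` times the sum of the
coefficients. The first is `σ_∞ / 2` by the substitution `X = √u t`, `Y = -√u v`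
(`sigmaInfty_eq`), the second the Euler product (`tsum_coef_eq`).

That `c₂ ≥ 0` has two reasons. The contribution of the divisors is, up to a positive factor, the
derivative at `w = 0` of the Dirichlet series with coefficients `coef`, each Euler factor of which
is smallest at `w = 0` (`tsum_coef_mul_log_nonpos`). The contribution of the real place is
nonnegative because `∫ log² ≤ 48 ≤ 9 γ ∫ -log` for the logarithm of the cubic form
(`integral_log_cubic_sq_le`).
-/

namespace A1DelPezzo

open Real

local notation "γ" => eulerMascheroniConstant

/-! ### Sums of `(log a) ^ k / a` -/

/-- A sequence whose increments are dominated by those of `-C / √n` converges, with the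
corresponding rate. -/
theorem exists_limit_of_increment_le {u : ℕ → ℝ} {C : ℝ}
    (h : ∀ n : ℕ, 1 ≤ n → |u (n + 1) - u n| ≤ C * (1 / √n - 1 / √(n + 1 : ℕ))) :
    ∃ c, ∀ n : ℕ, 1 ≤ n → |u n - c| ≤ C * (1 / √n) := by
  have hC : 0 ≤ C := by
    have h1 := (abs_nonneg _).trans (h 1 le_rfl)
    have : 0 < 1 / √(1 : ℕ) - 1 / √(1 + 1 : ℕ) := by
      have : (1 : ℝ) < √2 := by rw [Real.lt_sqrt] <;> norm_num
      have : 1 / √2 < 1 := by rw [div_lt_one] <;> linarith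
      norm_num at *; linarith
    exact nonneg_of_mul_nonneg_left h1 this
  have key : ∀ n : ℕ, 1 ≤ n → ∀ k : ℕ,
      |u (n + k) - u n| ≤ C * (1 / √n - 1 / √(n + k : ℕ)) := by
    intro n hn k
    induction k with
    | zero => simp
    | succ k ih =>
      have := h (n + k) (by omega)
      calc |u (n + (k + 1)) - u n| ≤ |u (n + k + 1) - u (n + k)| + |u (n + k) - u n| := by
            rw [show n + (k + 1) = n + k + 1 by ring]
            exact abs_sub_le _ _ _
        _ ≤ C * (1 / √(n + k : ℕ) - 1 / √(n + k + 1 : ℕ)) + C * (1 / √n - 1 / √(n + k : ℕ)) :=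
            add_le_add this ih
        _ = _ := by rw [show n + (k + 1) = n + k + 1 by ring]; ring
  have key2 : ∀ n : ℕ, 1 ≤ n → ∀ m, n ≤ m → |u m - u n| ≤ C * (1 / √n) := by
    intro n hn m hm
    obtain ⟨k, rfl⟩ := Nat.exists_eq_add_of_le hm
    refine (key n hn k).trans ?_
    gcongr
    have : 0 ≤ 1 / √((n + k : ℕ) : ℝ) := by positivity
    linarith
  have hlim : Tendsto (fun n : ℕ => C * (1 / √(n : ℝ))) atTop (nhds 0) := by
    have : Tendsto (fun n : ℕ => √(n : ℝ)) atTop atTop :=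
      Real.tendsto_sqrt_atTop.comp tendsto_natCast_atTop_atTop
    simpa using (tendsto_const_nhds (x := C)).mul (this.inv_tendsto_atTop)
  have hcauchy : CauchySeq u := by
    rw [Metric.cauchySeq_iff']
    intro ε hε
    obtain ⟨N, hN⟩ := ((hlim.eventually (gt_mem_nhds hε)).and (eventually_ge_atTop 1)).exists
    exact ⟨N, fun n hn => (key2 N hN.2 n hn).trans_lt hN.1⟩
  obtain ⟨c, hc⟩ := cauchySeq_tendsto_of_complete hcauchy
  refine ⟨c, fun n hn => ?_⟩
  have : Tendsto (fun m => |u m - u n|) atTop (nhds |c - u n|) := (hc.sub_const _).abs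
  rw [abs_sub_comm]
  exact le_of_tendsto this (eventually_atTop.2 ⟨n, key2 n hn⟩)

/-- `∑ (log a) ^ k / a` over `1 ≤ a ≤ x`. -/
noncomputable def logSum (k : ℕ) (x : ℝ) : ℝ :=
  ∑ a ∈ Finset.Icc 1 ⌊x⌋₊, log a ^ k / (a : ℝ)

theorem log_sq_le_sqrt {x : ℝ} (hx : 1 ≤ x) : log x ^ 2 ≤ 16 * √x := by
  have h0 : 0 ≤ log x := log_nonneg hx
  have h1 : log x = 4 * log (√√x) := by
    rw [log_sqrt (by positivity), log_sqrt (by positivity)]; ring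
  have h2 : log (√√x) ≤ √√x := (log_le_sub_one_of_pos (by positivity)).trans (by linarith)
  have h3 : √√x ^ 2 = √x := Real.sq_sqrt (by positivity)
  rw [h1] at h0 ⊢
  nlinarith [sq_nonneg (√√x - log √√x)]

theorem log_sub_log_le {a b : ℝ} (ha : 0 < a) (hab : a ≤ b) : log b - log a ≤ (b - a) / a := by
  rw [← log_div (by linarith) ha.ne']
  refine (log_le_sub_one_of_pos (div_pos (by linarith) ha)).trans_eq ?_
  field_simp

theorem div_le_log_sub_log {a b : ℝ} (ha : 0 < a) (hab : a ≤ b) : (b - a) / b ≤ log b - log a := by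
  have hb : 0 < b := by linarith
  rw [← neg_sub (log a), ← log_div ha.ne' hb.ne']
  have := log_le_sub_one_of_pos (div_pos ha hb)
  rw [sub_div, div_self hb.ne']
  linarith

/-- The increments of `∑ (log a)^k / a - (log n)^(k+1) / (k+1)` are `O((log n)² / n²)`, hence
dominated by those of `-C / √n`. -/
theorem log_pow_increment_le (k : ℕ) (hk : k = 1 ∨ k = 2) (n : ℕ) (hn : 1 ≤ n) :
    |log (n + 1 : ℕ) ^ k / ((n + 1 : ℕ) : ℝ) -
      (log (n + 1 : ℕ) ^ (k + 1) / (k + 1) - log n ^ (k + 1) / (k + 1))| ≤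
      400 * (1 / √n - 1 / √(n + 1 : ℕ)) := by
  set N : ℝ := ((n + 1 : ℕ) : ℝ) with hN
  have hn' : (n : ℝ) = N - 1 := by rw [hN]; push_cast; ring
  have hn1 : (1 : ℝ) ≤ n := by exact_mod_cast hn
  have hN2 : 2 ≤ N := by linarith
  set A := log N with hA
  set δ := log N - log n with hδ
  have hA0 : 0 ≤ A := log_nonneg (by linarith)
  have hd1 : 1 / N ≤ δ := by
    have := div_le_log_sub_log (a := n) (b := N) (by linarith) (by linarith)
    rwa [hn', sub_sub_cancel, ← hn'] at this
  have hd2 : δ ≤ 1 / N + 2 / N ^ 2 := by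
    have := log_sub_log_le (a := n) (b := N) (by linarith) (by linarith)
    refine this.trans ?_
    rw [hn', sub_sub_cancel, div_add_div _ _ (by positivity) (by positivity),
      div_le_div_iff₀ (by linarith) (by positivity)]
    nlinarith [mul_nonneg (sub_nonneg.2 hN2) (by positivity : 0 ≤ N ^ 2), sq_nonneg N]
  have hd3 : δ ≤ 2 / N := by
    refine hd2.trans ?_
    rw [div_add_div _ _ (by positivity) (by positivity), div_le_div_iff₀ (by positivity) (by positivity)]
    linarith [mul_nonneg (sub_nonneg.2 hN2) (by positivity : 0 ≤ N ^ 2)]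
  have hd0 : 0 ≤ δ := le_trans (by positivity) hd1
  have hlogn : log n = A - δ := by rw [hδ, hA]; ring
  have hE : |δ - 1 / N| ≤ 2 / N ^ 2 := by rw [abs_of_nonneg (by linarith)]; linarith
  have hδ2 : δ ^ 2 ≤ 4 / N ^ 2 := by
    calc δ ^ 2 ≤ (2 / N) ^ 2 := by gcongr
      _ = 4 / N ^ 2 := by ring
  have hN1 : 1 / N ≤ 1 := by rw [div_le_one] <;> linarith
  have hmain : |A ^ k / N - (A ^ (k + 1) / (k + 1) - log n ^ (k + 1) / (k + 1))| ≤
      (10 + 4 * A ^ 2) / N ^ 2 := by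
    rw [hlogn]
    rcases hk with rfl | rfl
    · have : A ^ 1 / N - (A ^ (1 + 1) / ((1 : ℕ) + 1) - (A - δ) ^ (1 + 1) / ((1 : ℕ) + 1)) =
          -((δ - 1 / N) * A) + δ ^ 2 / 2 := by push_cast; field_simp; ring
      rw [this]
      calc _ ≤ |-((δ - 1 / N) * A)| + |δ ^ 2 / 2| := abs_add_le _ _
        _ = |δ - 1 / N| * A + δ ^ 2 / 2 := by
          rw [abs_neg, abs_mul, abs_of_nonneg hA0, abs_of_nonneg (by positivity : 0 ≤ δ ^ 2 / 2)]
        _ ≤ 2 / N ^ 2 * A + 4 / N ^ 2 / 2 := by gcongr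
        _ = (2 + 2 * A) / N ^ 2 := by ring
        _ ≤ _ := by gcongr ?_ / _; nlinarith
    · have : A ^ 2 / N - (A ^ (2 + 1) / ((2 : ℕ) + 1) - (A - δ) ^ (2 + 1) / ((2 : ℕ) + 1)) =
          -((δ - 1 / N) * A ^ 2) + δ ^ 2 * A - δ ^ 2 * δ / 3 := by push_cast; field_simp; ring
      rw [this]
      have hδ3 : δ ≤ 2 := by linarith [hd3, (by ring : 2 / N = 2 * (1 / N))]
      calc _ ≤ |-((δ - 1 / N) * A ^ 2)| + |δ ^ 2 * A| + |δ ^ 2 * δ / 3| :=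
            (abs_sub _ _).trans (by gcongr; exact abs_add_le _ _)
        _ = |δ - 1 / N| * A ^ 2 + δ ^ 2 * A + δ ^ 2 * δ / 3 := by
          rw [abs_neg, abs_mul, abs_of_nonneg (by positivity : 0 ≤ A ^ 2),
            abs_of_nonneg (by positivity : 0 ≤ δ ^ 2 * A),
            abs_of_nonneg (by positivity : 0 ≤ δ ^ 2 * δ / 3)]
        _ ≤ 2 / N ^ 2 * A ^ 2 + 4 / N ^ 2 * A + 4 / N ^ 2 * 2 / 3 := by gcongr
        _ = (2 * A ^ 2 + 4 * A + 8 / 3) / N ^ 2 := by ring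
        _ ≤ _ := by gcongr ?_ / _; linarith [sq_nonneg (A - 1)]
  refine hmain.trans ?_
  have hA2 : A ^ 2 ≤ 16 * √N := log_sq_le_sqrt (by linarith)
  set r := √N with hr
  set q := √(n : ℝ) with hq
  have hr2 : r ^ 2 = N := Real.sq_sqrt (by linarith)
  have hq2 : q ^ 2 = N - 1 := by rw [← hn']; exact Real.sq_sqrt (by linarith)
  have hq1 : 1 ≤ q := Real.one_le_sqrt.2 hn1
  have hqr : q ≤ r := Real.sqrt_le_sqrt (by linarith)
  have h1 : 1 / q - 1 / r = 1 / (q * r * (q + r)) := by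
    have : (r - q) * (q + r) = 1 := by linarith
    have hq0 : q ≠ 0 := by positivity
    have hr0 : r ≠ 0 := by linarith
    rw [eq_div_iff (by positivity)]
    linear_combination this + (r * (q + r)) * (one_div_mul_cancel hq0) -
      (q * (q + r)) * (one_div_mul_cancel hr0)
  have h2 : 1 / (2 * r ^ 3) ≤ 1 / q - 1 / r := by
    rw [h1]
    apply one_div_le_one_div_of_le (by positivity)
    calc q * r * (q + r) ≤ r * r * (r + r) := by gcongr
      _ = 2 * r ^ 3 := by ring
  calc (10 + 4 * A ^ 2) / N ^ 2 ≤ (10 * r + 4 * (16 * r)) / N ^ 2 := by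
        gcongr; linarith
    _ = 148 * (1 / (2 * r ^ 3)) := by rw [← hr2]; field_simp; ring
    _ ≤ 148 * (1 / q - 1 / r) := by gcongr
    _ ≤ _ := by
      gcongr
      · exact le_trans (by positivity) h2
      · norm_num

theorem one_le_floor_of_one_le {x : ℝ} (hx : 1 ≤ x) : 1 ≤ ⌊x⌋₊ :=
  Nat.le_floor (by simpa using hx)

theorem half_le_floor {x : ℝ} (hx : 1 ≤ x) : x / 2 ≤ (⌊x⌋₊ : ℝ) := by
  have h1 : (1 : ℝ) ≤ ⌊x⌋₊ := by exact_mod_cast one_le_floor_of_one_le hx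
  have := Nat.lt_floor_add_one x
  linarith

theorem log_floor_bounds {x : ℝ} (hx : 1 ≤ x) :
    0 ≤ log ⌊x⌋₊ ∧ log ⌊x⌋₊ ≤ log x ∧ log x - log ⌊x⌋₊ ≤ 2 / x := by
  have h1 : (1 : ℝ) ≤ ⌊x⌋₊ := by exact_mod_cast one_le_floor_of_one_le hx
  have h2 : (⌊x⌋₊ : ℝ) ≤ x := Nat.floor_le (by linarith)
  refine ⟨log_nonneg h1, log_le_log (by linarith) h2, ?_⟩
  refine (log_sub_log_le (by linarith) h2).trans ?_
  have h3 := Nat.lt_floor_add_one x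
  have h4 := half_le_floor hx
  rw [div_le_div_iff₀ (by linarith) (by linarith)]
  nlinarith

/-- `∑_{a ≤ x} (log a)^k / a = (log x)^(k+1) / (k+1) + c + O(1 / √x)` for `k = 1, 2`. -/
theorem exists_logSum_asymp (k : ℕ) (hk : k = 1 ∨ k = 2) :
    ∃ c C : ℝ, ∀ x : ℝ, 1 ≤ x →
      |logSum k x - (log x ^ (k + 1) / (k + 1) + c)| ≤ C / √x := by
  obtain ⟨c, hc⟩ := exists_limit_of_increment_le
    (u := fun n => (∑ a ∈ Finset.Icc 1 n, log a ^ k / (a : ℝ)) - log n ^ (k + 1) / (k + 1))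
    (C := 400) (fun n hn => by
      refine le_of_eq_of_le ?_ (log_pow_increment_le k hk n hn)
      rw [Finset.sum_Icc_succ_top (by omega)]
      congr 1; ring)
  refine ⟨c, 1000, fun x hx => ?_⟩
  have h := hc ⌊x⌋₊ (one_le_floor_of_one_le hx)
  obtain ⟨h1, h2, h3⟩ := log_floor_bounds hx
  have hx0 : 0 < √x := by positivity
  have hxx : √x ^ 2 = x := Real.sq_sqrt (by linarith)
  have hL0 : 0 ≤ log x := log_nonneg hx
  have hL2 : log x ^ 2 ≤ 16 * √x := log_sq_le_sqrt hx
  have hsx : 1 ≤ √x := Real.one_le_sqrt.2 hx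
  have e1 : |log (⌊x⌋₊ : ℝ) ^ (k + 1) / (k + 1) - log x ^ (k + 1) / (k + 1)| ≤ 40 / √x := by
    rw [abs_sub_comm]
    set A := log x
    set A' := log (⌊x⌋₊ : ℝ)
    have hd : (A - A') * (A ^ 2 + 1) ≤ 34 / √x := by
      calc (A - A') * (A ^ 2 + 1) ≤ 2 / x * (16 * √x + √x) := by gcongr
        _ = 34 / √x := by
          rw [div_mul_eq_mul_div, div_eq_div_iff (by linarith) hx0.ne']
          linear_combination 34 * hxx
    have hd0 : 0 ≤ A - A' := by linarith
    rcases hk with rfl | rfl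
    · have : A ^ (1 + 1) / ((1 : ℕ) + 1 : ℝ) - A' ^ (1 + 1) / ((1 : ℕ) + 1 : ℝ) =
        (A - A') * ((A + A') / 2) := by push_cast; ring
      rw [this, abs_of_nonneg (by positivity)]
      refine le_trans (mul_le_mul_of_nonneg_left ?_ hd0) (hd.trans (by gcongr; norm_num))
      linarith [sq_nonneg (A - 1)]
    · have : A ^ (2 + 1) / ((2 : ℕ) + 1 : ℝ) - A' ^ (2 + 1) / ((2 : ℕ) + 1 : ℝ) =
        (A - A') * ((A ^ 2 + A * A' + A' ^ 2) / 3) := by push_cast; ring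
      rw [this, abs_of_nonneg (by positivity)]
      refine le_trans (mul_le_mul_of_nonneg_left ?_ hd0) (hd.trans (by gcongr; norm_num))
      nlinarith
  have e2 : (400 : ℝ) * (1 / √(⌊x⌋₊ : ℝ)) ≤ 800 / √x := by
    have : √x / 2 ≤ √(⌊x⌋₊ : ℝ) := by
      apply Real.le_sqrt_of_sq_le
      have := half_le_floor hx
      linarith
    rw [show (800 : ℝ) / √x = 400 * (1 / (√x / 2)) by field_simp; norm_num]
    gcongr
  have := abs_sub_le (logSum k x - log x ^ (k + 1) / (k + 1) - c)
    (logSum k x - log (⌊x⌋₊ : ℝ) ^ (k + 1) / (k + 1) - c) 0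
  calc |logSum k x - (log x ^ (k + 1) / (k + 1) + c)|
      = |((∑ a ∈ Finset.Icc 1 ⌊x⌋₊, log a ^ k / (a : ℝ)) -
          log (⌊x⌋₊ : ℝ) ^ (k + 1) / (k + 1) - c) +
        (log (⌊x⌋₊ : ℝ) ^ (k + 1) / (k + 1) - log x ^ (k + 1) / (k + 1))| := by
        rw [logSum]; congr 1; ring
    _ ≤ 800 / √x + 40 / √x := (abs_add_le _ _).trans (add_le_add (h.trans e2) e1)
    _ ≤ 1000 / √x := by rw [← add_div]; gcongr; norm_num

/-! ### Truncated sums of reciprocals over products of one, two and three factors -/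

/-- `∑ 1 / a` over `1 ≤ a ≤ x`. -/
noncomputable def recipSum (x : ℝ) : ℝ := ∑ a ∈ Finset.Icc 1 ⌊x⌋₊, 1 / (a : ℝ)

/-- `∑ 1 / (a b)` over positive integers with `a b ≤ x`. -/
noncomputable def recipSum₂ (x : ℝ) : ℝ := ∑ a ∈ Finset.Icc 1 ⌊x⌋₊, 1 / (a : ℝ) * recipSum (x / a)

/-- `∑ 1 / (a b c)` over positive integers with `a b c ≤ x`. -/
noncomputable def recipSum₃ (x : ℝ) : ℝ := ∑ a ∈ Finset.Icc 1 ⌊x⌋₊, 1 / (a : ℝ) * recipSum₂ (x / a)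

theorem abs_recipSum_sub_le {x : ℝ} (hx : 1 ≤ x) : |recipSum x - (log x + γ)| ≤ 2 / x := by
  have hs : recipSum x = (harmonic ⌊x⌋₊ : ℝ) := by
    rw [recipSum, harmonic_eq_sum_Icc]; push_cast; simp
  have h1 := eulerMascheroniSeq_lt_eulerMascheroniConstant ⌊x⌋₊
  have h2 := eulerMascheroniConstant_lt_eulerMascheroniSeq' ⌊x⌋₊
  have hfl : (1 : ℝ) ≤ ⌊x⌋₊ := by exact_mod_cast one_le_floor_of_one_le hx
  have hne : ⌊x⌋₊ ≠ 0 := by have := one_le_floor_of_one_le hx; omega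
  rw [eulerMascheroniSeq] at h1
  rw [eulerMascheroniSeq', if_neg hne] at h2
  rw [← hs] at h1 h2
  have h3 : log x ≤ log (⌊x⌋₊ + 1 : ℝ) :=
    log_le_log (by linarith) (Nat.lt_floor_add_one x).le
  obtain ⟨_, h4, h5⟩ := log_floor_bounds hx
  have h6 : log (⌊x⌋₊ + 1 : ℝ) - log ⌊x⌋₊ ≤ 2 / x := by
    refine (log_sub_log_le (by linarith) (by linarith)).trans ?_
    have h4 := half_le_floor hx
    rw [div_le_div_iff₀ (by linarith) (by linarith)]
    linarith
  rw [abs_le]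
  constructor <;> linarith

theorem recipSum_nonneg (x : ℝ) : 0 ≤ recipSum x := Finset.sum_nonneg fun _ _ => by positivity

theorem mem_Icc_floor_div {x : ℝ} (hx : 0 ≤ x) {a b : ℕ} (ha : 1 ≤ a) :
    b ∈ Finset.Icc 1 ⌊x / a⌋₊ ↔ 1 ≤ b ∧ (a : ℝ) * b ≤ x := by
  have ha' : (0 : ℝ) < a := by exact_mod_cast ha
  rw [Finset.mem_Icc, Nat.le_floor_iff (by positivity), le_div_iff₀ ha', mul_comm]

theorem mem_Icc_floor {x : ℝ} (hx : 0 ≤ x) {a : ℕ} :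
    a ∈ Finset.Icc 1 ⌊x⌋₊ ↔ 1 ≤ a ∧ (a : ℝ) ≤ x := by
  rw [Finset.mem_Icc, Nat.le_floor_iff hx]

/-- Dirichlet's hyperbola method. -/
theorem recipSum₂_eq_hyperbola {x : ℝ} (hx : 1 ≤ x) :
    recipSum₂ x = 2 * (∑ a ∈ Finset.Icc 1 ⌊√x⌋₊, 1 / (a : ℝ) * recipSum (x / a)) -
      recipSum (√x) ^ 2 := by
  have hx0 : 0 ≤ x := by linarith
  have hs0 : 0 ≤ √x := Real.sqrt_nonneg x
  have hss : √x * √x = x := Real.mul_self_sqrt hx0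
  have hsx : √x ≤ x := by nlinarith [Real.one_le_sqrt.2 hx]
  set F : ℕ × ℕ → ℝ := fun z => 1 / (z.1 : ℝ) * (1 / (z.2 : ℝ)) with hF
  set N := ⌊x⌋₊
  set box := Finset.Icc 1 N ×ˢ Finset.Icc 1 N
  set S := box.filter fun z => (z.1 : ℝ) * z.2 ≤ x
  set S₁ := S.filter fun z => (z.1 : ℝ) ≤ √x with hS₁
  set S₂ := S.filter fun z => (z.2 : ℝ) ≤ √x with hS₂
  have hmem : ∀ z : ℕ × ℕ, z ∈ S ↔ (1 ≤ z.1 ∧ 1 ≤ z.2) ∧ (z.1 : ℝ) * z.2 ≤ x := by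
    intro z
    simp only [S, box, Finset.mem_filter, Finset.mem_product, N, mem_Icc_floor hx0]
    constructor
    · tauto
    · rintro ⟨⟨h1, h2⟩, h3⟩
      have h1' : (1 : ℝ) ≤ z.1 := by exact_mod_cast h1
      have h2' : (1 : ℝ) ≤ z.2 := by exact_mod_cast h2
      exact ⟨⟨⟨h1, by nlinarith⟩, h2, by nlinarith⟩, h3⟩
  have hnest : ∀ y : ℝ, 0 ≤ y → ∀ T : Finset (ℕ × ℕ),
      (∀ z : ℕ × ℕ, z ∈ T ↔ ((1 ≤ z.1 ∧ (z.1 : ℝ) ≤ y) ∧ 1 ≤ z.2 ∧ (z.1 : ℝ) * z.2 ≤ x)) →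
      ∑ z ∈ T, F z = ∑ a ∈ Finset.Icc 1 ⌊y⌋₊, 1 / (a : ℝ) * recipSum (x / a) := by
    intro y hy T hT
    rw [Finset.sum_finset_product T (Finset.Icc 1 ⌊y⌋₊) (fun a => Finset.Icc 1 ⌊x / a⌋₊)]
    · simp only [hF, recipSum, Finset.mul_sum]
    · intro z
      rw [hT, mem_Icc_floor hy]
      constructor
      · rintro ⟨h1, h2⟩; exact ⟨h1, (mem_Icc_floor_div hx0 h1.1).2 h2⟩
      · rintro ⟨h1, h2⟩; exact ⟨h1, (mem_Icc_floor_div hx0 h1.1).1 h2⟩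
  have hSsum : ∑ z ∈ S, F z = recipSum₂ x := by
    rw [hnest x hx0 S, recipSum₂]
    intro z
    rw [hmem]
    constructor
    · rintro ⟨⟨h1, h2⟩, h3⟩
      have h1' : (1 : ℝ) ≤ z.1 := by exact_mod_cast h1
      have h2' : (1 : ℝ) ≤ z.2 := by exact_mod_cast h2
      exact ⟨⟨h1, by nlinarith⟩, h2, h3⟩
    · tauto
  have hS₁sum : ∑ z ∈ S₁, F z = ∑ a ∈ Finset.Icc 1 ⌊√x⌋₊, 1 / (a : ℝ) * recipSum (x / a) := by
    apply hnest _ hs0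
    intro z
    rw [hS₁, Finset.mem_filter, hmem]
    tauto
  have hS₂sum : ∑ z ∈ S₂, F z = ∑ z ∈ S₁, F z := by
    refine Finset.sum_nbij' Prod.swap Prod.swap ?_ ?_ (by simp) (by simp) ?_
    · intro z hz
      simp only [hS₁, hS₂, Finset.mem_filter, hmem, Prod.fst_swap, Prod.snd_swap] at hz ⊢
      rw [mul_comm]; tauto
    · intro z hz
      simp only [hS₁, hS₂, Finset.mem_filter, hmem, Prod.fst_swap, Prod.snd_swap] at hz ⊢
      rw [mul_comm]; tauto
    · intro z _; simp only [hF, Prod.fst_swap, Prod.snd_swap]; ring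
  have hunion : S₁ ∪ S₂ = S := by
    ext z
    simp only [hS₁, hS₂, Finset.mem_union, Finset.mem_filter]
    refine ⟨by tauto, fun hz => ?_⟩
    by_cases h : (z.1 : ℝ) ≤ √x
    · exact Or.inl ⟨hz, h⟩
    · refine Or.inr ⟨hz, ?_⟩
      by_contra h'
      have := ((hmem z).1 hz).2
      push Not at h h'
      nlinarith
  have hinter : ∑ z ∈ S₁ ∩ S₂, F z = recipSum (√x) ^ 2 := by
    have : S₁ ∩ S₂ = Finset.Icc 1 ⌊√x⌋₊ ×ˢ Finset.Icc 1 ⌊√x⌋₊ := by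
      ext z
      simp only [hS₁, hS₂, Finset.mem_inter, Finset.mem_filter, Finset.mem_product, hmem,
        mem_Icc_floor hs0]
      constructor
      · tauto
      · rintro ⟨⟨h1, h2⟩, h3, h4⟩
        have : (z.1 : ℝ) * z.2 ≤ x := by
          rw [← hss]; gcongr
        tauto
    rw [this, sq, recipSum, Finset.sum_mul_sum, Finset.sum_product]
  have := Finset.sum_union_inter (s₁ := S₁) (s₂ := S₂) (f := F)
  rw [hunion, hS₂sum, hS₁sum, hSsum, hinter] at this
  linarith

theorem sum_floor_log_sub (x : ℝ) (L : ℝ) :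
    ∑ a ∈ Finset.Icc 1 ⌊x⌋₊, 1 / (a : ℝ) * (L - log a) = L * recipSum x - logSum 1 x := by
  rw [recipSum, logSum, Finset.mul_sum, ← Finset.sum_sub_distrib]
  exact Finset.sum_congr rfl fun a _ => by ring

theorem sum_floor_log_sub_sq (x : ℝ) (L : ℝ) :
    ∑ a ∈ Finset.Icc 1 ⌊x⌋₊, 1 / (a : ℝ) * (L - log a) ^ 2 =
      L ^ 2 * recipSum x - 2 * L * logSum 1 x + logSum 2 x := by
  rw [recipSum, logSum, logSum, Finset.mul_sum, Finset.mul_sum, ← Finset.sum_sub_distrib,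
    ← Finset.sum_add_distrib]
  exact Finset.sum_congr rfl fun a _ => by ring

/-- `∑_{a b ≤ x} 1 / (a b) = (log x)² / 2 + 2 γ log x + c + O(x^{-1/4})`, at `x = y²`. -/
theorem exists_recipSum₂_asymp_aux : ∃ c C : ℝ, 0 ≤ C ∧ ∀ y : ℝ, 1 ≤ y →
    |recipSum₂ (y ^ 2) - (log (y ^ 2) ^ 2 / 2 + 2 * γ * log (y ^ 2) + c)| ≤ C / √y := by
  obtain ⟨g, C, hg⟩ := exists_logSum_asymp 1 (Or.inl rfl)
  refine ⟨γ ^ 2 - 2 * g, 2 * C + 200, ?_, fun y hy => ?_⟩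
  · have := (abs_nonneg _).trans (hg 1 le_rfl)
    simp at this; linarith
  have hy0 : 0 < y := by linarith
  have hx1 : 1 ≤ y ^ 2 := one_le_pow₀ hy
  have hsq : √(y ^ 2) = y := Real.sqrt_sq hy0.le
  have hg1 := hg y hy
  have hH := abs_recipSum_sub_le hy
  have hl0 : 0 ≤ log y := log_nonneg hy
  set l := log y with hl
  have hlx : log (y ^ 2) = 2 * l := by rw [log_pow]; push_cast; ring
  have hγ0 : 0 < γ := lt_trans (by norm_num) one_half_lt_eulerMascheroniConstant
  have hγ1 : γ < 1 := eulerMascheroniConstant_lt_two_thirds.trans (by norm_num)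
  have herr : |(∑ a ∈ Finset.Icc 1 ⌊y⌋₊, 1 / (a : ℝ) * recipSum (y ^ 2 / a)) -
      ((2 * l + γ) * recipSum y - logSum 1 y)| ≤ 2 / y := by
    rw [← sum_floor_log_sub, ← Finset.sum_sub_distrib]
    refine (Finset.abs_sum_le_sum_abs _ _).trans ?_
    have : ∀ a ∈ Finset.Icc 1 ⌊y⌋₊, |1 / (a : ℝ) * recipSum (y ^ 2 / a) -
        1 / (a : ℝ) * (2 * l + γ - log a)| ≤ 2 / y ^ 2 := by
      intro a ha
      rw [mem_Icc_floor hy0.le] at ha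
      have ha1 : (1 : ℝ) ≤ a := by exact_mod_cast ha.1
      have hya : 1 ≤ y ^ 2 / a := by
        rw [le_div_iff₀ (by linarith)]; nlinarith [ha.2]
      have h := abs_recipSum_sub_le hya
      rw [log_div (by positivity) (by positivity), hlx] at h
      rw [← mul_sub, abs_mul, abs_of_nonneg (by positivity),
        show 2 * l + γ - log a = 2 * l - log a + γ by ring]
      calc 1 / (a : ℝ) * _ ≤ 1 / (a : ℝ) * (2 / (y ^ 2 / a)) := by gcongr
        _ = 2 / y ^ 2 := by field_simp
    refine (Finset.sum_le_card_nsmul _ _ _ this).trans ?_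
    rw [Nat.card_Icc, nsmul_eq_mul, Nat.add_sub_cancel]
    calc (⌊y⌋₊ : ℝ) * (2 / y ^ 2) ≤ y * (2 / y ^ 2) := by
          gcongr; exact Nat.floor_le hy0.le
      _ = 2 / y := by field_simp
  rw [recipSum₂_eq_hyperbola hx1, hsq, hlx]
  set T₁ := ∑ a ∈ Finset.Icc 1 ⌊y⌋₊, 1 / (a : ℝ) * recipSum (y ^ 2 / a)
  obtain ⟨e₁, he₁⟩ : ∃ e, e = recipSum y - (l + γ) := ⟨_, rfl⟩
  obtain ⟨e₂, he₂⟩ : ∃ e, e = logSum 1 y - (l ^ (1 + 1) / ((1 : ℕ) + 1) + g) := ⟨_, rfl⟩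
  obtain ⟨e₃, he₃⟩ : ∃ e, e = T₁ - ((2 * l + γ) * recipSum y - logSum 1 y) := ⟨_, rfl⟩
  rw [← he₁] at hH
  rw [← he₂] at hg1
  rw [← he₃] at herr
  have id : 2 * T₁ - recipSum y ^ 2 -
      ((2 * l) ^ 2 / 2 + 2 * γ * (2 * l) + (γ ^ 2 - 2 * g)) =
      2 * e₃ + 2 * l * e₁ - 2 * e₂ - e₁ ^ 2 := by
    have h1 : recipSum y = l + γ + e₁ := by rw [he₁]; ring
    have h2 : logSum 1 y = l ^ 2 / 2 + g + e₂ := by rw [he₂]; push_cast; ring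
    have h3 : T₁ = (2 * l + γ) * recipSum y - logSum 1 y + e₃ := by rw [he₃]; ring
    rw [h3, h2, h1]; ring
  rw [id]
  have hsy : 1 ≤ √y := Real.one_le_sqrt.2 hy
  have hsy2 : √y ^ 2 = y := Real.sq_sqrt hy0.le
  have hy_s : 1 / y ≤ 1 / √y := by
    apply one_div_le_one_div_of_le (by linarith); nlinarith
  have hly : l / y ≤ 2 / √y := by
    have : l ≤ 2 * √y := by
      have : l = 2 * log √y := by rw [log_sqrt hy0.le]; ring
      have := log_le_sub_one_of_pos (by positivity : 0 < √y)
      linarith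
    calc l / y ≤ 2 * √y / y := by gcongr
      _ = 2 / √y := by
        rw [div_eq_div_iff hy0.ne' (by positivity)]; linear_combination 2 * hsy2
  have he1sq : e₁ ^ 2 ≤ 4 * (1 / √y) := by
    have h1 : |e₁| ≤ 2 := hH.trans (by rw [div_le_iff₀ hy0]; linarith)
    have h2 : |e₁| ≤ 2 * (1 / √y) := hH.trans (by
      rw [show 2 / y = 2 * (1 / y) by ring]; gcongr)
    calc e₁ ^ 2 = |e₁| * |e₁| := by rw [← sq, sq_abs]
      _ ≤ 2 * (2 * (1 / √y)) := by gcongr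
      _ = _ := by ring
  calc |2 * e₃ + 2 * l * e₁ - 2 * e₂ - e₁ ^ 2|
      ≤ 2 * |e₃| + 2 * l * |e₁| + 2 * |e₂| + e₁ ^ 2 := by
        have a1 := abs_sub (2 * e₃ + 2 * l * e₁ - 2 * e₂) (e₁ ^ 2)
        have a2 := abs_sub (2 * e₃ + 2 * l * e₁) (2 * e₂)
        have a3 := abs_add_le (2 * e₃) (2 * l * e₁)
        rw [abs_mul, abs_of_pos (by norm_num : (0 : ℝ) < 2)] at a2 a3
        rw [abs_mul (2 * l), abs_of_nonneg (by positivity : 0 ≤ 2 * l)] at a3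
        rw [abs_of_nonneg (sq_nonneg e₁)] at a1
        have a4 : |2 * e₂| = 2 * |e₂| := by rw [abs_mul, abs_of_pos (by norm_num : (0 : ℝ) < 2)]
        linarith
    _ ≤ 2 * (2 / y) + 2 * l * (2 / y) + 2 * (C / √y) + 4 * (1 / √y) := by gcongr
    _ = 4 * (1 / y) + 4 * (l / y) + 2 * (C / √y) + 4 * (1 / √y) := by ring
    _ ≤ 4 * (1 / √y) + 4 * (2 / √y) + 2 * (C / √y) + 4 * (1 / √y) := by gcongr
    _ = (2 * C + 16) / √y := by ring
    _ ≤ _ := by gcongr; norm_num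

theorem exists_recipSum₂_asymp : ∃ c C : ℝ, 0 ≤ C ∧ ∀ x : ℝ, 1 ≤ x →
    |recipSum₂ x - (log x ^ 2 / 2 + 2 * γ * log x + c)| ≤ C * x ^ (-(1 / 4) : ℝ) := by
  obtain ⟨c, C, hC, h⟩ := exists_recipSum₂_asymp_aux
  refine ⟨c, C, hC, fun x hx => ?_⟩
  have := h (√x) (Real.one_le_sqrt.2 hx)
  rw [Real.sq_sqrt (by linarith)] at this
  refine this.trans_eq ?_
  rw [div_eq_mul_inv, rpow_neg (by linarith), Real.sqrt_eq_rpow, Real.sqrt_eq_rpow,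
    ← rpow_mul (by linarith)]
  norm_num

/-- The sum `∑_{a ≤ N} a^{-3/4}` is at most its integral `4 N^{1/4}`. -/
theorem sum_rpow_le (N : ℕ) :
    ∑ a ∈ Finset.Icc 1 N, 1 / (a : ℝ) * (a : ℝ) ^ (1 / 4 : ℝ) ≤ 4 * (N : ℝ) ^ (1 / 4 : ℝ) := by
  induction N with
  | zero => simp
  | succ n ih =>
    rw [Finset.sum_Icc_succ_top (by omega)]
    have hn : (0 : ℝ) < (n + 1 : ℕ) := by positivity
    have hb := rpow_one_add_le_one_add_mul_self (s := -(1 / ((n + 1 : ℕ) : ℝ))) (p := 1 / 4)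
      (by rw [neg_le_neg_iff, div_le_one hn]; push_cast; linarith [n.cast_nonneg (α := ℝ)])
      (by norm_num) (by norm_num)
    have hn2 : (n : ℝ) = (n + 1 : ℕ) * (1 + -(1 / ((n + 1 : ℕ) : ℝ))) := by
      field_simp; push_cast; ring
    have h3 : (n : ℝ) ^ (1 / 4 : ℝ) ≤
        ((n + 1 : ℕ) : ℝ) ^ (1 / 4 : ℝ) * (1 + 1 / 4 * -(1 / ((n + 1 : ℕ) : ℝ))) := by
      conv_lhs => rw [hn2]
      rw [Real.mul_rpow hn.le (by
        rw [← sub_eq_add_neg, sub_nonneg, div_le_one hn]; push_cast; linarith [n.cast_nonneg (α := ℝ)])]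
      gcongr
    have : (4 : ℝ) * (((n + 1 : ℕ) : ℝ) ^ (1 / 4 : ℝ) * (1 + 1 / 4 * -(1 / ((n + 1 : ℕ) : ℝ)))) =
      4 * ((n + 1 : ℕ) : ℝ) ^ (1 / 4 : ℝ) -
        1 / ((n + 1 : ℕ) : ℝ) * ((n + 1 : ℕ) : ℝ) ^ (1 / 4 : ℝ) := by ring
    linarith

/-- `∑_{a b c ≤ x} 1 / (a b c) = (log x)³ / 6 + (3 γ / 2) (log x)² + w log x + O(1)`. -/
theorem exists_recipSum₃_asymp : ∃ w C : ℝ, 0 ≤ C ∧ ∀ x : ℝ, 1 ≤ x →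
    |recipSum₃ x - (log x ^ 3 / 6 + 3 * γ / 2 * log x ^ 2 + w * log x)| ≤ C := by
  obtain ⟨g₁, C₁, h₁⟩ := exists_logSum_asymp 1 (Or.inl rfl)
  obtain ⟨g₂, C₂, h₂⟩ := exists_logSum_asymp 2 (Or.inr rfl)
  obtain ⟨c, C, hC, h⟩ := exists_recipSum₂_asymp
  have hγ0 : 0 < γ := lt_trans (by norm_num) one_half_lt_eulerMascheroniConstant
  have hC₁ : 0 ≤ C₁ := by
    have := (abs_nonneg _).trans (h₁ 1 le_rfl); simpa using this
  have hC₂ : 0 ≤ C₂ := by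
    have := (abs_nonneg _).trans (h₂ 1 le_rfl); simpa using this
  refine ⟨-g₁ + 2 * γ ^ 2 + c, 4 * C + 32 + 16 * γ + 2 * |c| + 2 * C₁ + 2 * γ * C₁ + C₂ +
    |g₂| + 2 * γ * |g₁| + |c * γ|, by positivity, fun x hx => ?_⟩
  have hx0 : 0 < x := by linarith
  set L := log x with hL
  have hL0 : 0 ≤ L := log_nonneg hx
  -- Inserting the expansion of `recipSum₂ (x / a)`; the errors `(a / x)^{1/4}` sum to `O(1)`.
  have herr : |recipSum₃ x - ∑ a ∈ Finset.Icc 1 ⌊x⌋₊, 1 / (a : ℝ) *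
      ((L - log a) ^ 2 / 2 + 2 * γ * (L - log a) + c)| ≤ 4 * C := by
    rw [recipSum₃, ← Finset.sum_sub_distrib]
    refine (Finset.abs_sum_le_sum_abs _ _).trans ?_
    have hb : ∀ a ∈ Finset.Icc 1 ⌊x⌋₊, |1 / (a : ℝ) * recipSum₂ (x / a) - 1 / (a : ℝ) *
      ((L - log a) ^ 2 / 2 + 2 * γ * (L - log a) + c)| ≤
        C * x ^ (-(1 / 4) : ℝ) * (1 / (a : ℝ) * (a : ℝ) ^ (1 / 4 : ℝ)) := by
      intro a ha
      rw [mem_Icc_floor hx0.le] at ha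
      have ha1 : (1 : ℝ) ≤ a := by exact_mod_cast ha.1
      have hxa : 1 ≤ x / a := by rw [le_div_iff₀ (by linarith)]; linarith [ha.2]
      have hh := h _ hxa
      rw [log_div hx0.ne' (by positivity)] at hh
      rw [← mul_sub, abs_mul, abs_of_nonneg (by positivity)]
      calc 1 / (a : ℝ) * _ ≤ 1 / (a : ℝ) * (C * (x / a) ^ (-(1 / 4) : ℝ)) := by gcongr
        _ = _ := by
          rw [Real.div_rpow hx0.le (by positivity), rpow_neg (by positivity : (0 : ℝ) ≤ a),
            div_inv_eq_mul]
          ring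
    refine (Finset.sum_le_sum hb).trans ?_
    rw [← Finset.mul_sum]
    calc C * x ^ (-(1 / 4) : ℝ) * _ ≤ C * x ^ (-(1 / 4) : ℝ) * (4 * x ^ (1 / 4 : ℝ)) := by
          gcongr
          refine (sum_rpow_le _).trans ?_
          gcongr
          exact Nat.floor_le hx0.le
      _ = 4 * C * (x ^ (-(1 / 4) : ℝ) * x ^ (1 / 4 : ℝ)) := by ring
      _ = 4 * C := by rw [← rpow_add hx0]; norm_num
  have hsum : ∑ a ∈ Finset.Icc 1 ⌊x⌋₊, 1 / (a : ℝ) *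
      ((L - log a) ^ 2 / 2 + 2 * γ * (L - log a) + c) =
      (L ^ 2 * recipSum x - 2 * L * logSum 1 x + logSum 2 x) / 2 +
        2 * γ * (L * recipSum x - logSum 1 x) + c * recipSum x := by
    rw [← sum_floor_log_sub, ← sum_floor_log_sub_sq, Finset.sum_div, Finset.mul_sum, recipSum,
      Finset.mul_sum, ← Finset.sum_add_distrib, ← Finset.sum_add_distrib]
    exact Finset.sum_congr rfl fun a _ => by ring
  have hH := abs_recipSum_sub_le hx
  have h₁x := h₁ x hx
  have h₂x := h₂ x hx
  rw [← hL] at hH h₁x h₂x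
  obtain ⟨e₀, he₀⟩ : ∃ e, e = recipSum x - (L + γ) := ⟨_, rfl⟩
  obtain ⟨e₁, he₁⟩ : ∃ e, e = logSum 1 x - (L ^ (1 + 1) / ((1 : ℕ) + 1) + g₁) := ⟨_, rfl⟩
  obtain ⟨e₂, he₂⟩ : ∃ e, e = logSum 2 x - (L ^ (2 + 1) / ((2 : ℕ) + 1) + g₂) := ⟨_, rfl⟩
  rw [← he₀] at hH
  rw [← he₁] at h₁x
  rw [← he₂] at h₂x
  rw [hsum] at herr
  have i0 : recipSum x = L + γ + e₀ := by rw [he₀]; ring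
  have i1 : logSum 1 x = L ^ 2 / 2 + g₁ + e₁ := by rw [he₁]; push_cast; ring
  have i2 : logSum 2 x = L ^ 3 / 3 + g₂ + e₂ := by rw [he₂]; push_cast; ring
  rw [i0, i1, i2] at herr
  have hsx : 1 ≤ √x := Real.one_le_sqrt.2 hx
  have hsx2 : √x ^ 2 = x := Real.sq_sqrt hx0.le
  have hLs : L ≤ 2 * √x := by
    have : L = 2 * log √x := by rw [log_sqrt hx0.le]; ring
    have := log_le_sub_one_of_pos (by positivity : 0 < √x)
    linarith
  have hL2 : L ^ 2 ≤ 16 * √x := log_sq_le_sqrt hx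
  have hsxx : √x ≤ x := by nlinarith
  have b0 : |e₀| ≤ 2 := hH.trans (by rw [div_le_iff₀ hx0]; linarith)
  have b0' : |L * e₀| ≤ 4 := by
    rw [abs_mul, abs_of_nonneg hL0]
    calc L * |e₀| ≤ 2 * √x * (2 / x) := by gcongr
      _ = 4 * (√x / x) := by ring
      _ ≤ 4 * 1 := by gcongr; rw [div_le_one hx0]; exact hsxx
      _ = 4 := by ring
  have b0'' : |L ^ 2 * e₀| ≤ 32 := by
    rw [abs_mul, abs_of_nonneg (by positivity)]
    calc L ^ 2 * |e₀| ≤ 16 * √x * (2 / x) := by gcongr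
      _ = 32 * (√x / x) := by ring
      _ ≤ 32 * 1 := by gcongr; rw [div_le_one hx0]; exact hsxx
      _ = 32 := by ring
  have b1 : |e₁| ≤ C₁ := h₁x.trans (div_le_self hC₁ hsx)
  have b1' : |L * e₁| ≤ 2 * C₁ := by
    rw [abs_mul, abs_of_nonneg hL0]
    calc L * |e₁| ≤ 2 * √x * (C₁ / √x) := by gcongr
      _ = 2 * C₁ := by field_simp
  have b2 : |e₂| ≤ C₂ := h₂x.trans (div_le_self hC₂ hsx)
  have hid : recipSum₃ x - (L ^ 3 / 6 + 3 * γ / 2 * L ^ 2 + (-g₁ + 2 * γ ^ 2 + c) * L) =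
      (recipSum₃ x - ((L ^ 2 * (L + γ + e₀) - 2 * L * (L ^ 2 / 2 + g₁ + e₁) +
        (L ^ 3 / 3 + g₂ + e₂)) / 2 + 2 * γ * (L * (L + γ + e₀) - (L ^ 2 / 2 + g₁ + e₁)) +
        c * (L + γ + e₀))) + (L ^ 2 * e₀ / 2 - L * e₁ + (g₂ + e₂) / 2 +
          2 * γ * (L * e₀) - 2 * γ * (g₁ + e₁) + c * γ + c * e₀) := by ring
  rw [hid]
  refine (abs_add_le _ _).trans ?_
  have b3 : |c * e₀| ≤ 2 * |c| := by rw [abs_mul]; nlinarith [abs_nonneg c]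
  have hγ0' := hγ0.le
  have rest : |L ^ 2 * e₀ / 2 - L * e₁ + (g₂ + e₂) / 2 + 2 * γ * (L * e₀) - 2 * γ * (g₁ + e₁) +
      c * γ + c * e₀| ≤ 16 + 2 * C₁ + (|g₂| + C₂) / 2 + 2 * γ * 4 + 2 * γ * (|g₁| + C₁) +
        |c * γ| + 2 * |c| := by
    have k1 : |L ^ 2 * e₀ / 2| ≤ 16 := by rw [abs_div, abs_two]; linarith
    have k2 : |(g₂ + e₂) / 2| ≤ (|g₂| + C₂) / 2 := by
      rw [abs_div, abs_two]; gcongr; exact (abs_add_le _ _).trans (by gcongr)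
    have k3 : |2 * γ * (L * e₀)| ≤ 2 * γ * 4 := by
      rw [abs_mul, abs_of_nonneg (by positivity)]; gcongr
    have k4 : |2 * γ * (g₁ + e₁)| ≤ 2 * γ * (|g₁| + C₁) := by
      rw [abs_mul, abs_of_nonneg (by positivity)]; gcongr
      exact (abs_add_le _ _).trans (by gcongr)
    rw [abs_le] at *
    have := abs_le.1 (le_refl |c * γ|)
    constructor <;> linarith [b1'.1, b1'.2, b3.1, b3.2, this.1, this.2]
  have p1 : 0 ≤ |g₂| := abs_nonneg _
  have p2 : 0 ≤ γ * C₁ := by positivity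
  linarith [herr, rest]

theorem recipSum_mono : Monotone recipSum := fun _ _ h =>
  Finset.sum_le_sum_of_subset_of_nonneg (Finset.Icc_subset_Icc_right (Nat.floor_mono h))
    fun _ _ _ => by positivity

theorem recipSum₂_nonneg (x : ℝ) : 0 ≤ recipSum₂ x :=
  Finset.sum_nonneg fun _ _ => mul_nonneg (by positivity) (recipSum_nonneg _)

theorem recipSum₂_mono : Monotone recipSum₂ := fun x y h =>
  (Finset.sum_le_sum fun a _ => mul_le_mul_of_nonneg_left
      (recipSum_mono (div_le_div_of_nonneg_right h a.cast_nonneg)) (by positivity)).trans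
    (Finset.sum_le_sum_of_subset_of_nonneg (Finset.Icc_subset_Icc_right (Nat.floor_mono h))
      fun _ _ _ => mul_nonneg (by positivity) (recipSum_nonneg _))

theorem recipSum₃_nonneg (x : ℝ) : 0 ≤ recipSum₃ x :=
  Finset.sum_nonneg fun _ _ => mul_nonneg (by positivity) (recipSum₂_nonneg _)

theorem recipSum₃_mono : Monotone recipSum₃ := fun x y h =>
  (Finset.sum_le_sum fun a _ => mul_le_mul_of_nonneg_left
      (recipSum₂_mono (div_le_div_of_nonneg_right h a.cast_nonneg)) (by positivity)).trans
    (Finset.sum_le_sum_of_subset_of_nonneg (Finset.Icc_subset_Icc_right (Nat.floor_mono h))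
      fun _ _ _ => mul_nonneg (by positivity) (recipSum₂_nonneg _))

theorem recipSum₃_of_lt_one {x : ℝ} (hx : x < 1) : recipSum₃ x = 0 := by
  rw [recipSum₃, Nat.floor_eq_zero.2 hx]; simp

/-- The difference of `recipSum₃` at `Z` and `f Z`, uniformly in `0 < f ≤ 1`: the error depends on
`f` only. -/
theorem exists_recipSum₃_sub_asymp : ∃ C : ℝ, 0 ≤ C ∧ ∀ Z f : ℝ, 1 ≤ Z → 0 < f → f ≤ 1 →
    |recipSum₃ Z - recipSum₃ (f * Z) -
      ((log Z ^ 2 / 2 + 3 * γ * log Z) * (-log f) - log Z / 2 * (-log f) ^ 2)| ≤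
      C * (1 - log f) ^ 3 := by
  obtain ⟨w, C, hC, h⟩ := exists_recipSum₃_asymp
  have hγ0 : 0 < γ := lt_trans (by norm_num) one_half_lt_eulerMascheroniConstant
  have hγ1 : γ < 1 := eulerMascheroniConstant_lt_two_thirds.trans (by norm_num)
  refine ⟨2 * C + |w| + 20, by positivity, fun Z f hZ hf hf1 => ?_⟩
  have h1 := h Z hZ
  have hl0 : 0 ≤ log Z := log_nonneg hZ
  have hm0 : 0 ≤ -log f := by have := log_nonpos hf.le hf1; linarith
  obtain ⟨l, hl⟩ : ∃ l, l = log Z := ⟨_, rfl⟩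
  obtain ⟨m, hm⟩ : ∃ m, m = -log f := ⟨_, rfl⟩
  rw [show 1 - log f = 1 + m by rw [hm]; ring]
  rw [← hl] at h1 hl0 ⊢
  rw [← hm] at hm0 ⊢
  have hm1 : 1 + m ≤ (1 + m) ^ 3 := by linarith [mul_nonneg hm0 hm0, mul_nonneg (mul_nonneg hm0 hm0) hm0]
  have hm2 : m ^ 2 ≤ (1 + m) ^ 3 := by linarith [mul_nonneg hm0 hm0, mul_nonneg (mul_nonneg hm0 hm0) hm0]
  have hm3 : m ^ 3 ≤ (1 + m) ^ 3 := by gcongr; linarith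
  have hm4 : m ≤ (1 + m) ^ 3 := by linarith
  have hm5 : 1 ≤ (1 + m) ^ 3 := by linarith
  rw [abs_le] at h1
  have hw := abs_le.1 (le_refl |w|)
  have hw0 := abs_nonneg w
  rcases le_or_gt 1 (f * Z) with hfZ | hfZ
  · have h2 := h _ hfZ
    rw [log_mul hf.ne' (by linarith), show log f = -m by rw [hm]; ring, ← hl, abs_le] at h2
    have e1 : |w * m| ≤ |w| * (1 + m) ^ 3 := by
      rw [abs_mul, abs_of_nonneg hm0]; gcongr
    rw [abs_le] at e1 ⊢
    have e2 : γ * m ^ 2 ≤ (1 + m) ^ 3 := by nlinarith [sq_nonneg m]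
    have e3 : 0 ≤ γ * m ^ 2 := by positivity
    have e4 : 0 ≤ m ^ 3 := by positivity
    have e5 : C ≤ C * (1 + m) ^ 3 := le_mul_of_one_le_right hC hm5
    constructor <;> linarith
  · rw [recipSum₃_of_lt_one hfZ, sub_zero]
    have hlm : l ≤ m := by
      have := log_neg (by positivity) hfZ
      rw [log_mul hf.ne' (by linarith)] at this
      linarith
    have b1 : l ^ 3 ≤ m ^ 3 := by gcongr
    have b2 : l ^ 2 ≤ m ^ 2 := by gcongr
    have b3 : l ^ 2 * m ≤ m ^ 2 * m := by gcongr
    have b4 : l * m ^ 2 ≤ m * m ^ 2 := by gcongr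
    have b5 : l * m ≤ m * m := by gcongr
    have p1 : 0 ≤ l ^ 3 := by positivity
    have p2 : 0 ≤ l ^ 2 := by positivity
    have p3 : 0 ≤ l ^ 2 * m := by positivity
    have p4 : 0 ≤ l * m ^ 2 := by positivity
    have p5 : 0 ≤ l * m := by positivity
    have q2 : γ * l ^ 2 ≤ m ^ 2 := by nlinarith
    have q2' : 0 ≤ γ * l ^ 2 := by positivity
    have q5 : γ * (l * m) ≤ m * m := by nlinarith
    have q5' : 0 ≤ γ * (l * m) := by positivity
    have e1 : |w * l| ≤ |w| * (1 + m) ^ 3 := by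
      rw [abs_mul, abs_of_nonneg hl0]; gcongr; linarith
    have e5 : C ≤ C * (1 + m) ^ 3 := le_mul_of_one_le_right hC hm5
    rw [abs_le] at e1 ⊢
    constructor <;> linarith

/-- The moments of orders `0`, `1` and `2` of `log S - log s` for the weights `1 / s`, `s ≤ S`. They
arise because `log (Q / s³) = 3 (log S - log s)` for `S = Q^{1/3}`. -/
theorem exists_sum_log_sub_asymp : ∃ C : ℝ, 0 ≤ C ∧ ∀ S : ℝ, 1 ≤ S →
    recipSum S ≤ C * (1 + log S) ∧
    |(∑ s ∈ Finset.Icc 1 ⌊S⌋₊, 1 / (s : ℝ) * (log S - log s)) - log S ^ 2 / 2| ≤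
      C * (1 + log S) ∧
    |(∑ s ∈ Finset.Icc 1 ⌊S⌋₊, 1 / (s : ℝ) * (log S - log s) ^ 2) -
      (log S ^ 3 / 3 + γ * log S ^ 2)| ≤ C * (1 + log S) := by
  obtain ⟨g₁, C₁, h₁⟩ := exists_logSum_asymp 1 (Or.inl rfl)
  obtain ⟨g₂, C₂, h₂⟩ := exists_logSum_asymp 2 (Or.inr rfl)
  have hγ0 : 0 < γ := lt_trans (by norm_num) one_half_lt_eulerMascheroniConstant
  have hγ1 : γ < 1 := eulerMascheroniConstant_lt_two_thirds.trans (by norm_num)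
  have hC₁ : 0 ≤ C₁ := by
    have := (abs_nonneg _).trans (h₁ 1 le_rfl); simpa using this
  have hC₂ : 0 ≤ C₂ := by
    have := (abs_nonneg _).trans (h₂ 1 le_rfl); simpa using this
  refine ⟨100 + 4 * C₁ + C₂ + 2 * |g₁| + |g₂|, by positivity, fun x hx => ?_⟩
  have hx0 : 0 < x := by linarith
  rw [sum_floor_log_sub, sum_floor_log_sub_sq]
  set L := log x with hL
  have hL0 : 0 ≤ L := log_nonneg hx
  have hH := abs_recipSum_sub_le hx
  have h₁x := h₁ x hx
  have h₂x := h₂ x hx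
  rw [← hL] at hH h₁x h₂x
  obtain ⟨e₀, he₀⟩ : ∃ e, e = recipSum x - (L + γ) := ⟨_, rfl⟩
  obtain ⟨e₁, he₁⟩ : ∃ e, e = logSum 1 x - (L ^ (1 + 1) / ((1 : ℕ) + 1) + g₁) := ⟨_, rfl⟩
  obtain ⟨e₂, he₂⟩ : ∃ e, e = logSum 2 x - (L ^ (2 + 1) / ((2 : ℕ) + 1) + g₂) := ⟨_, rfl⟩
  rw [← he₀] at hH
  rw [← he₁] at h₁x
  rw [← he₂] at h₂x
  have i0 : recipSum x = L + γ + e₀ := by rw [he₀]; ring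
  have i1 : logSum 1 x = L ^ 2 / 2 + g₁ + e₁ := by rw [he₁]; push_cast; ring
  have i2 : logSum 2 x = L ^ 3 / 3 + g₂ + e₂ := by rw [he₂]; push_cast; ring
  have hsx : 1 ≤ √x := Real.one_le_sqrt.2 hx
  have hsx2 : √x ^ 2 = x := Real.sq_sqrt hx0.le
  have hL2 : L ^ 2 ≤ 16 * √x := log_sq_le_sqrt hx
  have hsxx : √x ≤ x := by nlinarith
  have b0 : |e₀| ≤ 2 := hH.trans (by rw [div_le_iff₀ hx0]; linarith)
  have b0'' : |L ^ 2 * e₀| ≤ 32 := by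
    rw [abs_mul, abs_of_nonneg (by positivity)]
    calc L ^ 2 * |e₀| ≤ 16 * √x * (2 / x) := by gcongr
      _ = 32 * (√x / x) := by ring
      _ ≤ 32 * 1 := by gcongr; rw [div_le_one hx0]; exact hsxx
      _ = 32 := by ring
  have b1 : |e₁| ≤ C₁ := h₁x.trans (div_le_self hC₁ hsx)
  have b2 : |e₂| ≤ C₂ := h₂x.trans (div_le_self hC₂ hsx)
  have a1 := abs_le.1 (le_refl |g₁|)
  have a2 := abs_le.1 (le_refl |g₂|)
  have b0' : |L * e₀| ≤ 2 * L := by rw [abs_mul, abs_of_nonneg hL0]; nlinarith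
  have b1' : |L * e₁| ≤ L * C₁ := by rw [abs_mul, abs_of_nonneg hL0]; gcongr
  have b3 : |L * g₁| ≤ L * |g₁| := by rw [abs_mul, abs_of_nonneg hL0]
  have p1 : 0 ≤ L * C₁ := by positivity
  have p2 : 0 ≤ L * C₂ := by positivity
  have p3 : 0 ≤ L * |g₁| := by positivity
  have p4 : 0 ≤ L * |g₂| := by positivity
  have p5 : γ * L ≤ L := by nlinarith
  have p6 : 0 ≤ γ * L := by positivity
  have p7 : 0 ≤ |g₁| := by positivity
  have p8 : 0 ≤ |g₂| := by positivity
  rw [i0, i1, i2]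
  rw [abs_le] at b0 b0' b0'' b1 b1' b2 b3
  refine ⟨by linarith, ?_, ?_⟩ <;> rw [abs_le] <;> constructor <;> linarith

/-- The asymptotic expansion of the average over `f` of the sum over `s` of the differences of
`recipSum₃`, where `Z_s = √(Q / s³)`. -/
theorem exists_integral_recipSum₃_sub_asymp {X : Type*} [MeasurableSpace X] (μ : Measure X)
    [IsFiniteMeasure μ] (f : X → ℝ) (hf : Measurable f) (hf0 : ∀ᵐ p ∂μ, 0 < f p ∧ f p ≤ 1)
    (hint : Integrable (fun p => (1 - log (f p)) ^ 3) μ) :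
    ∃ C : ℝ, 0 ≤ C ∧ ∀ Q : ℝ, 1 ≤ Q →
      |(∑ s ∈ Finset.Icc 1 ⌊Q ^ (1 / 3 : ℝ)⌋₊, 1 / (s : ℝ) *
        ∫ p, (recipSum₃ √(Q / s ^ 3) - recipSum₃ (f p * √(Q / s ^ 3))) ∂μ) -
        ((∫ p, -log (f p) ∂μ) / 72 * log Q ^ 3 +
          (9 * γ * (∫ p, -log (f p) ∂μ) - ∫ p, (-log (f p)) ^ 2 ∂μ) / 24 * log Q ^ 2)| ≤
        C * (1 + log Q) := by
  obtain ⟨C₁, hC₁, h₁⟩ := exists_recipSum₃_sub_asymp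
  obtain ⟨C₂, hC₂, h₂⟩ := exists_sum_log_sub_asymp
  have hlogm : Measurable fun p => log (f p) := measurable_log.comp hf
  have hint1 : Integrable (fun p => -log (f p)) μ := by
    refine hint.mono hlogm.neg.aestronglyMeasurable ?_
    filter_upwards [hf0] with p hp
    have h0 := log_nonpos hp.1.le hp.2
    obtain ⟨m, hm⟩ : ∃ m, m = -log (f p) := ⟨_, rfl⟩
    have hm0 : 0 ≤ m := by linarith
    rw [show 1 - log (f p) = 1 + m by rw [hm]; ring, ← hm, norm_of_nonneg hm0,
      norm_of_nonneg (by positivity)]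
    linarith [mul_nonneg hm0 hm0, mul_nonneg (mul_nonneg hm0 hm0) hm0]
  have hint2 : Integrable (fun p => (-log (f p)) ^ 2) μ := by
    refine hint.mono (hlogm.neg.pow_const 2).aestronglyMeasurable ?_
    filter_upwards [hf0] with p hp
    have h0 := log_nonpos hp.1.le hp.2
    obtain ⟨m, hm⟩ : ∃ m, m = -log (f p) := ⟨_, rfl⟩
    have hm0 : 0 ≤ m := by linarith
    rw [show 1 - log (f p) = 1 + m by rw [hm]; ring, ← hm, norm_of_nonneg (by positivity),
      norm_of_nonneg (by positivity)]
    linarith [mul_nonneg hm0 hm0, mul_nonneg (mul_nonneg hm0 hm0) hm0]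
  set I₁ := ∫ p, -log (f p) ∂μ with hI₁
  set I₂ := ∫ p, (-log (f p)) ^ 2 ∂μ with hI₂
  set K := C₁ * ∫ p, (1 - log (f p)) ^ 3 ∂μ with hK
  have hI₁0 : 0 ≤ I₁ := integral_nonneg_of_ae (by
    filter_upwards [hf0] with p hp; have := log_nonpos hp.1.le hp.2; simp; linarith)
  have hI₂0 : 0 ≤ I₂ := integral_nonneg fun p => by positivity
  have hK0 : 0 ≤ K := mul_nonneg hC₁ (integral_nonneg_of_ae (by
    filter_upwards [hf0] with p hp
    have := log_nonpos hp.1.le hp.2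
    have : 0 ≤ 1 - log (f p) := by linarith
    simp only [Pi.zero_apply]; positivity))
  have hγ0 : 0 < γ := lt_trans (by norm_num) one_half_lt_eulerMascheroniConstant
  have inner : ∀ Z : ℝ, 1 ≤ Z → |(∫ p, (recipSum₃ Z - recipSum₃ (f p * Z)) ∂μ) -
      ((log Z ^ 2 / 2 + 3 * γ * log Z) * I₁ - log Z / 2 * I₂)| ≤ K := by
    intro Z hZ
    have hmeas : Measurable fun p => recipSum₃ (f p * Z) :=
      recipSum₃_mono.measurable.comp (hf.mul_const Z)
    have hint3 : Integrable (fun p => recipSum₃ Z - recipSum₃ (f p * Z)) μ := by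
      refine Integrable.of_bound (measurable_const.sub hmeas).aestronglyMeasurable (recipSum₃ Z) ?_
      filter_upwards [hf0] with p hp
      have h1 := recipSum₃_nonneg (f p * Z)
      have h2 : recipSum₃ (f p * Z) ≤ recipSum₃ Z := recipSum₃_mono (by nlinarith)
      rw [norm_of_nonneg (by linarith)]; linarith
    have hint4 : Integrable (fun p => (log Z ^ 2 / 2 + 3 * γ * log Z) * (-log (f p)) -
        log Z / 2 * (-log (f p)) ^ 2) μ := (hint1.const_mul _).sub (hint2.const_mul _)
    rw [hI₁, hI₂, ← integral_const_mul, ← integral_const_mul, ← integral_sub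
      (hint1.const_mul _) (hint2.const_mul _), ← integral_sub hint3 hint4, hK, ← integral_const_mul]
    refine (abs_integral_le_integral_abs).trans (integral_mono_ae ?_ (hint.const_mul _) ?_)
    · exact (hint3.sub hint4).abs
    · filter_upwards [hf0] with p hp
      exact h₁ Z (f p) hZ hp.1 hp.2
  refine ⟨K * C₂ + 9 / 8 * I₁ * C₂ + 3 / 4 * (6 * γ * I₁ + I₂) * C₂, by positivity,
    fun Q hQ => ?_⟩
  have hQ0 : 0 < Q := by linarith
  set S := Q ^ (1 / 3 : ℝ) with hS
  have hS1 : 1 ≤ S := one_le_rpow hQ (by norm_num)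
  have hS3 : S ^ 3 = Q := by
    rw [hS, ← rpow_natCast, ← rpow_mul hQ0.le]; norm_num
  have hlogS : log Q = 3 * log S := by rw [← hS3, log_pow]; push_cast; ring
  obtain ⟨k1, k2, k3⟩ := h₂ S hS1
  set Λ := log S with hΛ
  have hΛ0 : 0 ≤ Λ := log_nonneg hS1
  have hsum : |(∑ s ∈ Finset.Icc 1 ⌊S⌋₊, 1 / (s : ℝ) *
        ∫ p, (recipSum₃ √(Q / s ^ 3) - recipSum₃ (f p * √(Q / s ^ 3))) ∂μ) -
      ∑ s ∈ Finset.Icc 1 ⌊S⌋₊, 1 / (s : ℝ) * (9 / 8 * I₁ * (Λ - log s) ^ 2 +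
        3 / 4 * (6 * γ * I₁ - I₂) * (Λ - log s))| ≤ K * recipSum S := by
    rw [← Finset.sum_sub_distrib, recipSum, Finset.mul_sum]
    refine (Finset.abs_sum_le_sum_abs _ _).trans (Finset.sum_le_sum fun s hs => ?_)
    rw [mem_Icc_floor (by linarith)] at hs
    have hs1 : (1 : ℝ) ≤ s := by exact_mod_cast hs.1
    have hs3 : (1 : ℝ) ≤ Q / s ^ 3 := by
      rw [le_div_iff₀ (by positivity), one_mul, ← hS3]
      gcongr; exact hs.2
    have hlogZ : log √(Q / s ^ 3) = 3 / 2 * (Λ - log s) := by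
      rw [log_sqrt (by positivity), log_div hQ0.ne' (by positivity), hlogS, log_pow]
      push_cast; ring
    have := inner √(Q / s ^ 3) (Real.one_le_sqrt.2 hs3)
    rw [hlogZ] at this
    rw [← mul_sub, abs_mul, abs_of_nonneg (by positivity), mul_comm K]
    gcongr
    refine le_trans (le_of_eq ?_) this
    congr 1; ring
  have hsplit : ∑ s ∈ Finset.Icc 1 ⌊S⌋₊, 1 / (s : ℝ) * (9 / 8 * I₁ * (Λ - log s) ^ 2 +
        3 / 4 * (6 * γ * I₁ - I₂) * (Λ - log s)) =
      9 / 8 * I₁ * (∑ s ∈ Finset.Icc 1 ⌊S⌋₊, 1 / (s : ℝ) * (Λ - log s) ^ 2) +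
        3 / 4 * (6 * γ * I₁ - I₂) * ∑ s ∈ Finset.Icc 1 ⌊S⌋₊, 1 / (s : ℝ) * (Λ - log s) := by
    rw [Finset.mul_sum, Finset.mul_sum, ← Finset.sum_add_distrib]
    exact Finset.sum_congr rfl fun s _ => by ring
  rw [hsplit] at hsum
  rw [hlogS]
  set T₀ := ∑ s ∈ Finset.Icc 1 ⌊S⌋₊, 1 / (s : ℝ) *
        ∫ p, (recipSum₃ √(Q / s ^ 3) - recipSum₃ (f p * √(Q / s ^ 3))) ∂μ
  set T₁ := ∑ s ∈ Finset.Icc 1 ⌊S⌋₊, 1 / (s : ℝ) * (Λ - log s)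
  set T₂ := ∑ s ∈ Finset.Icc 1 ⌊S⌋₊, 1 / (s : ℝ) * (Λ - log s) ^ 2
  have hid : T₀ - (I₁ / 72 * (3 * Λ) ^ 3 + (9 * γ * I₁ - I₂) / 24 * (3 * Λ) ^ 2) =
      (T₀ - (9 / 8 * I₁ * T₂ + 3 / 4 * (6 * γ * I₁ - I₂) * T₁)) +
      9 / 8 * I₁ * (T₂ - (Λ ^ 3 / 3 + γ * Λ ^ 2)) +
      3 / 4 * (6 * γ * I₁ - I₂) * (T₁ - Λ ^ 2 / 2) := by ring
  rw [hid]
  have hb : |6 * γ * I₁ - I₂| ≤ 6 * γ * I₁ + I₂ := by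
    have : 0 ≤ 6 * γ * I₁ := by positivity
    rw [abs_le]; constructor <;> linarith
  calc _ ≤ |T₀ - (9 / 8 * I₁ * T₂ + 3 / 4 * (6 * γ * I₁ - I₂) * T₁)| +
        |9 / 8 * I₁ * (T₂ - (Λ ^ 3 / 3 + γ * Λ ^ 2))| +
        |3 / 4 * (6 * γ * I₁ - I₂) * (T₁ - Λ ^ 2 / 2)| := abs_add_three _ _ _
    _ = |T₀ - (9 / 8 * I₁ * T₂ + 3 / 4 * (6 * γ * I₁ - I₂) * T₁)| +
        9 / 8 * I₁ * |T₂ - (Λ ^ 3 / 3 + γ * Λ ^ 2)| +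
        3 / 4 * |6 * γ * I₁ - I₂| * |T₁ - Λ ^ 2 / 2| := by
      rw [abs_mul (9 / 8 * I₁), abs_of_nonneg (by positivity : 0 ≤ 9 / 8 * I₁), abs_mul, abs_mul,
        abs_of_nonneg (by norm_num : (0 : ℝ) ≤ 3 / 4)]
    _ ≤ K * (C₂ * (1 + Λ)) + 9 / 8 * I₁ * (C₂ * (1 + Λ)) +
        3 / 4 * (6 * γ * I₁ + I₂) * (C₂ * (1 + Λ)) := by
      gcongr
      exact hsum.trans (by gcongr)
    _ = (K * C₂ + 9 / 8 * I₁ * C₂ + 3 / 4 * (6 * γ * I₁ + I₂) * C₂) * (1 + Λ) := by ring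
    _ ≤ _ := by gcongr; linarith

/-! ### Functions given by a product over the prime factorization -/

section FactProd

variable {R : Type*} [CommMonoid R]

theorem factorization_prod_mul_of_coprime (g : ℕ → ℕ → R) {m n : ℕ} (h : m.Coprime n) :
    (m * n).factorization.prod g = m.factorization.prod g * n.factorization.prod g := by
  rw [Nat.factorization_mul_of_coprime h]
  exact Finsupp.prod_add_index_of_disjoint (by simpa using h.disjoint_primeFactors) g

theorem factorization_prod_prime_pow (g : ℕ → ℕ → R) (h0 : ∀ p, g p 0 = 1) {p : ℕ}
    (hp : p.Prime) (k : ℕ) : (p ^ k).factorization.prod g = g p k := by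
  rw [hp.factorization_pow, Finsupp.prod_single_index (h0 p)]

end FactProd

/-! ### The arithmetic density and its Möbius transform -/

/-- The density of the admissible pairs modulo a prime `p`, where `a = 1 / p` and the four truth
values say which of `s, n₁, n₂, n₃` are divisible by `p`. -/
def locDensity (a : ℝ) (b₀ b₁ b₂ b₃ : Bool) : ℝ :=
  match b₀, b₁, b₂, b₃ with
  | false, false, false, false => 1
  | true, false, false, false => (1 - a) * (1 - 2 * a)
  | false, true, false, false => 1 - a
  | false, false, true, false => 1 - a
  | false, false, false, true => 1 - a
  | true, true, false, false => (1 - a) ^ 2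
  | true, false, true, false => (1 - a) ^ 2
  | true, false, false, true => (1 - a) ^ 2
  | _, _, _, _ => 0

/-- The density of the admissible pairs `(x, y)` among those with `n₁ ∣ x`, `n₂ ∣ y`,
`n₃ ∣ x + y`. -/
noncomputable def density (s n₁ n₂ n₃ : ℕ) : ℝ :=
  ∏ p ∈ (s * n₁ * n₂ * n₃).primeFactors,
    locDensity (1 / (p : ℝ)) (decide (p ∣ s)) (decide (p ∣ n₁)) (decide (p ∣ n₂)) (decide (p ∣ n₃))

/-- The Möbius transform of `locDensity` over subsets of `{s, n₁, n₂, n₃}`; the subset is encoded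
by the binary digits of `j < 16`, starting with the digit of `s`. The values at `j ≥ 16` are `0`. -/
def locMoebius (a : ℝ) (j : ℕ) : ℝ :=
  match j with
  | 0 => 1
  | 1 => -3 * a + 2 * a ^ 2
  | 2 => -a
  | 4 => -a
  | 8 => -a
  | 3 => 2 * a - a ^ 2
  | 5 => 2 * a - a ^ 2
  | 9 => 2 * a - a ^ 2
  | 6 => -1 + 2 * a
  | 10 => -1 + 2 * a
  | 12 => -1 + 2 * a
  | 7 => -a
  | 11 => -a
  | 13 => -a
  | 14 => 2 - 3 * a
  | 15 => a ^ 2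
  | _ => 0

theorem locMoebius_of_le {a : ℝ} {j : ℕ} (hj : 16 ≤ j) : locMoebius a j = 0 := by
  unfold locMoebius
  split <;> first | omega | rfl

theorem sum_locMoebius (a : ℝ) (b₀ b₁ b₂ b₃ : Bool) :
    ∑ j ∈ Finset.range 16, (if (j.testBit 0 → b₀) ∧ (j.testBit 1 → b₁) ∧ (j.testBit 2 → b₂) ∧
      (j.testBit 3 → b₃) then locMoebius a j else 0) = locDensity a b₀ b₁ b₂ b₃ := by
  cases b₀ <;> cases b₁ <;> cases b₂ <;> cases b₃ <;>
    simp +decide only [Finset.sum_range_succ, Finset.sum_range_zero, locMoebius, locDensity,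
      if_true, if_false] <;> ring

/-- The quadruple `(d₀, d₁, d₂, d₃)` of squarefree numbers is encoded in
`m = d₀ d₁² d₂⁴ d₃⁸`; this recovers `dᵢ`. -/
def part (i m : ℕ) : ℕ := m.factorization.prod fun p j => if j.testBit i then p else 1

/-- The multiplicative function with local values `locMoebius`. -/
noncomputable def moebiusDensity (m : ℕ) : ℝ :=
  m.factorization.prod fun p j => locMoebius (1 / (p : ℝ)) j

theorem part_mul (i : ℕ) {m n : ℕ} (h : m.Coprime n) : part i (m * n) = part i m * part i n :=
  factorization_prod_mul_of_coprime _ h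

theorem part_prime_pow (i : ℕ) {p : ℕ} (hp : p.Prime) (k : ℕ) :
    part i (p ^ k) = if k.testBit i then p else 1 :=
  factorization_prod_prime_pow (fun p j => if j.testBit i then p else 1) (by simp) hp k

theorem moebiusDensity_mul {m n : ℕ} (h : m.Coprime n) :
    moebiusDensity (m * n) = moebiusDensity m * moebiusDensity n :=
  factorization_prod_mul_of_coprime _ h

theorem moebiusDensity_prime_pow {p : ℕ} (hp : p.Prime) (k : ℕ) :
    moebiusDensity (p ^ k) = locMoebius (1 / (p : ℝ)) k :=
  factorization_prod_prime_pow (fun p j => locMoebius (1 / (p : ℝ)) j) (by simp [locMoebius]) hp k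

theorem moebiusDensity_one : moebiusDensity 1 = 1 := by simp [moebiusDensity]

theorem part_one (i : ℕ) : part i 1 = 1 := by simp [part]

theorem part_pos (i m : ℕ) : 0 < part i m := by
  unfold part Finsupp.prod
  refine Finset.prod_pos fun p hp => ?_
  have := Nat.pos_of_mem_primeFactors (Nat.support_factorization m ▸ hp)
  beta_reduce
  split <;> omega

theorem part_dvd_self (i : ℕ) {m : ℕ} (hm : m ≠ 0) : part i m ∣ m := by
  conv_rhs => rw [← Nat.prod_factorization_pow_eq_self hm]
  refine Finset.prod_dvd_prod_of_dvd _ _ fun p hp => ?_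
  dsimp only
  split
  · exact dvd_pow_self p (Finsupp.mem_support_iff.1 hp)
  · exact one_dvd _

theorem part_coprime (i : ℕ) {m n : ℕ} (hm : m ≠ 0) (hn : n ≠ 0) (h : m.Coprime n) :
    (part i m).Coprime (part i n) :=
  Nat.Coprime.coprime_dvd_left (part_dvd_self i hm) (h.coprime_dvd_right (part_dvd_self i hn))

theorem dvd_part_of_testBit {i m p : ℕ} (hp : p ∈ m.primeFactors)
    (h : (m.factorization p).testBit i) : p ∣ part i m := by
  have := Finset.dvd_prod_of_mem (fun p => if (m.factorization p).testBit i then p else 1)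
    (Nat.support_factorization m ▸ hp : p ∈ m.factorization.support)
  rwa [if_pos h] at this

/-- All four squarefree numbers encoded by `m` divide the corresponding `s, n₁, n₂, n₃`. -/
def PartsDvd (s n₁ n₂ n₃ m : ℕ) : Prop :=
  part 0 m ∣ s ∧ part 1 m ∣ n₁ ∧ part 2 m ∣ n₂ ∧ part 3 m ∣ n₃

instance (s n₁ n₂ n₃ m : ℕ) : Decidable (PartsDvd s n₁ n₂ n₃ m) := by
  unfold PartsDvd; infer_instance

/-- Only finitely many `m` contribute to a given density: their prime exponents are at most `15`. -/
theorem dvd_pow_of_partsDvd {s n₁ n₂ n₃ m : ℕ} (hm : m ≠ 0) (hN : s * n₁ * n₂ * n₃ ≠ 0)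
    (hk : moebiusDensity m ≠ 0) (h : PartsDvd s n₁ n₂ n₃ m) : m ∣ (s * n₁ * n₂ * n₃) ^ 15 := by
  rw [← Nat.factorization_le_iff_dvd hm (pow_ne_zero _ hN)]
  intro p
  by_cases hp : p ∈ m.primeFactors
  · have hj : m.factorization p < 16 := by
      by_contra hj
      refine hk ?_
      unfold moebiusDensity Finsupp.prod
      exact Finset.prod_eq_zero (i := p) (by rwa [Nat.support_factorization])
        (locMoebius_of_le (not_lt.1 hj))
    have hj0 : m.factorization p ≠ 0 := Finsupp.mem_support_iff.1 (Nat.support_factorization m ▸ hp)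
    have hpN : p ∣ s * n₁ * n₂ * n₃ := by
      have hbit : (m.factorization p).testBit 0 ∨ (m.factorization p).testBit 1 ∨
          (m.factorization p).testBit 2 ∨ (m.factorization p).testBit 3 := by
        generalize m.factorization p = j at hj hj0
        interval_cases j <;> simp_all [Nat.testBit]
      obtain ⟨h0, h1, h2, h3⟩ := h
      rcases hbit with hb | hb | hb | hb
      · exact (((dvd_part_of_testBit hp hb).trans h0).mul_right _).mul_right _ |>.mul_right _
      · exact (((dvd_part_of_testBit hp hb).trans h1).mul_left _).mul_right _ |>.mul_right _
      · exact (((dvd_part_of_testBit hp hb).trans h2).mul_left _).mul_right _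
      · exact ((dvd_part_of_testBit hp hb).trans h3).mul_left _
    have hpp := Nat.prime_of_mem_primeFactors hp
    have := (hpp.dvd_iff_one_le_factorization hN).1 hpN
    rw [Nat.factorization_pow]
    simp only [Finsupp.smul_apply, smul_eq_mul]
    omega
  · rw [← Nat.support_factorization, Finsupp.notMem_support_iff] at hp
    rw [hp]; exact Nat.zero_le _

/-- `m ↦ moebiusDensity m` restricted to those `m` with `PartsDvd`, as an arithmetic function. -/
noncomputable def moebiusRestrict (s n₁ n₂ n₃ : ℕ) : ArithmeticFunction ℝ :=
  ⟨fun m => if m = 0 then 0 else if PartsDvd s n₁ n₂ n₃ m then moebiusDensity m else 0, by simp⟩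

theorem moebiusRestrict_apply (s n₁ n₂ n₃ : ℕ) {m : ℕ} (hm : m ≠ 0) :
    moebiusRestrict s n₁ n₂ n₃ m = if PartsDvd s n₁ n₂ n₃ m then moebiusDensity m else 0 := by
  simp [moebiusRestrict, hm]

theorem partsDvd_mul (s n₁ n₂ n₃ : ℕ) {m n : ℕ} (hm : m ≠ 0) (hn : n ≠ 0) (h : m.Coprime n) :
    PartsDvd s n₁ n₂ n₃ (m * n) ↔ PartsDvd s n₁ n₂ n₃ m ∧ PartsDvd s n₁ n₂ n₃ n := by
  have key : ∀ i v, part i (m * n) ∣ v ↔ part i m ∣ v ∧ part i n ∣ v := fun i v => by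
    rw [part_mul i h]
    exact ⟨fun hd => ⟨(dvd_mul_right _ _).trans hd, (dvd_mul_left _ _).trans hd⟩,
      fun hd => (part_coprime i hm hn h).mul_dvd_of_dvd_of_dvd hd.1 hd.2⟩
  simp only [PartsDvd, key]
  tauto

theorem moebiusRestrict_isMultiplicative (s n₁ n₂ n₃ : ℕ) :
    (moebiusRestrict s n₁ n₂ n₃).IsMultiplicative := by
  rw [ArithmeticFunction.IsMultiplicative.iff_ne_zero]
  refine ⟨?_, fun {m n} hm hn h => ?_⟩
  · rw [moebiusRestrict_apply _ _ _ _ one_ne_zero, moebiusDensity_one, if_pos]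
    simp [PartsDvd, part_one]
  · rw [moebiusRestrict_apply _ _ _ _ hm, moebiusRestrict_apply _ _ _ _ hn,
      moebiusRestrict_apply _ _ _ _ (mul_ne_zero hm hn), moebiusDensity_mul h]
    simp only [partsDvd_mul s n₁ n₂ n₃ hm hn h]
    by_cases h1 : PartsDvd s n₁ n₂ n₃ m <;> by_cases h2 : PartsDvd s n₁ n₂ n₃ n <;> simp [h1, h2]

theorem moebiusRestrict_prime_pow (s n₁ n₂ n₃ : ℕ) {p : ℕ} (hp : p.Prime) (j : ℕ) :
    moebiusRestrict s n₁ n₂ n₃ (p ^ j) =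
      if (j.testBit 0 → decide (p ∣ s)) ∧ (j.testBit 1 → decide (p ∣ n₁)) ∧
        (j.testBit 2 → decide (p ∣ n₂)) ∧ (j.testBit 3 → decide (p ∣ n₃))
      then locMoebius (1 / (p : ℝ)) j else 0 := by
  rw [moebiusRestrict_apply _ _ _ _ (pow_ne_zero _ hp.ne_zero), moebiusDensity_prime_pow hp]
  have key : ∀ i v, part i (p ^ j) ∣ v ↔ (j.testBit i → decide (p ∣ v)) := fun i v => by
    rw [part_prime_pow i hp]
    by_cases h : j.testBit i <;> simp [h]
  simp only [PartsDvd, key]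

/-- The density is a sum over the divisor quadruples `d₀ ∣ s`, `dᵢ ∣ nᵢ`. -/
theorem density_eq_sum {s n₁ n₂ n₃ : ℕ} (hN : s * n₁ * n₂ * n₃ ≠ 0) :
    density s n₁ n₂ n₃ =
      ∑ m ∈ ((s * n₁ * n₂ * n₃) ^ 15).divisors, moebiusRestrict s n₁ n₂ n₃ m := by
  set N := s * n₁ * n₂ * n₃
  have hmul := (moebiusRestrict_isMultiplicative s n₁ n₂ n₃).mul
    (ArithmeticFunction.isMultiplicative_zeta.natCast (R := ℝ))
  rw [← ArithmeticFunction.coe_mul_zeta_apply,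
    ArithmeticFunction.IsMultiplicative.multiplicative_factorization _ hmul (pow_ne_zero _ hN),
    density, Finsupp.prod, Nat.support_factorization, Nat.primeFactors_pow _ (by norm_num)]
  refine Finset.prod_congr rfl fun p hp => ?_
  have hpp := Nat.prime_of_mem_primeFactors hp
  have hk : 15 ≤ (N ^ 15).factorization p := by
    have := (hpp.dvd_iff_one_le_factorization hN).1 (Nat.dvd_of_mem_primeFactors hp)
    rw [Nat.factorization_pow]
    simp only [Finsupp.smul_apply, smul_eq_mul]
    omega
  rw [ArithmeticFunction.coe_mul_zeta_apply, Nat.sum_divisors_prime_pow hpp, ← sum_locMoebius]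
  refine Finset.sum_subset_zero_on_sdiff (Finset.range_subset_range.2 (by omega)) ?_ ?_
  · intro j hj
    simp only [Finset.mem_sdiff, Finset.mem_range, not_lt] at hj
    rw [moebiusRestrict_prime_pow _ _ _ _ hpp, locMoebius_of_le hj.2, ite_self]
  · intro j _
    rw [moebiusRestrict_prime_pow _ _ _ _ hpp]

theorem hasSum_density {s n₁ n₂ n₃ : ℕ} (hN : s * n₁ * n₂ * n₃ ≠ 0) :
    HasSum (moebiusRestrict s n₁ n₂ n₃) (density s n₁ n₂ n₃) := by
  rw [density_eq_sum hN]
  apply hasSum_sum_of_ne_finset_zero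
  intro m hm
  by_contra hne
  apply hm
  have hm0 : m ≠ 0 := by rintro rfl; simp at hne
  rw [moebiusRestrict_apply _ _ _ _ hm0] at hne
  have hP : PartsDvd s n₁ n₂ n₃ m := by by_contra h; simp [h] at hne
  rw [if_pos hP] at hne
  rw [Nat.mem_divisors]
  exact ⟨dvd_pow_of_partsDvd hm0 hN hne hP, pow_ne_zero _ hN⟩

/-! ### Absolute convergence and Euler products -/

/-- A nonnegative multiplicative function whose sums over the powers of the primes `p` are at most
`1 + g p`, with `g` summable, is summable. -/
theorem summable_of_multiplicative_of_le {f g : ℕ → ℝ} (hf : ∀ n, 0 ≤ f n) (hf0 : f 0 = 0)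
    (hf1 : f 1 = 1) (hmul : ∀ {m n : ℕ}, m.Coprime n → f (m * n) = f m * f n)
    (hsum : ∀ {p : ℕ}, p.Prime → Summable fun n => f (p ^ n))
    (hg : ∀ n, 0 ≤ g n) (hgs : Summable g) (hle : ∀ {p : ℕ}, p.Prime → ∑' n, f (p ^ n) ≤ 1 + g p) :
    Summable f := by
  refine summable_of_sum_le (c := exp (∑' n, g n)) hf fun u => ?_
  set N := u.sup id + 1
  obtain ⟨h1, h2⟩ := EulerProduct.summable_and_hasSum_smoothNumbers_prod_primesBelow_tsum
    (f := f) hf1 hmul (fun {p} hp => by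
      simpa only [norm_of_nonneg (hf _)] using hsum hp) N
  have hsub : ∀ n ∈ u.erase 0, n ∈ N.smoothNumbers := fun n hn => by
    rw [Finset.mem_erase] at hn
    exact Nat.mem_smoothNumbers_of_lt (Nat.pos_of_ne_zero hn.1)
      (Nat.lt_succ_of_le (Finset.le_sup (f := id) hn.2))
  have h3 : ∑ n ∈ u, f n ≤ ∏ p ∈ N.primesBelow, ∑' n, f (p ^ n) := by
    calc ∑ n ∈ u, f n = ∑ n ∈ u.erase 0, f n := (Finset.sum_erase u hf0).symm
      _ = ∑ n ∈ (u.erase 0).subtype (· ∈ N.smoothNumbers), f n := by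
        rw [Finset.sum_subtype_of_mem (fun n => f n) hsub]
      _ ≤ ∑' m : N.smoothNumbers, f m :=
        h2.summable.sum_le_tsum _ fun m _ => hf m
      _ = _ := h2.tsum_eq
  refine h3.trans ?_
  calc ∏ p ∈ N.primesBelow, ∑' n, f (p ^ n) ≤ ∏ p ∈ N.primesBelow, exp (g p) := by
        refine Finset.prod_le_prod (fun p _ => tsum_nonneg fun n => hf _) fun p hp => ?_
        refine (hle (Nat.prime_of_mem_primesBelow hp)).trans ?_
        rw [add_comm]; exact add_one_le_exp _
    _ = exp (∑ p ∈ N.primesBelow, g p) := (exp_sum _ _).symm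
    _ ≤ _ := exp_le_exp.2 (hgs.sum_le_tsum _ fun n _ => hg n)

/-- The product `d₀ d₁ d₂ d₃` of the parts of `m`. -/
def partsProd (m : ℕ) : ℕ := part 0 m * part 1 m * part 2 m * part 3 m

/-- The number `d₀³ (d₁ d₂ d₃)²`. -/
def partsHeight (m : ℕ) : ℕ := part 0 m ^ 3 * (part 1 m * part 2 m * part 3 m) ^ 2

theorem partsHeight_pos (m : ℕ) : 0 < partsHeight m := by
  have h0 := part_pos 0 m
  have h1 := part_pos 1 m
  have h2 := part_pos 2 m
  have h3 := part_pos 3 m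
  unfold partsHeight; positivity

theorem one_le_partsHeight (m : ℕ) : (1 : ℝ) ≤ partsHeight m := by
  exact_mod_cast partsHeight_pos m

/-- The coefficient of `m` in the expansion of the density, divided by `d₀ d₁ d₂ d₃`. -/
noncomputable def coef (m : ℕ) : ℝ := if m = 0 then 0 else moebiusDensity m / partsProd m

theorem coef_zero : coef 0 = 0 := if_pos rfl

theorem coef_one : coef 1 = 1 := by
  simp [coef, moebiusDensity_one, partsProd, part_one]

theorem partsHeight_one : partsHeight 1 = 1 := by simp [partsHeight, part_one]

theorem partsHeight_mul {m n : ℕ} (h : m.Coprime n) :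
    partsHeight (m * n) = partsHeight m * partsHeight n := by
  simp only [partsHeight, part_mul _ h]; ring

theorem coef_mul {m n : ℕ} (h : m.Coprime n) : coef (m * n) = coef m * coef n := by
  rcases eq_or_ne m 0 with rfl | hm
  · simp [coef_zero]
  rcases eq_or_ne n 0 with rfl | hn
  · simp [coef_zero]
  simp only [coef, hm, hn, mul_ne_zero hm hn, if_false, moebiusDensity_mul h, partsProd,
    part_mul _ h]
  push_cast
  ring

/-- The number of elements of the subset encoded by `j < 16`. -/
def digitCount (j : ℕ) : ℕ :=
  (j.testBit 0).toNat + (j.testBit 1).toNat + (j.testBit 2).toNat + (j.testBit 3).toNat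

/-- The exponent of `p` in `partsHeight (p ^ j)`. -/
def digitHeight (j : ℕ) : ℕ :=
  3 * (j.testBit 0).toNat + 2 * ((j.testBit 1).toNat + (j.testBit 2).toNat + (j.testBit 3).toNat)

theorem part_prime_pow_eq_pow (i : ℕ) {p : ℕ} (hp : p.Prime) (k : ℕ) :
    part i (p ^ k) = p ^ (k.testBit i).toNat := by
  rw [part_prime_pow i hp]; cases k.testBit i <;> simp

theorem coef_prime_pow {p : ℕ} (hp : p.Prime) (j : ℕ) :
    coef (p ^ j) = locMoebius (1 / (p : ℝ)) j * (1 / (p : ℝ)) ^ digitCount j := by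
  rw [coef, if_neg (pow_ne_zero _ hp.ne_zero), moebiusDensity_prime_pow hp, partsProd]
  simp only [part_prime_pow_eq_pow _ hp, ← pow_add]
  rw [digitCount]
  push_cast
  rw [one_div, inv_pow, div_eq_mul_inv]

theorem partsHeight_prime_pow {p : ℕ} (hp : p.Prime) (j : ℕ) :
    partsHeight (p ^ j) = p ^ digitHeight j := by
  rw [partsHeight, digitHeight]
  simp only [part_prime_pow_eq_pow _ hp, ← pow_add, ← pow_mul]
  congr 1; ring

theorem digitHeight_le (j : ℕ) : digitHeight j ≤ 9 := by
  have h0 := Bool.toNat_le (j.testBit 0)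
  have h1 := Bool.toNat_le (j.testBit 1)
  have h2 := Bool.toNat_le (j.testBit 2)
  have h3 := Bool.toNat_le (j.testBit 3)
  unfold digitHeight; omega

/-- The coefficients of `m = p ^ j` are `O(1 / p²)`: subsets of size one come with a transform
`O(1 / p)`, larger ones with at least two factors `1 / p`. -/
theorem abs_locMoebius_mul_le {a : ℝ} (ha0 : 0 ≤ a) (ha : a ≤ 1 / 2) {j : ℕ} (hj0 : j ≠ 0) :
    |locMoebius a j| * a ^ digitCount j ≤ 3 * a ^ 2 := by
  rcases Nat.lt_or_ge j 16 with hj | hj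
  · have hp3 : a ^ 3 ≤ a ^ 2 := by
      nlinarith [sq_nonneg a]
    have hp4 : a ^ 4 ≤ a ^ 2 := by nlinarith [sq_nonneg a, sq_nonneg (a ^ 2)]
    have h1 : |(-3 * a + 2 * a ^ 2)| ≤ 3 * a := by rw [abs_le]; constructor <;> nlinarith
    have h2 : |(-a)| ≤ a := by rw [abs_neg, abs_of_nonneg ha0]
    have h3 : |2 * a - a ^ 2| ≤ 3 := by rw [abs_le]; constructor <;> nlinarith
    have h4 : |(-1 + 2 * a)| ≤ 3 := by rw [abs_le]; constructor <;> linarith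
    have h5 : |(-a)| ≤ 3 := by linarith
    have h6 : |2 - 3 * a| ≤ 3 := by rw [abs_le]; constructor <;> linarith
    have h7 : |a ^ 2| ≤ 3 := by rw [abs_le]; constructor <;> nlinarith
    have hsq : 0 ≤ a ^ 2 := sq_nonneg a
    interval_cases j
    · exact absurd rfl hj0
    · change |(-3 * a + 2 * a ^ 2)| * a ^ 1 ≤ _; nlinarith
    · change |(-a)| * a ^ 1 ≤ _; nlinarith
    · change |2 * a - a ^ 2| * a ^ 2 ≤ _; gcongr
    · change |(-a)| * a ^ 1 ≤ _; nlinarith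
    · change |2 * a - a ^ 2| * a ^ 2 ≤ _; gcongr
    · change |(-1 + 2 * a)| * a ^ 2 ≤ _; gcongr
    · change |(-a)| * a ^ 3 ≤ _; gcongr
    · change |(-a)| * a ^ 1 ≤ _; nlinarith
    · change |2 * a - a ^ 2| * a ^ 2 ≤ _; gcongr
    · change |(-1 + 2 * a)| * a ^ 2 ≤ _; gcongr
    · change |(-a)| * a ^ 3 ≤ _; gcongr
    · change |(-1 + 2 * a)| * a ^ 2 ≤ _; gcongr
    · change |(-a)| * a ^ 3 ≤ _; gcongr
    · change |2 - 3 * a| * a ^ 3 ≤ _; gcongr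
    · change |a ^ 2| * a ^ 4 ≤ _; gcongr
  · rw [locMoebius_of_le hj, abs_zero, zero_mul]; positivity

theorem rpow_partsHeight_prime_pow {p : ℕ} (hp : p.Prime) (j : ℕ) (w : ℝ) :
    (partsHeight (p ^ j) : ℝ) ^ w = ((p : ℝ) ^ w) ^ digitHeight j := by
  rw [partsHeight_prime_pow hp]
  push_cast
  rw [← rpow_natCast, ← rpow_mul p.cast_nonneg, ← rpow_natCast, ← rpow_mul p.cast_nonneg, mul_comm]

/-- The coefficients converge absolutely, with a small power of the height to spare. -/
theorem summable_coef_mul_rpow :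
    Summable fun m => |coef m| * (partsHeight m : ℝ) ^ (1 / 20 : ℝ) := by
  have hval : ∀ {p : ℕ}, p.Prime → ∀ j, |coef (p ^ j)| * (partsHeight (p ^ j) : ℝ) ^ (1 / 20 : ℝ) =
      |locMoebius (1 / (p : ℝ)) j| * (1 / (p : ℝ)) ^ digitCount j *
        ((p : ℝ) ^ (1 / 20 : ℝ)) ^ digitHeight j := fun {p} hp j => by
    rw [coef_prime_pow hp, rpow_partsHeight_prime_pow hp, abs_mul,
      abs_of_nonneg (by positivity : 0 ≤ (1 / (p : ℝ)) ^ digitCount j)]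
  have hzero : ∀ {p : ℕ}, p.Prime → ∀ j ∉ Finset.range 16,
      |coef (p ^ j)| * (partsHeight (p ^ j) : ℝ) ^ (1 / 20 : ℝ) = 0 := fun {p} hp j hj => by
    rw [hval hp, locMoebius_of_le (by simpa using hj)]; simp
  refine summable_of_multiplicative_of_le (g := fun n => 45 * (n : ℝ) ^ (-(31 / 20) : ℝ))
    (fun n => by positivity) (by simp [coef_zero]) (by simp [coef_one, partsHeight_one]) ?_
    (fun {p} hp => summable_of_ne_finset_zero (hzero hp)) (fun n => by positivity)
    ((Real.summable_nat_rpow.2 (by norm_num)).mul_left _) (fun {p} hp => ?_)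
  · intro m n h
    rw [coef_mul h, partsHeight_mul h, abs_mul]
    push_cast
    rw [mul_rpow (by positivity) (by positivity)]
    ring
  · have hp2 : (2 : ℝ) ≤ p := by exact_mod_cast hp.two_le
    have hp0 : (0 : ℝ) < p := by linarith
    have ha : 1 / (p : ℝ) ≤ 1 / 2 := one_div_le_one_div_of_le (by norm_num) hp2
    have hT : 1 ≤ (p : ℝ) ^ (1 / 20 : ℝ) := one_le_rpow (by linarith) (by norm_num)
    rw [tsum_eq_sum (hzero hp), Finset.sum_range_succ']
    simp only [hval hp]
    have hterm : ∀ j ∈ Finset.range 15, |locMoebius (1 / (p : ℝ)) (j + 1)| *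
        (1 / (p : ℝ)) ^ digitCount (j + 1) * ((p : ℝ) ^ (1 / 20 : ℝ)) ^ digitHeight (j + 1) ≤
        3 * (p : ℝ) ^ (-(31 / 20) : ℝ) := fun j _ => by
      calc _ ≤ 3 * (1 / (p : ℝ)) ^ 2 * ((p : ℝ) ^ (1 / 20 : ℝ)) ^ 9 := by
            refine mul_le_mul (abs_locMoebius_mul_le (by positivity) ha (by omega))
              (pow_le_pow_right₀ hT (digitHeight_le _)) (by positivity) (by positivity)
        _ = 3 * ((p : ℝ) ^ (-2 : ℝ) * (p : ℝ) ^ (9 / 20 : ℝ)) := by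
            rw [← rpow_natCast ((p : ℝ) ^ (1 / 20 : ℝ)), ← rpow_mul hp0.le, rpow_neg hp0.le]
            norm_num
            ring
        _ = _ := by rw [← rpow_add hp0]; norm_num
    have h0 : |locMoebius (1 / (p : ℝ)) 0| * (1 / (p : ℝ)) ^ digitCount 0 *
        ((p : ℝ) ^ (1 / 20 : ℝ)) ^ digitHeight 0 = 1 := by
      simp [locMoebius, digitCount, digitHeight]
    rw [h0, add_comm]
    gcongr
    refine (Finset.sum_le_card_nsmul _ _ _ hterm).trans_eq ?_
    rw [Finset.card_range, nsmul_eq_mul]; push_cast; ring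

/-- The constant comes from `log x ≤ 60 x^{1/60}`. -/
theorem one_add_log_cube_le {x : ℝ} (hx : 1 ≤ x) : (1 + log x) ^ 3 ≤ 61 ^ 3 * x ^ (1 / 20 : ℝ) := by
  have h1 : log x ≤ x ^ (1 / 60 : ℝ) / (1 / 60) := log_le_rpow_div (by linarith) (by norm_num)
  have h2 : 1 ≤ x ^ (1 / 60 : ℝ) := one_le_rpow hx (by norm_num)
  have h3 : 0 ≤ log x := log_nonneg hx
  calc (1 + log x) ^ 3 ≤ (61 * x ^ (1 / 60 : ℝ)) ^ 3 := by gcongr; linarith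
    _ = 61 ^ 3 * x ^ (1 / 20 : ℝ) := by
      rw [mul_pow, ← rpow_natCast (x ^ (1 / 60 : ℝ)), ← rpow_mul (by linarith)]; norm_num

theorem summable_coef_mul_log_cube :
    Summable fun m => |coef m| * (1 + log (partsHeight m)) ^ 3 := by
  refine Summable.of_nonneg_of_le (fun m => ?_) (fun m => ?_)
    (summable_coef_mul_rpow.mul_left (61 ^ 3))
  · have := log_nonneg (one_le_partsHeight m); positivity
  · have := one_add_log_cube_le (one_le_partsHeight m)
    calc |coef m| * (1 + log (partsHeight m)) ^ 3
        ≤ |coef m| * (61 ^ 3 * (partsHeight m : ℝ) ^ (1 / 20 : ℝ)) := by gcongr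
      _ = _ := by ring

theorem summable_abs_coef : Summable fun m => |coef m| :=
  Summable.of_nonneg_of_le (fun m => abs_nonneg _) (fun m =>
    le_mul_of_one_le_right (abs_nonneg _) (one_le_rpow (one_le_partsHeight m) (by norm_num)))
    summable_coef_mul_rpow

theorem summable_abs_coef_mul_log : Summable fun m => |coef m| * log (partsHeight m) :=
  Summable.of_nonneg_of_le
    (fun m => mul_nonneg (abs_nonneg _) (log_nonneg (one_le_partsHeight m))) (fun m => by
      have h := log_nonneg (one_le_partsHeight m)
      gcongr
      linarith [mul_nonneg h h, mul_nonneg (mul_nonneg h h) h]) summable_coef_mul_log_cube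

/-- The local factor of the Dirichlet series `∑ coef m * (partsHeight m)^{-w}` at `p`, as a
polynomial in `a = 1 / p` and `T = p ^ {-w}`. -/
noncomputable def localSeries (a T : ℝ) : ℝ :=
  1 + T ^ 3 * a * (-3 * a + 2 * a ^ 2) - 3 * T ^ 2 * a ^ 2 + 3 * T ^ 5 * a ^ 2 * (2 * a - a ^ 2) +
    3 * T ^ 4 * a ^ 2 * (-1 + 2 * a) - 3 * T ^ 7 * a ^ 4 + T ^ 6 * a ^ 3 * (2 - 3 * a) + T ^ 9 * a ^ 6

theorem sum_locMoebius_mul (a T : ℝ) :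
    ∑ j ∈ Finset.range 16, locMoebius a j * a ^ digitCount j * T ^ digitHeight j =
      localSeries a T := by
  simp only [Finset.sum_range_succ, Finset.sum_range_zero, locMoebius, localSeries]
  simp only [digitCount, digitHeight, Nat.toNat_testBit]
  norm_num
  ring

theorem summable_norm_coef_mul_rpow {w : ℝ} (hw : 0 ≤ w) :
    Summable fun m => ‖coef m * (partsHeight m : ℝ) ^ (-w)‖ := by
  refine Summable.of_nonneg_of_le (fun m => norm_nonneg _) (fun m => ?_) summable_abs_coef
  rw [norm_mul, norm_of_nonneg (by positivity : 0 ≤ (partsHeight m : ℝ) ^ (-w)), norm_eq_abs]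
  exact mul_le_of_le_one_right (abs_nonneg _)
    (rpow_le_one_of_one_le_of_nonpos (one_le_partsHeight m) (by linarith))

/-- The Euler product of the Dirichlet series `∑ coef m * (partsHeight m)^{-w}`. -/
theorem hasProd_localSeries {w : ℝ} (hw : 0 ≤ w) :
    HasProd (fun p : Nat.Primes => localSeries (1 / (p : ℝ)) ((p : ℝ) ^ (-w)))
      (∑' m, coef m * (partsHeight m : ℝ) ^ (-w)) := by
  have h := EulerProduct.eulerProduct_hasProd
    (f := fun m => coef m * (partsHeight m : ℝ) ^ (-w)) (by simp [coef_one, partsHeight_one])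
    (fun {m n} hmn => by
      rw [coef_mul hmn, partsHeight_mul hmn]
      push_cast
      rw [mul_rpow (by positivity) (by positivity)]
      ring) (summable_norm_coef_mul_rpow hw) (by simp [coef_zero])
  refine (congrArg (HasProd · _) (funext fun p => ?_)).mpr h
  have hval : ∀ j, coef ((p : ℕ) ^ j) * (partsHeight ((p : ℕ) ^ j) : ℝ) ^ (-w) =
      locMoebius (1 / (p : ℝ)) j * (1 / (p : ℝ)) ^ digitCount j *
        ((p : ℝ) ^ (-w)) ^ digitHeight j := fun j => by
    rw [coef_prime_pow p.2, rpow_partsHeight_prime_pow p.2]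
  rw [tsum_eq_sum (s := Finset.range 16) fun j hj => by
    rw [hval, locMoebius_of_le (by simpa using hj)]; simp]
  simp only [hval]
  rw [sum_locMoebius_mul]

theorem localSeries_one (a : ℝ) : localSeries a 1 = (1 - a) ^ 4 * (1 + 4 * a + a ^ 2) := by
  unfold localSeries; ring

/-- The local factors on `0 ≤ T ≤ 1` are smallest at `T = 1`; this makes the second constant
nonnegative. -/
theorem localSeries_one_le {a T : ℝ} (ha0 : 0 ≤ a) (ha : a ≤ 1 / 2) (hT0 : 0 ≤ T) (hT : T ≤ 1) :
    localSeries a 1 ≤ localSeries a T := by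
  have hid : localSeries a T - localSeries a 1 =
      a ^ 2 * ((3 - 2 * a) * (1 - T ^ 3) + 3 * (1 - T ^ 2) - 3 * (2 * a - a ^ 2) * (1 - T ^ 5) +
        3 * (1 - 2 * a) * (1 - T ^ 4) + 3 * a ^ 2 * (1 - T ^ 7) - a * (2 - 3 * a) * (1 - T ^ 6) -
        a ^ 4 * (1 - T ^ 9)) := by unfold localSeries; ring
  suffices 0 ≤ localSeries a T - localSeries a 1 by linarith
  rw [hid]
  refine mul_nonneg (sq_nonneg a) ?_
  have h2 : 0 ≤ 1 - T ^ 2 := by nlinarith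
  have h3 : 0 ≤ 1 - T ^ 3 := sub_nonneg.2 (pow_le_one₀ hT0 hT)
  have h4 : 0 ≤ 1 - T ^ 4 := sub_nonneg.2 (pow_le_one₀ hT0 hT)
  have h5 : 1 - T ^ 5 ≤ (1 - T ^ 2) + (1 - T ^ 3) := by linarith [mul_nonneg h2 h3]
  have h6 : 1 - T ^ 6 ≤ 2 * (1 - T ^ 3) := by linarith [mul_nonneg h3 h3]
  have h7 : 1 - T ^ 3 ≤ 1 - T ^ 7 := by linarith [mul_nonneg (pow_nonneg hT0 3) h4]
  have h9 : 1 - T ^ 9 ≤ 3 * (1 - T ^ 3) := by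
    nlinarith [mul_nonneg h3 h3, mul_nonneg (mul_nonneg h3 h3) h3, pow_nonneg hT0 3]
  have h32 : 1 - T ^ 3 ≤ 2 * (1 - T ^ 2) := by
    nlinarith [mul_nonneg (mul_nonneg hT0 hT0) hT0, mul_nonneg (sub_nonneg.2 hT) hT0]
  have m5 := mul_le_mul_of_nonneg_left h5 (by nlinarith : 0 ≤ 3 * (2 * a - a ^ 2))
  have m6 := mul_le_mul_of_nonneg_left h6 (by nlinarith : 0 ≤ a * (2 - 3 * a))
  have m7 := mul_le_mul_of_nonneg_left h7 (by positivity : 0 ≤ 3 * a ^ 2)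
  have m9 := mul_le_mul_of_nonneg_left h9 (by positivity : 0 ≤ a ^ 4)
  have m4 : 0 ≤ 3 * (1 - 2 * a) * (1 - T ^ 4) := mul_nonneg (by linarith) h4
  have hm1 : 0 ≤ 3 * (1 - 2 * a) ^ 2 * (1 - T ^ 3) := by positivity
  have ha4 : a ^ 4 ≤ (1 / 2) ^ 4 := by gcongr
  have hm2 : 3 * a ^ 4 * (1 - T ^ 3) ≤ 3 * (1 / 2) ^ 4 * (2 * (1 - T ^ 2)) := by gcongr
  have hm3 : (1 / 2) ^ 2 * (1 - T ^ 2) ≤ (1 - a) ^ 2 * (1 - T ^ 2) := by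
    gcongr; linarith
  linarith

/-- The Euler product at `w = 0`, where the local factors are those of the leading constant. -/
theorem tsum_coef_eq : HasProd eulerFactor (∑' m, coef m) := by
  have h := hasProd_localSeries le_rfl
  simp only [neg_zero, rpow_zero, mul_one, localSeries_one] at h
  convert h using 2 with p
  rw [eulerFactor]; ring

theorem localSeries_one_pos {a : ℝ} (ha0 : 0 ≤ a) (ha : a ≤ 1 / 2) : 0 < localSeries a 1 := by
  rw [localSeries_one]
  have : 0 < 1 - a := by linarith
  positivity

theorem one_div_prime_le (p : Nat.Primes) : 1 / (p : ℝ) ≤ 1 / 2 :=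
  one_div_le_one_div_of_le (by norm_num) (by exact_mod_cast p.2.two_le)

theorem tsum_coef_le_tsum_coef_mul_rpow {w : ℝ} (hw : 0 ≤ w) :
    ∑' m, coef m ≤ ∑' m, coef m * (partsHeight m : ℝ) ^ (-w) := by
  have h0 := hasProd_localSeries le_rfl
  simp only [neg_zero, rpow_zero, mul_one] at h0
  refine le_of_tendsto_of_tendsto' h0 (hasProd_localSeries hw) fun s => ?_
  refine Finset.prod_le_prod (fun p _ => (localSeries_one_pos (by positivity)
    (one_div_prime_le p)).le) fun p _ => ?_
  exact localSeries_one_le (by positivity) (one_div_prime_le p) (by positivity)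
    (rpow_le_one_of_one_le_of_nonpos (by exact_mod_cast p.2.one_le) (by linarith))

theorem tsum_coef_nonneg : 0 ≤ ∑' m, coef m := by
  have h0 := hasProd_localSeries le_rfl
  simp only [neg_zero, rpow_zero, mul_one] at h0
  exact ge_of_tendsto' h0 fun s => Finset.prod_nonneg fun p _ =>
    (localSeries_one_pos (by positivity) (one_div_prime_le p)).le

/-- The negative of this sum is the right derivative at `w = 0` of the Dirichlet series
`∑ coef m * (partsHeight m)^{-w}`, which is smallest at `w = 0`. -/
theorem tsum_coef_mul_log_nonpos : ∑' m, coef m * log (partsHeight m) ≤ 0 := by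
  have hlim : Tendsto (fun w : ℝ => ∑' m, coef m * (((partsHeight m : ℝ) ^ (-w) - 1) / w))
      (nhdsWithin 0 (Set.Ioi 0)) (nhds (∑' m, coef m * (-log (partsHeight m)))) := by
    refine tendsto_tsum_of_dominated_convergence summable_abs_coef_mul_log (fun m => ?_) ?_
    · refine Tendsto.const_mul _ ?_
      have hpos : (0 : ℝ) < partsHeight m := by linarith [one_le_partsHeight m]
      have hd : HasDerivAt (fun w : ℝ => (partsHeight m : ℝ) ^ (-w)) (-log (partsHeight m)) 0 := by
        have := (hasDerivAt_neg (0 : ℝ)).const_rpow hpos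
        simpa using this
      have := hd.tendsto_slope_zero_right
      refine this.congr fun w => ?_
      simp [div_eq_inv_mul]
    · filter_upwards [self_mem_nhdsWithin] with w hw m
      have hw0 : 0 < w := hw
      have hpos : (0 : ℝ) < partsHeight m := by linarith [one_le_partsHeight m]
      have hlog := log_nonneg (one_le_partsHeight m)
      rw [norm_mul, norm_eq_abs]
      gcongr
      have h1 : (partsHeight m : ℝ) ^ (-w) ≤ 1 :=
        rpow_le_one_of_one_le_of_nonpos (one_le_partsHeight m) (by linarith)
      have h2 : 1 - w * log (partsHeight m) ≤ (partsHeight m : ℝ) ^ (-w) := by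
        rw [rpow_def_of_pos hpos]
        have := add_one_le_exp (log (partsHeight m) * -w)
        linarith
      rw [norm_div, norm_of_nonneg hw0.le, norm_of_nonpos (by linarith), div_le_iff₀ hw0]
      linarith
  have hnn : 0 ≤ ∑' m, coef m * (-log (partsHeight m)) := by
    refine ge_of_tendsto hlim ?_
    filter_upwards [self_mem_nhdsWithin] with w hw
    have hw0 : 0 < w := hw
    have e : ∀ m, coef m * (((partsHeight m : ℝ) ^ (-w) - 1) / w) =
        (coef m * (partsHeight m : ℝ) ^ (-w) - coef m) / w := fun m => by ring
    simp only [e]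
    rw [tsum_div_const, (summable_norm_coef_mul_rpow hw0.le).of_norm.tsum_sub
      summable_abs_coef.of_abs]
    exact div_nonneg (sub_nonneg.2 (tsum_coef_le_tsum_coef_mul_rpow hw0.le)) hw0.le
  simp only [mul_neg, tsum_neg] at hnn
  linarith

/-! ### The cubic form on the square -/

/-- The absolute value of the cubic form `X Y (X + Y)`. -/
def cubic (p : ℝ × ℝ) : ℝ := |p.1 * p.2 * (p.1 + p.2)|

theorem cubic_nonneg (p : ℝ × ℝ) : 0 ≤ cubic p := abs_nonneg _

theorem continuous_cubic : Continuous cubic := by unfold cubic; fun_prop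

theorem measurable_cubic : Measurable cubic := continuous_cubic.measurable

/-- The square `[-1, 1]²`. -/
def square : Set (ℝ × ℝ) := Set.Icc (-1) 1 ×ˢ Set.Icc (-1) 1

/-- The part of the square on which the cubic form is nonzero and at most `1`. -/
def cubicRegion : Set (ℝ × ℝ) := square ∩ {p | 0 < cubic p ∧ cubic p ≤ 1}

theorem measurableSet_square : MeasurableSet square := measurableSet_Icc.prod measurableSet_Icc

theorem measurableSet_cubicRegion : MeasurableSet cubicRegion :=
  measurableSet_square.inter ((measurableSet_lt measurable_const measurable_cubic).inter
    (measurableSet_le measurable_cubic measurable_const))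

theorem volume_square_lt_top : volume square < ⊤ := by
  rw [square, Measure.volume_eq_prod, Measure.prod_prod]
  simp [ENNReal.mul_lt_top_iff]

instance : IsFiniteMeasure (volume.restrict cubicRegion) :=
  ⟨by rw [Measure.restrict_apply_univ]
      exact (measure_mono Set.inter_subset_left).trans_lt volume_square_lt_top⟩

/-- The level sets of the cubic form are null sets. -/
theorem volume_cubic_eq (c : ℝ) : volume {p : ℝ × ℝ | cubic p = c} = 0 := by
  have hquad : ∀ X d : ℝ, X ≠ 0 → {Y : ℝ | X * Y * (X + Y) = d}.Finite := by
    intro X d hX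
    by_cases h : ∃ Y₁, X * Y₁ * (X + Y₁) = d
    · obtain ⟨Y₁, h₁⟩ := h
      -- The equation is quadratic in `Y`, and `Y₁` is one of its roots.
      refine Set.Finite.subset (Set.toFinite {Y₁, -X - Y₁}) fun Y hY => ?_
      have hY' : X * Y * (X + Y) = d := hY
      have h2 : (X * (Y - Y₁)) * (Y + Y₁ + X) = 0 := by linear_combination hY' - h₁
      rcases mul_eq_zero.1 h2 with h3 | h3
      · rcases mul_eq_zero.1 h3 with h4 | h4
        · exact absurd h4 hX
        · left; linarith
      · right; simp only [Set.mem_singleton_iff]; linarith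
    · convert Set.finite_empty
      ext Y
      simpa using fun hY => h ⟨Y, hY⟩
  have hm : MeasurableSet {p : ℝ × ℝ | cubic p = c} :=
    measurableSet_eq_fun measurable_cubic measurable_const
  rw [Measure.volume_eq_prod, Measure.measure_prod_null hm]
  have h0 : ∀ᵐ X : ℝ, X ≠ 0 := by simp [ae_iff]
  filter_upwards [h0] with X hX
  refine measure_mono_null (t := {Y : ℝ | X * Y * (X + Y) = c} ∪ {Y : ℝ | X * Y * (X + Y) = -c})
    (fun Y hY => ?_) (((hquad X c hX).union (hquad X (-c) hX)).measure_zero _)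
  have : |X * Y * (X + Y)| = c := hY
  rcases abs_choice (X * Y * (X + Y)) with h | h
  · left; simp only [Set.mem_ofPred_eq]; linarith
  · right; simp only [Set.mem_ofPred_eq]; linarith

/-- The area of the part of the square with `|X Y (X + Y)|² ≤ r`. -/
noncomputable def cubicArea (r : ℝ) : ℝ := volume.real (square ∩ {p | cubic p ^ 2 ≤ r})

/-- The region cut out by `|X Y (X + Y)| ≤ n / Z`, up to a null set, as a part of `cubicRegion`. -/
theorem cubicArea_eq_integral {Z n : ℝ} (hZ : 0 < Z) (hn : 0 ≤ n) (hnZ : n ≤ Z) :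
    cubicArea (n ^ 2 / Z ^ 2) =
      ∫ p in cubicRegion, if n ≤ cubic p * Z then (0 : ℝ) else 1 := by
  have hset : (square ∩ {p | cubic p ^ 2 ≤ n ^ 2 / Z ^ 2} : Set (ℝ × ℝ)) =ᵐ[volume]
      (cubicRegion ∩ {p | cubic p * Z < n} : Set (ℝ × ℝ)) := by
    have h1 : ∀ᵐ p : ℝ × ℝ, cubic p ≠ 0 := by
      rw [ae_iff]; simpa using volume_cubic_eq 0
    have h2 : ∀ᵐ p : ℝ × ℝ, cubic p ≠ n / Z := by
      rw [ae_iff]; simpa using volume_cubic_eq (n / Z)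
    filter_upwards [h1, h2] with p hp1 hp2
    have h0 := cubic_nonneg p
    apply propext
    change (p ∈ square ∧ cubic p ^ 2 ≤ n ^ 2 / Z ^ 2) ↔
      (p ∈ square ∧ 0 < cubic p ∧ cubic p ≤ 1) ∧ cubic p * Z < n
    rw [← div_pow, sq_le_sq₀ h0 (by positivity), ← lt_div_iff₀ hZ]
    constructor
    · rintro ⟨h3, h4⟩
      exact ⟨⟨h3, lt_of_le_of_ne h0 (Ne.symm hp1), h4.trans ((div_le_one hZ).2 hnZ)⟩,
        lt_of_le_of_ne h4 hp2⟩
    · rintro ⟨⟨h3, _⟩, h4⟩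
      exact ⟨h3, h4.le⟩
  have hm : MeasurableSet {p : ℝ × ℝ | cubic p * Z < n} :=
    measurableSet_lt (measurable_cubic.mul_const Z) measurable_const
  rw [cubicArea, measureReal_congr hset]
  have : (fun p => if n ≤ cubic p * Z then (0 : ℝ) else 1) =
      {p : ℝ × ℝ | cubic p * Z < n}.indicator 1 := by
    ext p
    by_cases h : n ≤ cubic p * Z
    · rw [if_pos h, Set.indicator_of_notMem (by simpa using h)]
    · rw [if_neg h, Set.indicator_of_mem (by simpa using h)]; rfl
  rw [this, integral_indicator_one hm, measureReal_restrict_apply hm, Set.inter_comm]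

/-! ### Sums over quadruples of bounded height -/

/-- The quadruples `(s, n₁, n₂, n₃)` of positive integers with `s³ (n₁ n₂ n₃)² ≤ Q`. -/
noncomputable def tuples (Q : ℝ) : Finset (ℕ × ℕ × ℕ × ℕ) :=
  (Finset.Icc 1 ⌊Q⌋₊ ×ˢ Finset.Icc 1 ⌊Q⌋₊ ×ˢ Finset.Icc 1 ⌊Q⌋₊ ×ˢ Finset.Icc 1 ⌊Q⌋₊).filter
    fun v => (v.1 : ℝ) ^ 3 * (v.2.1 * v.2.2.1 * v.2.2.2) ^ 2 ≤ Q

/-- The triples of positive integers with `n₁ n₂ n₃ ≤ y`. -/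
noncomputable def triples (y : ℝ) : Finset (ℕ × ℕ × ℕ) :=
  (Finset.Icc 1 ⌊y⌋₊ ×ˢ Finset.Icc 1 ⌊y⌋₊ ×ˢ Finset.Icc 1 ⌊y⌋₊).filter
    fun v => (v.1 : ℝ) * v.2.1 * v.2.2 ≤ y

theorem mem_triples {y : ℝ} (hy : 0 ≤ y) {v : ℕ × ℕ × ℕ} :
    v ∈ triples y ↔ (1 ≤ v.1 ∧ 1 ≤ v.2.1 ∧ 1 ≤ v.2.2) ∧ (v.1 : ℝ) * v.2.1 * v.2.2 ≤ y := by
  simp only [triples, Finset.mem_filter, Finset.mem_product, mem_Icc_floor hy]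
  constructor
  · tauto
  · rintro ⟨⟨h1, h2, h3⟩, h4⟩
    have h1' : (1 : ℝ) ≤ v.1 := by exact_mod_cast h1
    have h2' : (1 : ℝ) ≤ v.2.1 := by exact_mod_cast h2
    have h3' : (1 : ℝ) ≤ v.2.2 := by exact_mod_cast h3
    have h12 : (1 : ℝ) ≤ v.1 * v.2.1 := one_le_mul_of_one_le_of_one_le h1' h2'
    have hle : (v.1 : ℝ) * v.2.1 ≤ y := (le_mul_of_one_le_right (by positivity) h3').trans h4
    exact ⟨⟨⟨h1, (le_mul_of_one_le_right (by positivity) h2').trans hle⟩,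
      ⟨h2, (le_mul_of_one_le_left (by positivity) h1').trans hle⟩,
      h3, (le_mul_of_one_le_left (by positivity) h12).trans h4⟩, h4⟩

theorem mem_tuples {Q : ℝ} (hQ : 0 ≤ Q) {v : ℕ × ℕ × ℕ × ℕ} :
    v ∈ tuples Q ↔ (1 ≤ v.1 ∧ 1 ≤ v.2.1 ∧ 1 ≤ v.2.2.1 ∧ 1 ≤ v.2.2.2) ∧
      (v.1 : ℝ) ^ 3 * (v.2.1 * v.2.2.1 * v.2.2.2) ^ 2 ≤ Q := by
  simp only [tuples, Finset.mem_filter, Finset.mem_product, mem_Icc_floor hQ]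
  constructor
  · tauto
  · rintro ⟨⟨h0, h1, h2, h3⟩, h4⟩
    have h0' : (1 : ℝ) ≤ v.1 := by exact_mod_cast h0
    have h1' : (1 : ℝ) ≤ v.2.1 := by exact_mod_cast h1
    have h2' : (1 : ℝ) ≤ v.2.2.1 := by exact_mod_cast h2
    have h3' : (1 : ℝ) ≤ v.2.2.2 := by exact_mod_cast h3
    have h12 : (1 : ℝ) ≤ v.2.1 * v.2.2.1 := one_le_mul_of_one_le_of_one_le h1' h2'
    have h123 : (1 : ℝ) ≤ v.2.1 * v.2.2.1 * v.2.2.2 := one_le_mul_of_one_le_of_one_le h12 h3'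
    have hn : (v.2.1 : ℝ) * v.2.2.1 * v.2.2.2 ≤ Q := by
      refine (le_self_pow₀ h123 two_ne_zero).trans (le_trans ?_ h4)
      exact le_mul_of_one_le_left (by positivity) (one_le_pow₀ h0')
    have hs : (v.1 : ℝ) ≤ Q := by
      refine (le_self_pow₀ h0' three_ne_zero).trans (le_trans ?_ h4)
      exact le_mul_of_one_le_right (by positivity) (one_le_pow₀ h123)
    have hle : (v.2.1 : ℝ) * v.2.2.1 ≤ Q := (le_mul_of_one_le_right (by positivity) h3').trans hn
    exact ⟨⟨⟨h0, hs⟩, ⟨h1, (le_mul_of_one_le_right (by positivity) h2').trans hle⟩,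
      ⟨h2, (le_mul_of_one_le_left (by positivity) h1').trans hle⟩,
      h3, (le_mul_of_one_le_left (by positivity) h12).trans hn⟩, h4⟩

theorem sum_triples {y : ℝ} (hy : 0 ≤ y) :
    ∑ v ∈ triples y, 1 / ((v.1 : ℝ) * v.2.1 * v.2.2) = recipSum₃ y := by
  rw [Finset.sum_finset_product (triples y) (Finset.Icc 1 ⌊y⌋₊)
    (fun a => ((Finset.Icc 1 ⌊y / a⌋₊ ×ˢ Finset.Icc 1 ⌊y / a⌋₊).filter
      fun v : ℕ × ℕ => (v.1 : ℝ) * v.2 ≤ y / a)), recipSum₃]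
  · refine Finset.sum_congr rfl fun a ha => ?_
    rw [mem_Icc_floor hy] at ha
    have ha0 : (0 : ℝ) < a := by exact_mod_cast ha.1
    have hya : 0 ≤ y / a := by positivity
    rw [Finset.sum_finset_product _ (Finset.Icc 1 ⌊y / a⌋₊) (fun b => Finset.Icc 1 ⌊y / a / b⌋₊),
      recipSum₂, Finset.mul_sum]
    · refine Finset.sum_congr rfl fun b _ => ?_
      rw [recipSum, Finset.mul_sum, Finset.mul_sum]
      refine Finset.sum_congr rfl fun c _ => ?_
      simp only
      rw [← one_div_mul_one_div, ← one_div_mul_one_div]; ring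
    · intro v
      simp only [Finset.mem_filter, Finset.mem_product]
      constructor
      · rintro ⟨⟨h1, h2⟩, h3⟩
        refine ⟨h1, (mem_Icc_floor_div hya ((mem_Icc_floor hya).1 h1).1).2
          ⟨((mem_Icc_floor hya).1 h2).1, h3⟩⟩
      · rintro ⟨h1, h2⟩
        have h1' := (mem_Icc_floor hya).1 h1
        have h2' := (mem_Icc_floor_div hya h1'.1).1 h2
        have : (1 : ℝ) ≤ v.1 := by exact_mod_cast h1'.1
        exact ⟨⟨h1, (mem_Icc_floor hya).2 ⟨h2'.1,
          (le_mul_of_one_le_left (by positivity) this).trans h2'.2⟩⟩, h2'.2⟩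
  · intro v
    rw [mem_triples hy, Finset.mem_filter, Finset.mem_product, mem_Icc_floor hy]
    constructor
    · rintro ⟨⟨h1, h2, h3⟩, h4⟩
      have h1' : (1 : ℝ) ≤ v.1 := by exact_mod_cast h1
      have h2' : (1 : ℝ) ≤ v.2.1 := by exact_mod_cast h2
      have h3' : (1 : ℝ) ≤ v.2.2 := by exact_mod_cast h3
      have hya : 0 ≤ y / v.1 := by positivity
      have h5 : (v.2.1 : ℝ) * v.2.2 ≤ y / v.1 := by
        rw [le_div_iff₀ (by linarith)]; linarith
      refine ⟨⟨h1, ?_⟩, ⟨(mem_Icc_floor hya).2 ⟨h2, ?_⟩, (mem_Icc_floor hya).2 ⟨h3, ?_⟩⟩, h5⟩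
      · refine le_trans ?_ h4
        rw [mul_assoc]
        exact le_mul_of_one_le_right (by positivity) (one_le_mul_of_one_le_of_one_le h2' h3')
      · exact (le_mul_of_one_le_right (by positivity) h3').trans h5
      · exact (le_mul_of_one_le_left (by positivity) h2').trans h5
    · rintro ⟨⟨h1, h2⟩, ⟨h3, h4⟩, h5⟩
      have h1' : (0 : ℝ) < v.1 := by exact_mod_cast h1
      have hya : 0 ≤ y / v.1 := by positivity
      refine ⟨⟨h1, ((mem_Icc_floor hya).1 h3).1, ((mem_Icc_floor hya).1 h4).1⟩, ?_⟩
      rw [le_div_iff₀ h1'] at h5; linarith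

/-- The sum of `1 / (s n₁ n₂ n₃)` over the quadruples of height at most `Q`, weighted with areas. -/
noncomputable def weightedSum (Q : ℝ) : ℝ :=
  ∑ v ∈ tuples Q, 1 / ((v.1 : ℝ) * (v.2.1 * v.2.2.1 * v.2.2.2)) *
    cubicArea ((v.1 : ℝ) ^ 3 * (v.2.1 * v.2.2.1 * v.2.2.2) ^ 2 / Q)

theorem weightedSum_of_lt_one {Q : ℝ} (hQ : Q < 1) : weightedSum Q = 0 := by
  rw [weightedSum, tuples, Nat.floor_eq_zero.2 hQ]; simp

/-- With the areas written as integrals over `cubicRegion`, the sum over `n₁, n₂, n₃` under the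
integral sign runs over `cubic p * Z < n₁ n₂ n₃ ≤ Z` with `Z = √(Q / s³)`. -/
theorem weightedSum_eq {Q : ℝ} (hQ : 0 < Q) :
    weightedSum Q = ∑ s ∈ Finset.Icc 1 ⌊Q ^ (1 / 3 : ℝ)⌋₊, 1 / (s : ℝ) *
      ∫ p in cubicRegion, (recipSum₃ √(Q / s ^ 3) - recipSum₃ (cubic p * √(Q / s ^ 3))) := by
  have hS3 : (Q ^ (1 / 3 : ℝ)) ^ 3 = Q := by
    rw [← rpow_natCast, ← rpow_mul hQ.le]; norm_num
  have hS0 : 0 < Q ^ (1 / 3 : ℝ) := by positivity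
  rw [weightedSum, Finset.sum_finset_product (tuples Q) (Finset.Icc 1 ⌊Q ^ (1 / 3 : ℝ)⌋₊)
    (fun s => triples √(Q / s ^ 3))]
  · refine Finset.sum_congr rfl fun s hs => ?_
    rw [mem_Icc_floor hS0.le] at hs
    have hs0 : (0 : ℝ) < s := by exact_mod_cast hs.1
    have hQs : 0 < Q / s ^ 3 := by positivity
    set Z := √(Q / s ^ 3) with hZ
    have hZ0 : 0 < Z := Real.sqrt_pos.2 hQs
    have hZ2 : Z ^ 2 = Q / s ^ 3 := Real.sq_sqrt hQs.le
    have harea : ∀ v ∈ triples Z, 1 / ((s : ℝ) * (v.1 * v.2.1 * v.2.2)) *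
        cubicArea ((s : ℝ) ^ 3 * (v.1 * v.2.1 * v.2.2) ^ 2 / Q) =
        1 / (s : ℝ) * ∫ p in cubicRegion, 1 / ((v.1 : ℝ) * v.2.1 * v.2.2) *
          (if (v.1 : ℝ) * v.2.1 * v.2.2 ≤ cubic p * Z then (0 : ℝ) else 1) := by
      intro v hv
      rw [mem_triples hZ0.le] at hv
      rw [show (s : ℝ) ^ 3 * (v.1 * v.2.1 * v.2.2) ^ 2 / Q =
        ((v.1 : ℝ) * v.2.1 * v.2.2) ^ 2 / Z ^ 2 by rw [hZ2]; field_simp,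
        cubicArea_eq_integral hZ0 (by positivity) hv.2, integral_const_mul]
      rw [← one_div_mul_one_div]; ring
    rw [Finset.sum_congr rfl harea, ← Finset.mul_sum, ← integral_finsetSum]
    · congr 1
      refine setIntegral_congr_fun measurableSet_cubicRegion fun p hp => ?_
      have hp1 : cubic p ≤ 1 := hp.2.2
      have hcz : 0 ≤ cubic p * Z := mul_nonneg (cubic_nonneg p) hZ0.le
      rw [← sum_triples hZ0.le, ← sum_triples hcz]
      have hfil : triples (cubic p * Z) =
          (triples Z).filter fun v => (v.1 : ℝ) * v.2.1 * v.2.2 ≤ cubic p * Z := by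
        ext v
        rw [Finset.mem_filter, mem_triples hcz, mem_triples hZ0.le]
        have : cubic p * Z ≤ Z := mul_le_of_le_one_left hZ0.le hp1
        constructor
        · rintro ⟨h1, h2⟩; exact ⟨⟨h1, h2.trans this⟩, h2⟩
        · tauto
      rw [hfil, Finset.sum_filter, ← Finset.sum_sub_distrib]
      refine Finset.sum_congr rfl fun v _ => ?_
      split <;> ring
    · intro v _
      refine Integrable.const_mul ?_ _
      refine Integrable.of_bound (C := 1) ?_ ?_
      · exact (Measurable.ite (measurableSet_le measurable_const (measurable_cubic.mul_const Z))
          measurable_const measurable_const).aestronglyMeasurable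
      · filter_upwards with p
        split <;> simp
  · intro v
    rw [mem_tuples hQ.le, mem_Icc_floor hS0.le, mem_triples (Real.sqrt_nonneg _)]
    constructor
    · rintro ⟨⟨h0, h1, h2, h3⟩, h4⟩
      have h0' : (1 : ℝ) ≤ v.1 := by exact_mod_cast h0
      have h1' : (1 : ℝ) ≤ v.2.1 := by exact_mod_cast h1
      have h2' : (1 : ℝ) ≤ v.2.2.1 := by exact_mod_cast h2
      have h3' : (1 : ℝ) ≤ v.2.2.2 := by exact_mod_cast h3
      have h123 : (1 : ℝ) ≤ v.2.1 * v.2.2.1 * v.2.2.2 :=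
        one_le_mul_of_one_le_of_one_le (one_le_mul_of_one_le_of_one_le h1' h2') h3'
      refine ⟨⟨h0, ?_⟩, ⟨h1, h2, h3⟩, ?_⟩
      · rw [← pow_le_pow_iff_left₀ (by positivity) hS0.le three_ne_zero, hS3]
        exact (le_mul_of_one_le_right (by positivity) (one_le_pow₀ h123)).trans h4
      · apply Real.le_sqrt_of_sq_le
        rw [le_div_iff₀ (by positivity)]; linarith
    · rintro ⟨⟨h0, h1⟩, h2, h3⟩
      have h0' : (0 : ℝ) < v.1 := by exact_mod_cast h0
      refine ⟨⟨h0, h2⟩, ?_⟩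
      have := (Real.le_sqrt (by positivity) (by positivity)).1 h3
      rw [le_div_iff₀ (by positivity)] at this
      linarith

/-- The sum over the quadruples weighted with the density, expanded over the divisors. -/
theorem sum_density_eq_tsum {B : ℝ} (hB : 0 < B) :
    ∑ v ∈ tuples B, density v.1 v.2.1 v.2.2.1 v.2.2.2 /
      ((v.1 : ℝ) * (v.2.1 * v.2.2.1 * v.2.2.2)) *
        cubicArea ((v.1 : ℝ) ^ 3 * (v.2.1 * v.2.2.1 * v.2.2.2) ^ 2 / B) =
    ∑' m, coef m * weightedSum (B / partsHeight m) := by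
  set G : ℕ × ℕ × ℕ × ℕ → ℝ := fun v => 1 / ((v.1 : ℝ) * (v.2.1 * v.2.2.1 * v.2.2.2)) *
    cubicArea ((v.1 : ℝ) ^ 3 * (v.2.1 * v.2.2.1 * v.2.2.2) ^ 2 / B) with hG
  have hsum : ∀ v ∈ tuples B, HasSum (fun m => moebiusRestrict v.1 v.2.1 v.2.2.1 v.2.2.2 m * G v)
      (density v.1 v.2.1 v.2.2.1 v.2.2.2 /
      ((v.1 : ℝ) * (v.2.1 * v.2.2.1 * v.2.2.2)) *
        cubicArea ((v.1 : ℝ) ^ 3 * (v.2.1 * v.2.2.1 * v.2.2.2) ^ 2 / B)) := by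
    intro v hv
    rw [mem_tuples hB.le] at hv
    obtain ⟨⟨h0, h1, h2, h3⟩, _⟩ := hv
    rw [show density v.1 v.2.1 v.2.2.1 v.2.2.2 / ((v.1 : ℝ) * (v.2.1 * v.2.2.1 * v.2.2.2)) *
      cubicArea ((v.1 : ℝ) ^ 3 * (v.2.1 * v.2.2.1 * v.2.2.2) ^ 2 / B) =
        density v.1 v.2.1 v.2.2.1 v.2.2.2 * G v by rw [hG]; ring]
    exact (hasSum_density (by positivity)).mul_right (G v)
  rw [← (hasSum_sum hsum).tsum_eq]
  refine tsum_congr fun m => ?_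
  rcases eq_or_ne m 0 with rfl | hm
  · simp [coef_zero]
  simp only [moebiusRestrict_apply _ _ _ _ hm, ite_mul, zero_mul]
  rw [← Finset.sum_filter, coef, if_neg hm, weightedSum, Finset.mul_sum]
  have hD : (0 : ℝ) < partsHeight m := by linarith [one_le_partsHeight m]
  have hBD : 0 < B / partsHeight m := by positivity
  have p0 := part_pos 0 m
  have p1 := part_pos 1 m
  have p2 := part_pos 2 m
  have p3 := part_pos 3 m
  have hheight : ∀ v : ℕ × ℕ × ℕ × ℕ, ((part 0 m * v.1 : ℕ) : ℝ) ^ 3 * (((part 1 m * v.2.1 : ℕ) : ℝ) *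
      (part 2 m * v.2.2.1 : ℕ) * (part 3 m * v.2.2.2 : ℕ)) ^ 2 =
      partsHeight m * ((v.1 : ℝ) ^ 3 * (v.2.1 * v.2.2.1 * v.2.2.2) ^ 2) := fun v => by
    rw [partsHeight]; push_cast; ring
  symm
  refine Finset.sum_nbij' (fun v => (part 0 m * v.1, part 1 m * v.2.1, part 2 m * v.2.2.1,
    part 3 m * v.2.2.2)) (fun v => (v.1 / part 0 m, v.2.1 / part 1 m, v.2.2.1 / part 2 m,
    v.2.2.2 / part 3 m)) ?_ ?_ ?_ ?_ ?_
  · intro v hv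
    rw [mem_tuples hBD.le] at hv
    obtain ⟨⟨h0, h1, h2, h3⟩, h4⟩ := hv
    rw [Finset.mem_filter, mem_tuples hB.le]
    refine ⟨⟨⟨Nat.mul_pos p0 h0, Nat.mul_pos p1 h1, Nat.mul_pos p2 h2, Nat.mul_pos p3 h3⟩, ?_⟩,
      dvd_mul_right _ _, dvd_mul_right _ _, dvd_mul_right _ _, dvd_mul_right _ _⟩
    simp only
    rw [hheight v, mul_comm, ← le_div_iff₀ hD]
    exact h4
  · rintro ⟨v0, v1, v2, v3⟩ hv
    rw [Finset.mem_filter, mem_tuples hB.le] at hv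
    obtain ⟨⟨⟨h0, h1, h2, h3⟩, h4⟩, ⟨a, ha⟩, ⟨b, hb⟩, ⟨c, hc⟩, ⟨d, hd⟩⟩ := hv
    simp only at ha hb hc hd h0 h1 h2 h3 h4 ⊢
    subst ha hb hc hd
    rw [mem_tuples hBD.le]
    simp only [Nat.mul_div_cancel_left _ p0, Nat.mul_div_cancel_left _ p1,
      Nat.mul_div_cancel_left _ p2, Nat.mul_div_cancel_left _ p3]
    refine ⟨⟨Nat.pos_of_mul_pos_left h0, Nat.pos_of_mul_pos_left h1, Nat.pos_of_mul_pos_left h2,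
      Nat.pos_of_mul_pos_left h3⟩, ?_⟩
    rw [hheight (a, b, c, d), mul_comm, ← le_div_iff₀ hD] at h4
    exact h4
  · rintro ⟨v0, v1, v2, v3⟩ _
    simp only [Nat.mul_div_cancel_left _ p0, Nat.mul_div_cancel_left _ p1,
      Nat.mul_div_cancel_left _ p2, Nat.mul_div_cancel_left _ p3]
  · rintro ⟨v0, v1, v2, v3⟩ hv
    rw [Finset.mem_filter] at hv
    obtain ⟨_, h0, h1, h2, h3⟩ := hv
    simp only at h0 h1 h2 h3
    simp only [Nat.mul_div_cancel' h0, Nat.mul_div_cancel' h1, Nat.mul_div_cancel' h2,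
      Nat.mul_div_cancel' h3]
  · intro v hv
    simp only [hG]
    rw [hheight v, div_div_eq_mul_div, mul_comm (partsHeight m : ℝ)]
    rw [partsProd]
    push_cast
    rw [show (part 0 m : ℝ) * v.1 * (part 1 m * v.2.1 * (part 2 m * v.2.2.1) * (part 3 m * v.2.2.2)) =
      (part 0 m * part 1 m * part 2 m * part 3 m) * (v.1 * (v.2.1 * v.2.2.1 * v.2.2.2)) by ring,
      ← one_div_mul_one_div]
    ring

/-- Summing an expansion `b₃ (log Q)³ + b₂ (log Q)² + O(1 + log Q)` over the shifts
`Q = B / partsHeight m`. -/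
theorem exists_tsum_coef_asymp {W : ℝ → ℝ} {b₃ b₂ C : ℝ} (hW0 : ∀ Q < 1, W Q = 0)
    (hW : ∀ Q, 1 ≤ Q → |W Q - (b₃ * log Q ^ 3 + b₂ * log Q ^ 2)| ≤ C * (1 + log Q)) :
    ∃ C' : ℝ, ∀ B : ℝ, 1 ≤ B →
      |(∑' m, coef m * W (B / partsHeight m)) -
        (b₃ * (∑' m, coef m) * log B ^ 3 + (b₂ * (∑' m, coef m) -
          3 * b₃ * ∑' m, coef m * log (partsHeight m)) * log B ^ 2)| ≤ C' * (1 + log B) := by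
  have hC : 0 ≤ C := by
    have := (abs_nonneg _).trans (hW 1 le_rfl); simpa using this
  set K := C + 8 * |b₃| + 4 * |b₂| with hK
  have hpt : ∀ B : ℝ, 1 ≤ B → ∀ D : ℝ, 1 ≤ D →
      |W (B / D) - (b₃ * log B ^ 3 + (b₂ - 3 * b₃ * log D) * log B ^ 2)| ≤
        K * (1 + log B) * (1 + log D) ^ 3 := by
    intro B hB D hD
    have hL0 := log_nonneg hB
    have hl0 := log_nonneg hD
    have hlogd : log (B / D) = log B - log D := log_div (by linarith) (by linarith)
    generalize log B = L at hL0 hlogd ⊢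
    generalize log D = l at hl0 hlogd ⊢
    have n3 := abs_nonneg b₃
    have n2 := abs_nonneg b₂
    have hl2 : 0 ≤ l ^ 2 := sq_nonneg l
    have hl3 : 0 ≤ l ^ 3 := by positivity
    have hLl : 0 ≤ L * l := by positivity
    have hLl2 : 0 ≤ L * l ^ 2 := by positivity
    have hLl3 : 0 ≤ L * l ^ 3 := by positivity
    rcases le_or_gt 1 (B / D) with h | h
    · have h1 := hW _ h
      rw [hlogd] at h1
      have hlog : 0 ≤ L - l := by rw [← hlogd]; exact log_nonneg h
      have hid : W (B / D) - (b₃ * L ^ 3 + (b₂ - 3 * b₃ * l) * L ^ 2) =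
          (W (B / D) - (b₃ * (L - l) ^ 3 + b₂ * (L - l) ^ 2)) +
            (b₃ * (3 * l ^ 2 * L - l ^ 3) + b₂ * (-2 * L * l + l ^ 2)) := by ring
      rw [hid]
      have e3 : |3 * l ^ 2 * L - l ^ 3| ≤ 8 * ((1 + L) * (1 + l) ^ 3) := by
        rw [abs_le]; constructor <;> linarith
      have e2 : |-2 * L * l + l ^ 2| ≤ 4 * ((1 + L) * (1 + l) ^ 3) := by
        rw [abs_le]; constructor <;> linarith
      have e1 : C * (1 + (L - l)) ≤ C * ((1 + L) * (1 + l) ^ 3) := by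
        gcongr; linarith
      calc _ ≤ C * (1 + (L - l)) + (|b₃| * |3 * l ^ 2 * L - l ^ 3| +
            |b₂| * |-2 * L * l + l ^ 2|) := by
            refine (abs_add_le _ _).trans (add_le_add h1 ?_)
            rw [← abs_mul, ← abs_mul]; exact abs_add_le _ _
        _ ≤ C * ((1 + L) * (1 + l) ^ 3) + (|b₃| * (8 * ((1 + L) * (1 + l) ^ 3)) +
            |b₂| * (4 * ((1 + L) * (1 + l) ^ 3))) := by gcongr
        _ = _ := by rw [hK]; ring
    · rw [hW0 _ h, zero_sub, abs_neg]
      have hlog : L ≤ l := by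
        have := log_neg (by positivity) h
        rw [hlogd] at this; linarith
      have e3 : |L ^ 3 - 3 * l * L ^ 2| ≤ 8 * ((1 + L) * (1 + l) ^ 3) := by
        have b1 : L ^ 2 ≤ L * l := by nlinarith
        have b2 : l * L ^ 2 ≤ l * (L * l) := by gcongr
        have b3 : L ^ 3 ≤ L * l ^ 2 := by nlinarith
        have b4 : 0 ≤ L ^ 3 := by positivity
        have b5 : 0 ≤ l * L ^ 2 := by positivity
        rw [abs_le]; constructor <;> linarith
      have e2 : |L ^ 2| ≤ 4 * ((1 + L) * (1 + l) ^ 3) := by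
        have b1 : L ^ 2 ≤ L * l := by nlinarith
        rw [abs_of_nonneg (sq_nonneg L)]; linarith
      calc |b₃ * L ^ 3 + (b₂ - 3 * b₃ * l) * L ^ 2|
          = |b₃ * (L ^ 3 - 3 * l * L ^ 2) + b₂ * L ^ 2| := by congr 1; ring
        _ ≤ |b₃| * |L ^ 3 - 3 * l * L ^ 2| + |b₂| * |L ^ 2| := by
            rw [← abs_mul, ← abs_mul]; exact abs_add_le _ _
        _ ≤ |b₃| * (8 * ((1 + L) * (1 + l) ^ 3)) + |b₂| * (4 * ((1 + L) * (1 + l) ^ 3)) := by gcongr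
        _ = (8 * |b₃| + 4 * |b₂|) * (1 + L) * (1 + l) ^ 3 := by ring
        _ ≤ K * (1 + L) * (1 + l) ^ 3 := by
            gcongr; rw [hK]; linarith
  refine ⟨K * ∑' m, |coef m| * (1 + log (partsHeight m)) ^ 3, fun B hB => ?_⟩
  have hs1 := summable_abs_coef.of_abs
  have hs2 : Summable fun m => coef m * log (partsHeight m) := by
    refine Summable.of_norm_bounded summable_abs_coef_mul_log fun m => ?_
    rw [norm_mul, norm_eq_abs, norm_of_nonneg (log_nonneg (one_le_partsHeight m))]
  set P : ℕ → ℝ := fun m => b₃ * log B ^ 3 + (b₂ - 3 * b₃ * log (partsHeight m)) * log B ^ 2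
  have hP : HasSum (fun m => coef m * P m) (b₃ * (∑' m, coef m) * log B ^ 3 +
      (b₂ * (∑' m, coef m) - 3 * b₃ * ∑' m, coef m * log (partsHeight m)) * log B ^ 2) := by
    have := (hs1.hasSum.mul_left (b₃ * log B ^ 3 + b₂ * log B ^ 2)).sub
      (hs2.hasSum.mul_left (3 * b₃ * log B ^ 2))
    rw [show (fun m => coef m * P m) = fun m => (b₃ * log B ^ 3 + b₂ * log B ^ 2) * coef m -
      3 * b₃ * log B ^ 2 * (coef m * log (partsHeight m)) from funext fun m => by
        simp only [P]; ring]
    have hv : b₃ * (∑' m, coef m) * log B ^ 3 + (b₂ * (∑' m, coef m) -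
        3 * b₃ * ∑' m, coef m * log (partsHeight m)) * log B ^ 2 =
        (b₃ * log B ^ 3 + b₂ * log B ^ 2) * (∑' m, coef m) -
          3 * b₃ * log B ^ 2 * ∑' m, coef m * log (partsHeight m) := by ring
    rw [hv]
    exact this
  have hbound : ∀ m, |coef m * W (B / partsHeight m) - coef m * P m| ≤
      K * (1 + log B) * (|coef m| * (1 + log (partsHeight m)) ^ 3) := fun m => by
    rw [← mul_sub, abs_mul]
    calc |coef m| * _ ≤ |coef m| * (K * (1 + log B) * (1 + log (partsHeight m)) ^ 3) := by
          gcongr; exact hpt B hB _ (one_le_partsHeight m)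
      _ = _ := by ring
  have hsb := summable_coef_mul_log_cube.mul_left (K * (1 + log B))
  have hs3 : Summable fun m => coef m * W (B / partsHeight m) - coef m * P m :=
    Summable.of_norm_bounded hsb hbound
  have hs4 : Summable fun m => coef m * W (B / partsHeight m) := by
    simpa using hs3.add hP.summable
  rw [← hP.tsum_eq, ← hs4.tsum_sub hP.summable]
  calc _ ≤ ∑' m, |coef m * W (B / partsHeight m) - coef m * P m| := by
        simpa [norm_eq_abs] using norm_tsum_le_tsum_norm hs3.norm
    _ ≤ ∑' m, K * (1 + log B) * (|coef m| * (1 + log (partsHeight m)) ^ 3) :=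
        hs3.abs.tsum_le_tsum hbound hsb
    _ = _ := by rw [tsum_mul_left]; ring

/-! ### Sieving integers in intervals -/

/-- Sieving: if `T` is equidistributed in residue classes with error `K`, then so is the subset
that avoids the classes `Ω p` modulo the primes `p ∈ P`. -/
theorem abs_card_sieve_sub_le {T : Finset ℤ} {V K : ℝ}
    (hT : ∀ q : ℕ, 0 < q → ∀ r : ℤ, |((T.filter fun t => (q : ℤ) ∣ t - r).card : ℝ) - V / q| ≤ K)
    (Ω : ℕ → Finset ℤ) (P : Finset ℕ) (hP : ∀ p ∈ P, p.Prime)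
    (hΩ : ∀ p ∈ P, ∀ ω ∈ Ω p, ∀ ω' ∈ Ω p, (p : ℤ) ∣ ω - ω' → ω = ω') :
    ∀ q : ℕ, 0 < q → (∀ p ∈ P, p.Coprime q) → ∀ r : ℤ,
      |((T.filter fun t => (q : ℤ) ∣ t - r ∧ ∀ p ∈ P, ∀ ω ∈ Ω p, ¬ (p : ℤ) ∣ t - ω).card : ℝ) -
        V / q * ∏ p ∈ P, (1 - ((Ω p).card : ℝ) / p)| ≤ K * ∏ p ∈ P, (1 + ((Ω p).card : ℝ)) := by
  induction P using Finset.induction_on with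
  | empty => intro q hq _ r; simpa using hT q hq r
  | insert p P hpP ih =>
    intro q hq hcop r
    have hpp : p.Prime := hP p (Finset.mem_insert_self _ _)
    have ih' := ih (fun p' hp' => hP p' (Finset.mem_insert_of_mem hp'))
      (fun p' hp' => hΩ p' (Finset.mem_insert_of_mem hp'))
    have hΩp := hΩ p (Finset.mem_insert_self _ _)
    set ok : ℤ → Prop := fun t => ∀ p ∈ P, ∀ ω ∈ Ω p, ¬ (p : ℤ) ∣ t - ω with hok
    have hsplit : ((T.filter fun t => (q : ℤ) ∣ t - r ∧
          ∀ p' ∈ insert p P, ∀ ω ∈ Ω p', ¬ (p' : ℤ) ∣ t - ω).card : ℝ) =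
        ((T.filter fun t => (q : ℤ) ∣ t - r ∧ ok t).card : ℝ) -
          ∑ ω ∈ Ω p, ((T.filter fun t => ((q : ℤ) ∣ t - r ∧ (p : ℤ) ∣ t - ω) ∧ ok t).card : ℝ) := by
      simp only [Finset.card_filter, Nat.cast_sum]
      rw [Finset.sum_comm, ← Finset.sum_sub_distrib]
      refine Finset.sum_congr rfl fun t _ => ?_
      simp only [Finset.forall_mem_insert]
      by_cases h1 : (q : ℤ) ∣ t - r ∧ ok t
      · have hsum : ∀ ω, ((if ((q : ℤ) ∣ t - r ∧ (p : ℤ) ∣ t - ω) ∧ ok t then 1 else 0 : ℕ) : ℝ) =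
            if (p : ℤ) ∣ t - ω then 1 else 0 := fun ω => by
          by_cases h2 : (p : ℤ) ∣ t - ω <;> simp [h1.1, h1.2, h2]
        simp only [hsum, if_pos h1]
        by_cases h3 : ∃ ω₀ ∈ Ω p, (p : ℤ) ∣ t - ω₀
        · obtain ⟨ω₀, h4, h5⟩ := h3
          rw [if_neg fun h => h.2.1 ω₀ h4 h5, Finset.sum_eq_single_of_mem ω₀ h4, if_pos h5]
          · simp
          · intro ω hω hne
            rw [if_neg fun h => hne (hΩp ω hω ω₀ h4 (by
              have := dvd_sub h5 h; rwa [sub_sub_sub_cancel_left] at this))]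
        · push Not at h3
          rw [if_pos ⟨h1.1, h3, h1.2⟩, Finset.sum_eq_zero fun ω hω => if_neg (h3 ω hω)]
          simp
      · rw [if_neg fun h => h1 ⟨h.1, h.2.2⟩, if_neg h1, Finset.sum_eq_zero]
        · simp
        · intro ω _
          rw [if_neg fun h => h1 ⟨h.1.1, h.2⟩]; simp
    have hcrt : ∀ ω, ∃ r' : ℤ, ∀ t, ((q : ℤ) ∣ t - r ∧ (p : ℤ) ∣ t - ω) ↔
        ((q * p : ℕ) : ℤ) ∣ t - r' := by
      intro ω
      have hc : IsCoprime (q : ℤ) (p : ℤ) :=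
        Nat.isCoprime_iff_coprime.2 (hcop p (Finset.mem_insert_self _ _)).symm
      obtain ⟨u, v, huv⟩ := hc
      refine ⟨r * (v * p) + ω * (u * q), fun t => ?_⟩
      push_cast
      have e1 : t - (r * (v * p) + ω * (u * q)) = (t - r) + (r - ω) * u * q := by
        linear_combination (-r) * huv
      have e2 : t - (r * (v * p) + ω * (u * q)) = (t - ω) + (ω - r) * v * p := by
        linear_combination (-ω) * huv
      constructor
      · rintro ⟨h1, h2⟩
        refine IsCoprime.mul_dvd ⟨u, v, huv⟩ ?_ ?_
        · rw [e1]; exact dvd_add h1 (dvd_mul_left _ _)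
        · rw [e2]; exact dvd_add h2 (dvd_mul_left _ _)
      · intro h
        constructor
        · have := (dvd_mul_right (q : ℤ) p).trans h
          rw [e1] at this
          exact (dvd_add_left (dvd_mul_left _ _)).1 this
        · have := (dvd_mul_left (p : ℤ) q).trans h
          rw [e2] at this
          exact (dvd_add_left (dvd_mul_left _ _)).1 this
    choose r' hr' using hcrt
    rw [hsplit, Finset.prod_insert hpP, Finset.prod_insert hpP]
    simp only [hr']
    have hA := ih' q hq (fun p' hp' => hcop p' (Finset.mem_insert_of_mem hp')) r
    have hB : ∀ ω ∈ Ω p, |((T.filter fun t => ((q * p : ℕ) : ℤ) ∣ t - r' ω ∧ ok t).card : ℝ) -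
        V / (q * p : ℕ) * ∏ p ∈ P, (1 - ((Ω p).card : ℝ) / p)| ≤
          K * ∏ p ∈ P, (1 + ((Ω p).card : ℝ)) := fun ω _ =>
      ih' (q * p) (Nat.mul_pos hq hpp.pos) (fun p' hp' => by
        refine Nat.Coprime.mul_right (hcop p' (Finset.mem_insert_of_mem hp')) ?_
        rw [Nat.coprime_primes (hP p' (Finset.mem_insert_of_mem hp')) hpp]
        rintro rfl; exact hpP hp') _
    set Pr := ∏ p ∈ P, (1 - ((Ω p).card : ℝ) / p)
    set E := K * ∏ p ∈ P, (1 + ((Ω p).card : ℝ)) with hE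
    set a := ((T.filter fun t => (q : ℤ) ∣ t - r ∧ ok t).card : ℝ)
    have hp0 : (p : ℝ) ≠ 0 := by exact_mod_cast hpp.ne_zero
    have hq0 : (q : ℝ) ≠ 0 := by exact_mod_cast hq.ne'
    have hid : a - (∑ ω ∈ Ω p,
        ((T.filter fun t => ((q * p : ℕ) : ℤ) ∣ t - r' ω ∧ ok t).card : ℝ)) -
        V / q * ((1 - ((Ω p).card : ℝ) / p) * Pr) =
        (a - V / q * Pr) - ∑ ω ∈ Ω p,
          (((T.filter fun t => ((q * p : ℕ) : ℤ) ∣ t - r' ω ∧ ok t).card : ℝ) -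
            V / (q * p : ℕ) * Pr) := by
      rw [Finset.sum_sub_distrib, Finset.sum_const, nsmul_eq_mul]
      push_cast
      field_simp
      ring
    rw [hid]
    calc _ ≤ |a - V / q * Pr| + |∑ ω ∈ Ω p,
          (((T.filter fun t => ((q * p : ℕ) : ℤ) ∣ t - r' ω ∧ ok t).card : ℝ) -
            V / (q * p : ℕ) * Pr)| := abs_sub _ _
      _ ≤ E + ∑ ω ∈ Ω p, E := by
          gcongr
          exact (Finset.abs_sum_le_sum_abs _ _).trans (Finset.sum_le_sum hB)
      _ = _ := by rw [Finset.sum_const, nsmul_eq_mul, hE]; ring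

/-- The number of integers in a bounded order-connected set differs from its length by at most
`1`. -/
theorem abs_ncard_int_sub_volume_le {S : Set ℝ} (hS : S.OrdConnected) {M : ℝ}
    (hM : S ⊆ Set.Icc (-M) M) :
    ((↑) ⁻¹' S : Set ℤ).Finite ∧ |((((↑) ⁻¹' S : Set ℤ)).ncard : ℝ) - volume.real S| ≤ 1 := by
  have hfin : ∀ a b : ℝ, ((↑) ⁻¹' Set.Icc a b : Set ℤ).Finite := fun a b => by
    rw [Int.preimage_Icc]; exact Set.finite_Icc _ _
  refine ⟨(hfin _ _).subset (Set.preimage_mono hM), ?_⟩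
  rcases S.eq_empty_or_nonempty with rfl | hne
  · simp
  have hbb : BddBelow S := ⟨-M, fun x hx => (hM hx).1⟩
  have hba : BddAbove S := ⟨M, fun x hx => (hM hx).2⟩
  set a := sInf S
  set b := sSup S
  have hab : a ≤ b := csInf_le_csSup hne hbb hba
  have h1 : S ⊆ Set.Icc a b := fun x hx => ⟨csInf_le hbb hx, le_csSup hba hx⟩
  have h2 : Set.Ioo a b ⊆ S := fun x hx => by
    obtain ⟨u, hu, hu'⟩ := exists_lt_of_csInf_lt hne hx.1
    obtain ⟨w, hw, hw'⟩ := exists_lt_of_lt_csSup hne hx.2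
    exact hS.out hu hw ⟨hu'.le, hw'.le⟩
  have hvol : volume.real S = b - a := by
    apply le_antisymm
    · calc volume.real S ≤ volume.real (Set.Icc a b) := measureReal_mono h1 (by simp)
        _ = b - a := by rw [Real.volume_real_Icc_of_le hab]
    · calc b - a = volume.real (Set.Ioo a b) := by rw [Real.volume_real_Ioo_of_le hab]
        _ ≤ volume.real S := measureReal_mono h2 (ne_top_of_le_ne_top (by simp) (measure_mono h1))
  have hup : (((↑) ⁻¹' S : Set ℤ).ncard : ℝ) ≤ b - a + 1 := by
    have h3 := Set.ncard_le_ncard (Set.preimage_mono (f := ((↑) : ℤ → ℝ)) h1) (hfin a b)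
    rw [Int.preimage_Icc, ← Finset.coe_Icc, Set.ncard_coe_finset, Int.card_Icc] at h3
    have h4 : (((⌊b⌋ + 1 - ⌈a⌉).toNat : ℕ) : ℝ) ≤ b - a + 1 := by
      rcases le_total 0 (⌊b⌋ + 1 - ⌈a⌉) with h | h
      · have h5 : (((⌊b⌋ + 1 - ⌈a⌉).toNat : ℕ) : ℝ) = ((⌊b⌋ + 1 - ⌈a⌉ : ℤ) : ℝ) := by
          exact_mod_cast congrArg (Int.cast (R := ℝ)) (Int.toNat_of_nonneg h)
        rw [h5]; push_cast
        linarith [Int.floor_le b, Int.le_ceil a]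
      · rw [Int.toNat_of_nonpos h]; simp; linarith
    exact le_trans (by exact_mod_cast h3) h4
  have hlow : b - a - 1 ≤ (((↑) ⁻¹' S : Set ℤ).ncard : ℝ) := by
    have h3 := Set.ncard_le_ncard (Set.preimage_mono (f := ((↑) : ℤ → ℝ)) h2)
      ((hfin _ _).subset (Set.preimage_mono hM))
    rw [Int.preimage_Ioo, ← Finset.coe_Ioo, Set.ncard_coe_finset, Int.card_Ioo] at h3
    have h4 : ((⌈b⌉ - ⌊a⌋ - 1 : ℤ) : ℝ) ≤ (((⌈b⌉ - ⌊a⌋ - 1).toNat : ℕ) : ℝ) := by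
      exact_mod_cast Int.self_le_toNat _
    push_cast at h4
    have h5 : (((⌈b⌉ - ⌊a⌋ - 1).toNat : ℕ) : ℝ) ≤ (((↑) ⁻¹' S : Set ℤ).ncard : ℝ) := by
      exact_mod_cast h3
    linarith [Int.le_ceil b, Int.floor_le a]
  rw [hvol, abs_le]
  constructor <;> linarith

/-- Integers `t` with `y₀ + M t` in an order-connected set. -/
theorem abs_ncard_affine_sub_le {S : Set ℝ} (hS : S.OrdConnected) {N : ℝ}
    (hN : S ⊆ Set.Icc (-N) N) {M : ℝ} (hM : 0 < M) (y₀ : ℝ) :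
    {t : ℤ | y₀ + M * t ∈ S}.Finite ∧
      |({t : ℤ | y₀ + M * t ∈ S}.ncard : ℝ) - volume.real S / M| ≤ 1 := by
  set S' : Set ℝ := (fun t => y₀ + M * t) ⁻¹' S with hS'
  have hord : S'.OrdConnected := by
    refine ⟨fun u hu w hw t ht => hS.out hu hw ⟨?_, ?_⟩⟩
    · have := ht.1; simp only; gcongr
    · have := ht.2; simp only; gcongr
  have hsub : S' ⊆ Set.Icc (-((N + |y₀|) / M)) ((N + |y₀|) / M) := by
    intro t ht
    have h1 := hN ht
    have h2 := neg_abs_le y₀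
    have h3 := le_abs_self y₀
    have h4 : y₀ + M * t ≤ N := h1.2
    have h5 : -N ≤ y₀ + M * t := h1.1
    constructor
    · rw [← neg_div, div_le_iff₀ hM]; linarith
    · rw [le_div_iff₀ hM]; linarith
  have hvol : volume.real S' = volume.real S / M := by
    have e : S' = (fun t => M * t) ⁻¹' ((fun t => y₀ + t) ⁻¹' S) := rfl
    rw [e, measureReal_def, Real.volume_preimage_mul_left hM.ne',
      measure_preimage_add, ENNReal.toReal_mul, measureReal_def, ENNReal.toReal_ofReal (by positivity),
      abs_of_pos (by positivity)]
    ring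
  have := abs_ncard_int_sub_volume_le hord hsub
  rw [hvol] at this
  exact this

/-- Equidistribution in residue classes for the integers `t` with `y₀ + M t` in a difference of two
bounded order-connected sets. -/
theorem abs_card_filter_dvd_sub_le {A A' : Set ℝ} (hA : A.OrdConnected) (hA' : A'.OrdConnected)
    (hsub : A' ⊆ A) (hm : MeasurableSet A') {N : ℝ} (hN : A ⊆ Set.Icc (-N) N)
    {M : ℝ} (hM : 0 < M) (y₀ : ℝ) {T : Finset ℤ} (hT : ∀ t : ℤ, t ∈ T ↔ y₀ + M * t ∈ A \ A')
    (q : ℕ) (hq : 0 < q) (r : ℤ) :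
    |((T.filter fun t => (q : ℤ) ∣ t - r).card : ℝ) - volume.real (A \ A') / M / q| ≤ 2 := by
  have hq0 : (0 : ℝ) < q := by exact_mod_cast hq
  obtain ⟨f1, h1⟩ := abs_ncard_affine_sub_le hA hN (mul_pos hM hq0) (y₀ + M * r)
  obtain ⟨f2, h2⟩ := abs_ncard_affine_sub_le hA' (hsub.trans hN) (mul_pos hM hq0) (y₀ + M * r)
  have hcard : ((T.filter fun t => (q : ℤ) ∣ t - r).card : ℝ) =
      ({t : ℤ | y₀ + M * r + M * q * t ∈ A}.ncard : ℝ) -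
        ({t : ℤ | y₀ + M * r + M * q * t ∈ A'}.ncard : ℝ) := by
    have himg : ((T.filter fun t => (q : ℤ) ∣ t - r : Finset ℤ) : Set ℤ) =
        (fun k : ℤ => r + q * k) '' ({t : ℤ | y₀ + M * r + M * q * t ∈ A} \
          {t : ℤ | y₀ + M * r + M * q * t ∈ A'}) := by
      ext t
      simp only [Finset.coe_filter, Set.mem_ofPred_eq, hT, Set.mem_image, Set.mem_sdiff]
      constructor
      · rintro ⟨h, k, hk⟩
        refine ⟨k, ?_, by linarith⟩
        have : (t : ℝ) = r + q * k := by
          have : t = r + q * k := by linarith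
          exact_mod_cast this
        rw [this] at h
        rw [show y₀ + M * r + M * q * k = y₀ + M * (r + q * k) by ring]
        exact h
      · rintro ⟨k, h, rfl⟩
        refine ⟨?_, ⟨k, by ring⟩⟩
        push_cast
        rw [show y₀ + M * r + M * q * k = y₀ + M * (r + q * k) by ring] at h
        exact h
    have hinj : Function.Injective fun k : ℤ => r + q * k := fun k k' h => by
      have : (q : ℤ) * k = q * k' := by simpa using h
      exact mul_left_cancel₀ (by exact_mod_cast hq.ne') this
    have hss : {t : ℤ | y₀ + M * r + M * q * t ∈ A'} ⊆ {t : ℤ | y₀ + M * r + M * q * t ∈ A} :=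
      fun t ht => hsub ht
    rw [← Set.ncard_coe_finset, himg, Set.ncard_image_of_injective _ hinj,
      Set.ncard_sdiff hss f2, Nat.cast_sub (Set.ncard_le_ncard hss f1)]
  have hvol : volume.real (A \ A') = volume.real A - volume.real A' :=
    measureReal_sdiff hsub hm
      (ne_top_of_le_ne_top (measure_Icc_lt_top.ne) (measure_mono hN))
  rw [hcard, hvol, div_div]
  rw [abs_le] at *
  have := sub_div (volume.real A) (volume.real A') (M * q)
  constructor <;> linarith [h1.1, h1.2, h2.1, h2.2]

/-! ### Pairs with prescribed divisibility -/

/-- The region of pairs `(x, y)` of absolute value at most `X` with `|x y (x + y)| ≤ Y`. -/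
def pairRegion (X Y : ℝ) : Set (ℝ × ℝ) :=
  {p | |p.1| ≤ X ∧ |p.2| ≤ X ∧ |p.1 * p.2 * (p.1 + p.2)| ≤ Y}

/-- The section of `pairRegion X Y` over a first coordinate `c` with `|c| ≤ X`. -/
def slice (X Y c : ℝ) : Set ℝ := {t | |t| ≤ X ∧ |c * t * (c + t)| ≤ Y}

theorem mul_add_le_of_mem_Icc {c u t w Z : ℝ} (h1 : u ≤ t) (h2 : t ≤ w) (hu : u * (c + u) ≤ Z)
    (hw : w * (c + w) ≤ Z) : t * (c + t) ≤ Z := by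
  rcases le_total 0 (u + w + c) with h | h
  · nlinarith [mul_nonneg (sub_nonneg.2 h1) (sub_nonneg.2 h2), mul_nonneg (sub_nonneg.2 h2) h]
  · nlinarith [mul_nonneg (sub_nonneg.2 h1) (sub_nonneg.2 h2),
      mul_nonneg (sub_nonneg.2 h1) (neg_nonneg.2 h)]

theorem mul_add_le_max {c u t w : ℝ} (h1 : u ≤ t) (h2 : t ≤ w) :
    t * (c + t) ≤ max (u * (c + u)) (w * (c + w)) :=
  mul_add_le_of_mem_Icc h1 h2 (le_max_left _ _) (le_max_right _ _)

/-- By convexity of `t (c + t)`, a slice is a difference of two bounded order-connected sets. -/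
theorem exists_slice_eq_sdiff {X Y : ℝ} (hY : 0 ≤ Y) (c : ℝ) :
    ∃ A A' : Set ℝ, A.OrdConnected ∧ A'.OrdConnected ∧ A' ⊆ A ∧ MeasurableSet A' ∧
      A ⊆ Set.Icc (-X) X ∧ slice X Y c = A \ A' := by
  refine ⟨{t | |t| ≤ X ∧ |c| * (t * (c + t)) ≤ Y}, {t | |t| ≤ X ∧ |c| * (t * (c + t)) < -Y},
    ⟨?_⟩, ⟨?_⟩, ?_, ?_, ?_, ?_⟩
  · rintro u ⟨hu, hu'⟩ w ⟨hw, hw'⟩ t ⟨h1, h2⟩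
    refine ⟨abs_le.2 ⟨(abs_le.1 hu).1.trans h1, h2.trans (abs_le.1 hw).2⟩, ?_⟩
    refine (mul_le_mul_of_nonneg_left (mul_add_le_max h1 h2) (abs_nonneg c)).trans ?_
    rcases max_choice (u * (c + u)) (w * (c + w)) with h | h <;> rw [h] <;> assumption
  · rintro u ⟨hu, hu'⟩ w ⟨hw, hw'⟩ t ⟨h1, h2⟩
    refine ⟨abs_le.2 ⟨(abs_le.1 hu).1.trans h1, h2.trans (abs_le.1 hw).2⟩, ?_⟩
    refine (mul_le_mul_of_nonneg_left (mul_add_le_max h1 h2) (abs_nonneg c)).trans_lt ?_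
    rcases max_choice (u * (c + u)) (w * (c + w)) with h | h <;> rw [h] <;> assumption
  · rintro t ⟨h1, h2⟩
    exact ⟨h1, by linarith⟩
  · exact (measurableSet_le (f := fun t : ℝ => |t|) continuous_abs.measurable
        measurable_const).inter
      (measurableSet_lt (f := fun t : ℝ => |c| * (t * (c + t))) (by fun_prop) measurable_const)
  · rintro t ⟨h1, _⟩
    exact abs_le.1 h1
  · ext t
    simp only [slice, Set.mem_ofPred_eq, Set.mem_sdiff, not_and, not_lt]
    rw [show |c * t * (c + t)| = |(|c| * (t * (c + t)))| by
      rw [abs_mul, abs_mul, abs_mul, abs_mul, abs_abs, mul_assoc], abs_le (a := |c| * (t * (c + t)))]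
    tauto

theorem finite_affine_slice {X Y : ℝ} (c : ℝ) {M : ℝ} (hM : 0 < M) (y₀ : ℝ) :
    {t : ℤ | y₀ + M * t ∈ slice X Y c}.Finite := by
  refine ((abs_ncard_affine_sub_le (S := Set.Icc (-X) X) Set.ordConnected_Icc subset_rfl hM
    y₀).1).subset fun t ht => ?_
  exact abs_le.1 ht.1

/-- Sieving the integers `t` with `y₀ + M t` in a slice. -/
theorem abs_card_slice_sieve_sub_le {X Y : ℝ} (hY : 0 ≤ Y) (c : ℝ) {M : ℝ} (hM : 0 < M) (y₀ : ℝ)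
    {T : Finset ℤ} (hT : ∀ t : ℤ, t ∈ T ↔ y₀ + M * t ∈ slice X Y c)
    (Ω : ℕ → Finset ℤ) (P : Finset ℕ) (hP : ∀ p ∈ P, p.Prime)
    (hΩ : ∀ p ∈ P, ∀ ω ∈ Ω p, ∀ ω' ∈ Ω p, (p : ℤ) ∣ ω - ω' → ω = ω') :
    |((T.filter fun t => ∀ p ∈ P, ∀ ω ∈ Ω p, ¬ (p : ℤ) ∣ t - ω).card : ℝ) -
        volume.real (slice X Y c) / M * ∏ p ∈ P, (1 - ((Ω p).card : ℝ) / p)| ≤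
      2 * ∏ p ∈ P, (1 + ((Ω p).card : ℝ)) := by
  obtain ⟨A, A', hA, hA', hsub, hm, hN, he⟩ := exists_slice_eq_sdiff (X := X) hY c
  rw [he] at hT ⊢
  have := abs_card_sieve_sub_le (T := T)
    (fun q hq r => abs_card_filter_dvd_sub_le hA hA' hsub hm hN hM y₀ hT q hq r) Ω P hP hΩ 1
    one_pos (fun p _ => Nat.coprime_one_right p) 0
  simpa using this

/-- The residues modulo `p` at which one of two linear forms vanishes. -/
noncomputable def badResidues (b n c m : ℤ) (p : ℕ) : Finset ℤ :=
  (Finset.Ico 0 (p : ℤ)).filter fun t => (p : ℤ) ∣ b + n * t ∨ (p : ℤ) ∣ c + m * t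

theorem eq_of_mem_badResidues {b n c m : ℤ} {p : ℕ} {ω ω' : ℤ} (h : ω ∈ badResidues b n c m p)
    (h' : ω' ∈ badResidues b n c m p) (hd : (p : ℤ) ∣ ω - ω') : ω = ω' := by
  simp only [badResidues, Finset.mem_filter, Finset.mem_Ico] at h h'
  have := Int.eq_zero_of_abs_lt_dvd hd (by
    rw [abs_lt]; constructor <;> linarith [h.1.1, h.1.2, h'.1.1, h'.1.2])
  linarith

theorem forall_badResidues_iff {b n c m : ℤ} {p : ℕ} (hp : 0 < p) (t : ℤ) :
    (∀ ω ∈ badResidues b n c m p, ¬ (p : ℤ) ∣ t - ω) ↔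
      ¬ (p : ℤ) ∣ b + n * t ∧ ¬ (p : ℤ) ∣ c + m * t := by
  have key : ∀ b n ω : ℤ, (p : ℤ) ∣ t - ω → ((p : ℤ) ∣ b + n * t ↔ (p : ℤ) ∣ b + n * ω) := by
    intro b n ω h
    rw [show b + n * t = b + n * ω + n * (t - ω) by ring]
    exact dvd_add_left (h.mul_left _)
  have hp' : (0 : ℤ) < p := by exact_mod_cast hp
  have hmod : (p : ℤ) ∣ t - t % p := Int.dvd_self_sub_emod
  constructor
  · intro h
    rw [← not_or]
    intro hor
    refine h (t % p) ?_ hmod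
    simp only [badResidues, Finset.mem_filter, Finset.mem_Ico]
    refine ⟨⟨Int.emod_nonneg _ hp'.ne', Int.emod_lt_of_pos _ hp'⟩, ?_⟩
    rwa [← key b n _ hmod, ← key c m _ hmod]
  · rintro ⟨h1, h2⟩ ω hω hd
    simp only [badResidues, Finset.mem_filter, Finset.mem_Ico] at hω
    rcases hω.2 with h | h
    · exact h1 ((key b n ω hd).2 h)
    · exact h2 ((key c m ω hd).2 h)

theorem exists_residue {p : ℕ} (hp : p.Prime) (b : ℤ) {n : ℤ} (hn : ¬ (p : ℤ) ∣ n) :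
    ∃ ω ∈ Finset.Ico 0 (p : ℤ), ∀ t ∈ Finset.Ico 0 (p : ℤ), (p : ℤ) ∣ b + n * t ↔ t = ω := by
  have hp' : (0 : ℤ) < p := by exact_mod_cast hp.pos
  have hpp := Nat.prime_iff_prime_int.1 hp
  obtain ⟨u, v, huv⟩ := (Prime.coprime_iff_not_dvd hpp).2 hn
  have hmod : (p : ℤ) ∣ -b * v - (-b * v) % p := Int.dvd_self_sub_emod
  have h0 : (p : ℤ) ∣ b + n * ((-b * v) % p) := by
    have e : b + n * ((-b * v) % p) = p * (b * u) - n * (-b * v - (-b * v) % p) := by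
      linear_combination (-b) * huv
    rw [e]
    exact dvd_sub (dvd_mul_right _ _) (hmod.mul_left _)
  refine ⟨(-b * v) % p, Finset.mem_Ico.2 ⟨Int.emod_nonneg _ hp'.ne', Int.emod_lt_of_pos _ hp'⟩,
    fun t ht => ⟨fun h => ?_, fun h => h ▸ h0⟩⟩
  rw [Finset.mem_Ico] at ht
  have h1 : (p : ℤ) ∣ n * (t - (-b * v) % p) := by
    have := dvd_sub h h0
    rwa [add_sub_add_left_eq_sub, ← mul_sub] at this
  have h2 := (hpp.dvd_or_dvd h1).resolve_left hn
  have h3 := Int.emod_nonneg (-b * v) hp'.ne'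
  have h4 := Int.emod_lt_of_pos (-b * v) hp'
  have := Int.eq_zero_of_abs_lt_dvd h2 (by rw [abs_lt]; constructor <;> linarith)
  linarith

theorem card_badResidues_two {p : ℕ} (hp : p.Prime) {b n c m : ℤ} (hn : ¬ (p : ℤ) ∣ n)
    (hm : ¬ (p : ℤ) ∣ m) (hne : ∀ t, (p : ℤ) ∣ b + n * t → ¬ (p : ℤ) ∣ c + m * t) :
    (badResidues b n c m p).card = 2 := by
  obtain ⟨ω, hω, h1⟩ := exists_residue hp b hn
  obtain ⟨ω', hω', h2⟩ := exists_residue hp c hm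
  rw [Finset.card_eq_two]
  refine ⟨ω, ω', fun h => ?_, ?_⟩
  · exact hne ω ((h1 ω hω).2 rfl) ((h2 ω hω).2 h)
  · ext t
    simp only [badResidues, Finset.mem_filter, Finset.mem_insert, Finset.mem_singleton]
    constructor
    · rintro ⟨ht, h⟩
      rwa [h1 t ht, h2 t ht] at h
    · rintro (rfl | rfl)
      · exact ⟨hω, Or.inl ((h1 _ hω).2 rfl)⟩
      · exact ⟨hω', Or.inr ((h2 _ hω').2 rfl)⟩

theorem card_badResidues_one {p : ℕ} (hp : p.Prime) {b n c m : ℤ} (hn : ¬ (p : ℤ) ∣ n)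
    (hne : ∀ t, (p : ℤ) ∣ c + m * t → (p : ℤ) ∣ b + n * t) :
    (badResidues b n c m p).card = 1 := by
  obtain ⟨ω, hω, h1⟩ := exists_residue hp b hn
  rw [Finset.card_eq_one]
  refine ⟨ω, ?_⟩
  ext t
  simp only [badResidues, Finset.mem_filter, Finset.mem_singleton]
  constructor
  · rintro ⟨ht, h | h⟩
    · exact (h1 t ht).1 h
    · exact (h1 t ht).1 (hne t h)
  · rintro rfl
    exact ⟨hω, Or.inl ((h1 _ hω).2 rfl)⟩

theorem badResidues_comm (b n c m : ℤ) (p : ℕ) : badResidues b n c m p = badResidues c m b n p := by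
  simp only [badResidues, or_comm]

/-- The pairs `(x, y)` of integers in `pairRegion X Y` such that for `z = s n₁ n₂ n₃` the triple
`(x, y, z)` is primitive and `gcd(z, x) = n₁`, `gcd(z, y) = n₂`, `gcd(z, x + y) = n₃`. -/
def pairSet (s n₁ n₂ n₃ : ℕ) (X Y : ℝ) : Set (ℤ × ℤ) :=
  {w | ((w.1 : ℝ), (w.2 : ℝ)) ∈ pairRegion X Y ∧
    Int.gcd ((s * n₁ * n₂ * n₃ : ℕ) : ℤ) w.1 = n₁ ∧ Int.gcd ((s * n₁ * n₂ * n₃ : ℕ) : ℤ) w.2 = n₂ ∧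
    Int.gcd ((s * n₁ * n₂ * n₃ : ℕ) : ℤ) (w.1 + w.2) = n₃ ∧
    ∀ p : ℕ, p.Prime → (p : ℤ) ∣ w.1 → (p : ℤ) ∣ w.2 → ¬ p ∣ s * n₁ * n₂ * n₃}

theorem gcd_mul_eq_iff {n m z : ℕ} (hz : z = n * m) (hn : 0 < n) (a : ℤ) :
    Int.gcd (z : ℤ) (n * a) = n ↔ ∀ p : ℕ, p.Prime → p ∣ m → ¬ (p : ℤ) ∣ a := by
  rw [hz]
  push_cast
  rw [Int.gcd_mul_left, Int.natAbs_natCast]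
  have h1 : n * Int.gcd (m : ℤ) a = n ↔ Nat.Coprime m a.natAbs := by
    rw [Nat.mul_eq_left hn.ne', Nat.Coprime, Int.gcd, Int.natAbs_natCast]
  rw [h1]
  simp only [Int.natCast_dvd]
  constructor
  · intro h p hp h2 h3
    exact Nat.not_coprime_of_dvd_of_dvd hp.one_lt h2 h3 h
  · intro h
    exact Nat.Coprime.symm (Nat.coprime_of_dvd fun p hp h2 h3 => h p hp h3 h2)

theorem finite_pairSet (s n₁ n₂ n₃ : ℕ) (X Y : ℝ) : (pairSet s n₁ n₂ n₃ X Y).Finite := by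
  have hfin : ((↑) ⁻¹' Set.Icc (-X) X : Set ℤ).Finite := by
    rw [Int.preimage_Icc]; exact Set.finite_Icc _ _
  refine (hfin.prod hfin).subset fun w hw => ⟨?_, ?_⟩
  · exact abs_le.1 hw.1.1
  · exact abs_le.1 hw.1.2.1

/-- The number of residue classes modulo `p` removed by the sieve over `y`: one if `p` divides `n`,
two otherwise. -/
noncomputable def sieveCount (n p : ℕ) : ℝ := if p ∣ n then 1 else 2

section Count

variable {s n₁ n₂ n₃ : ℕ}

/-- For a fixed first coordinate `x = n₁ a`, the admissible `y` form an arithmetic progression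
modulo `n₂ n₃` from which residue classes modulo the primes dividing `s n₁` are removed. -/
theorem abs_card_fiber_sub_le (hs : 0 < s) (h1 : 0 < n₁) (h2 : 0 < n₂) (h3 : 0 < n₃)
    (h12 : n₁.Coprime n₂) (h13 : n₁.Coprime n₃) (h23 : n₂.Coprime n₃) {X Y : ℝ} (hY : 0 ≤ Y)
    {F : Finset (ℤ × ℤ)} (hF : ∀ w, w ∈ F ↔ w ∈ pairSet s n₁ n₂ n₃ X Y) {a : ℤ}
    (haX : |(n₁ : ℝ) * a| ≤ X) (ha : ∀ p : ℕ, p.Prime → p ∣ s * n₂ * n₃ → ¬ (p : ℤ) ∣ a) :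
    |((F.filter fun w => w.1 = n₁ * a).card : ℝ) -
        volume.real (slice X Y (n₁ * a)) / (n₂ * n₃) *
          ∏ p ∈ (s * n₁).primeFactors, (1 - sieveCount (n₁ * n₂ * n₃) p / p)| ≤
      2 * 3 ^ (s * n₁).primeFactors.card := by
  -- The conditions `n₂ ∣ y` and `n₃ ∣ x + y` are solved by `y = n₂ (b₀ + n₃ t)`, for which
  -- `x + y = n₃ (c₀ + n₂ t)`.
  obtain ⟨b₀, c₀, hbc⟩ : ∃ b₀ c₀ : ℤ, n₁ * a + n₂ * b₀ = n₃ * c₀ := by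
    obtain ⟨u, v, huv⟩ := Nat.isCoprime_iff_coprime.2 h23
    exact ⟨-(u * (n₁ * a)), v * (n₁ * a), by linear_combination (-(n₁ * a : ℤ)) * huv⟩
  have hM : (0 : ℝ) < n₂ * n₃ := by positivity
  have hsum : ∀ t : ℤ, (n₁ * a + n₂ * (b₀ + n₃ * t) : ℤ) = n₃ * (c₀ + n₂ * t) := fun t => by
    linear_combination hbc
  have nd : ∀ {p m n : ℕ}, p.Prime → m.Coprime n → p ∣ m → ¬ p ∣ n := fun hp hmn hm hn =>
    Nat.not_coprime_of_dvd_of_dvd hp.one_lt hm hn hmn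
  have hfinT := finite_affine_slice (X := X) (Y := Y) (n₁ * a) hM (n₂ * b₀)
  set T := hfinT.toFinset with hTdef
  have hT : ∀ t : ℤ, t ∈ T ↔ (n₂ * b₀ : ℝ) + n₂ * n₃ * t ∈ slice X Y (n₁ * a) := fun t => by
    simp [hTdef]
  set P := (s * n₁).primeFactors with hP
  have hPp : ∀ p ∈ P, p.Prime := fun p hp => Nat.prime_of_mem_primeFactors hp
  set Ω := badResidues b₀ n₃ c₀ n₂ with hΩ
  have key := abs_card_slice_sieve_sub_le hY (n₁ * a) hM (n₂ * b₀) hT Ω P hPp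
    (fun p _ ω hω ω' hω' h => eq_of_mem_badResidues hω hω' h)
  -- the fibre of `F` is parametrised by the sieved set of `t`
  have hmem : ∀ t : ℤ, ((n₁ * a : ℤ), (n₂ * (b₀ + n₃ * t) : ℤ)) ∈ F ↔
      t ∈ T.filter fun t => ∀ p ∈ P, ∀ ω ∈ Ω p, ¬ (p : ℤ) ∣ t - ω := by
    intro t
    rw [hF, Finset.mem_filter, hT]
    have hsieve : (∀ p ∈ P, ∀ ω ∈ Ω p, ¬ (p : ℤ) ∣ t - ω) ↔ ∀ p : ℕ, p.Prime → p ∣ s * n₁ →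
        ¬ (p : ℤ) ∣ b₀ + n₃ * t ∧ ¬ (p : ℤ) ∣ c₀ + n₂ * t := by
      simp only [hP, Nat.mem_primeFactors_of_ne_zero (Nat.mul_pos hs h1).ne', and_imp]
      exact forall₃_congr fun p hp _ => forall_badResidues_iff hp.pos t
    rw [hsieve]
    simp only [pairSet, Set.mem_ofPred_eq, hsum]
    rw [gcd_mul_eq_iff (show s * n₁ * n₂ * n₃ = n₁ * (s * n₂ * n₃) by ring) h1,
      gcd_mul_eq_iff (show s * n₁ * n₂ * n₃ = n₂ * (s * n₁ * n₃) by ring) h2,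
      gcd_mul_eq_iff (show s * n₁ * n₂ * n₃ = n₃ * (s * n₁ * n₂) by ring) h3]
    have hreg : (((n₁ * a : ℤ) : ℝ), ((n₂ * (b₀ + n₃ * t) : ℤ) : ℝ)) ∈ pairRegion X Y ↔
        (n₂ * b₀ : ℝ) + n₂ * n₃ * t ∈ slice X Y (n₁ * a) := by
      simp only [pairRegion, slice, Set.mem_ofPred_eq]
      push_cast
      rw [show (n₂ * (b₀ + n₃ * t) : ℝ) = n₂ * b₀ + n₂ * n₃ * t by ring]
      exact and_iff_right haX
    rw [hreg]
    refine and_congr_right fun _ => ?_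
    constructor
    · rintro ⟨_, hb, hc, _⟩ p hp hd
      exact ⟨hb p hp (hd.mul_right _), hc p hp (hd.mul_right _)⟩
    · intro h
      have hpn := fun {p : ℕ} (hp : p.Prime) => Nat.prime_iff_prime_int.1 hp
      refine ⟨ha, fun p hp hd hb => ?_, fun p hp hd hc => ?_, fun p hp hx hy hz => ?_⟩
      · rcases (hp.dvd_mul).1 hd with hd | hd
        · exact (h p hp hd).1 hb
        · have e : (p : ℤ) ∣ n₁ * a := by
            have e1 : (n₁ * a : ℤ) = n₃ * (c₀ + n₂ * t) - n₂ * (b₀ + n₃ * t) := by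
              linear_combination hbc
            rw [e1]
            exact dvd_sub ((Int.natCast_dvd_natCast.2 hd).mul_right _) (hb.mul_left _)
          rcases (hpn hp).dvd_or_dvd e with e | e
          · exact nd hp h13 (Int.natCast_dvd_natCast.1 e) hd
          · exact ha p hp (hd.mul_left _) e
      · rcases (hp.dvd_mul).1 hd with hd | hd
        · exact (h p hp hd).2 hc
        · have e : (p : ℤ) ∣ n₁ * a := by
            have e1 : (n₁ * a : ℤ) = n₃ * (c₀ + n₂ * t) - n₂ * (b₀ + n₃ * t) := by
              linear_combination hbc
            rw [e1]
            exact dvd_sub (hc.mul_left _) ((Int.natCast_dvd_natCast.2 hd).mul_right _)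
          rcases (hpn hp).dvd_or_dvd e with e | e
          · exact nd hp h12 (Int.natCast_dvd_natCast.1 e) hd
          · exact ha p hp ((hd.mul_left _).mul_right _) e
      · by_cases hp1 : p ∣ n₁
        · rcases (hpn hp).dvd_or_dvd hy with e | e
          · exact nd hp h12 hp1 (Int.natCast_dvd_natCast.1 e)
          · exact (h p hp (hp1.mul_left _)).1 e
        · have e : (p : ℤ) ∣ a := ((hpn hp).dvd_or_dvd hx).resolve_left fun e =>
            hp1 (Int.natCast_dvd_natCast.1 e)
          refine ha p hp ?_ e
          rw [show s * n₁ * n₂ * n₃ = n₁ * (s * n₂ * n₃) by ring] at hz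
          exact ((hp.dvd_mul).1 hz).resolve_left hp1
  have hcard : (F.filter fun w => w.1 = n₁ * a).card =
      (T.filter fun t => ∀ p ∈ P, ∀ ω ∈ Ω p, ¬ (p : ℤ) ∣ t - ω).card := by
    refine (Finset.card_bij (fun t _ => ((n₁ * a : ℤ), (n₂ * (b₀ + n₃ * t) : ℤ)))
      (fun t ht => Finset.mem_filter.2 ⟨(hmem t).2 ht, rfl⟩) (fun t _ t' _ h => ?_)
      (fun w hw => ?_)).symm
    · have e := (Prod.mk.inj h).2
      have e1 := mul_left_cancel₀ (by exact_mod_cast h2.ne') e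
      exact mul_left_cancel₀ (by exact_mod_cast h3.ne') (add_left_cancel e1)
    · obtain ⟨hw, hwa⟩ := Finset.mem_filter.1 hw
      have hw' := (hF w).1 hw
      have d2 : (n₂ : ℤ) ∣ w.2 := by
        have := Int.gcd_dvd_right ((s * n₁ * n₂ * n₃ : ℕ) : ℤ) w.2
        rwa [hw'.2.2.1] at this
      have d3 : (n₃ : ℤ) ∣ w.1 + w.2 := by
        have := Int.gcd_dvd_right ((s * n₁ * n₂ * n₃ : ℕ) : ℤ) (w.1 + w.2)
        rwa [hw'.2.2.2.1] at this
      obtain ⟨b, hb⟩ := d2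
      have d4 : (n₃ : ℤ) ∣ n₂ * (b - b₀) := by
        have e : (n₂ * (b - b₀) : ℤ) = (w.1 + w.2) - n₃ * c₀ := by
          rw [hwa, hb]; linear_combination (-1 : ℤ) * hbc
        rw [e]
        exact dvd_sub d3 (dvd_mul_right _ _)
      obtain ⟨t, ht⟩ := IsCoprime.dvd_of_dvd_mul_left
        (Nat.isCoprime_iff_coprime.2 h23.symm) d4
      have hwt : ((n₁ * a : ℤ), (n₂ * (b₀ + n₃ * t) : ℤ)) = w := by
        ext
        · exact hwa.symm
        · simp only; rw [hb, ← ht]; ring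
      exact ⟨t, (hmem t).1 (hwt ▸ hw), hwt⟩
  -- By `lin`, the two residue classes excluded modulo `p` are disjoint if `p` is prime to `n₁ n₂ n₃`.
  -- If `p` divides `n₁`, they coincide; if `p` divides `n₂` or `n₃`, one of them is empty.
  have hΩcard : ∀ p ∈ P, ((Ω p).card : ℝ) = sieveCount (n₁ * n₂ * n₃) p := by
    intro p hpP
    have hp := hPp p hpP
    have hpn := Nat.prime_iff_prime_int.1 hp
    have hdsn : p ∣ s * n₁ := Nat.dvd_of_mem_primeFactors hpP
    have lin : ∀ t : ℤ, (n₁ * a : ℤ) = n₃ * (c₀ + n₂ * t) - n₂ * (b₀ + n₃ * t) := fun t => by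
      linear_combination hbc
    by_cases hd1 : p ∣ n₁
    · have hd2 := nd hp h12 hd1
      have hd3 := nd hp h13 hd1
      have hz : (p : ℤ) ∣ n₁ * a := (Int.natCast_dvd_natCast.2 hd1).mul_right _
      rw [sieveCount, if_pos ((hd1.mul_right _).mul_right _), hΩ, card_badResidues_one hp]
      · simp
      · exact fun e => hd3 (Int.natCast_dvd_natCast.1 e)
      · intro t ht
        have : (p : ℤ) ∣ n₂ * (b₀ + n₃ * t) := by
          have e : (n₂ * (b₀ + n₃ * t) : ℤ) = n₃ * (c₀ + n₂ * t) - n₁ * a := by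
            linear_combination lin t
          rw [e]
          exact dvd_sub (ht.mul_left _) hz
        exact (hpn.dvd_or_dvd this).resolve_left fun e => hd2 (Int.natCast_dvd_natCast.1 e)
    · have hds : p ∣ s := ((hp.dvd_mul).1 hdsn).resolve_right hd1
      have hda := ha p hp ((hds.mul_right _).mul_right _)
      have hz : ¬ (p : ℤ) ∣ n₁ * a := fun e => (hpn.dvd_or_dvd e).elim
        (fun e => hd1 (Int.natCast_dvd_natCast.1 e)) hda
      by_cases hd2 : p ∣ n₂
      · have hd3 := nd hp h23 hd2
        rw [sieveCount, if_pos ((hd2.mul_left _).mul_right _), hΩ, card_badResidues_one hp]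
        · simp
        · exact fun e => hd3 (Int.natCast_dvd_natCast.1 e)
        · intro t ht
          refine absurd ?_ hz
          rw [lin t]
          exact dvd_sub (ht.mul_left _) ((Int.natCast_dvd_natCast.2 hd2).mul_right _)
      · by_cases hd3 : p ∣ n₃
        · rw [sieveCount, if_pos (hd3.mul_left _), hΩ, badResidues_comm, card_badResidues_one hp]
          · simp
          · exact fun e => hd2 (Int.natCast_dvd_natCast.1 e)
          · intro t ht
            refine absurd ?_ hz
            rw [lin t]
            exact dvd_sub ((Int.natCast_dvd_natCast.2 hd3).mul_right _) (ht.mul_left _)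
        · rw [sieveCount, if_neg, hΩ, card_badResidues_two hp]
          · simp
          · exact fun e => hd3 (Int.natCast_dvd_natCast.1 e)
          · exact fun e => hd2 (Int.natCast_dvd_natCast.1 e)
          · intro t ht ht'
            refine hz ?_
            rw [lin t]
            exact dvd_sub (ht'.mul_left _) (ht.mul_left _)
          · simp [hp.dvd_mul, hd1, hd2, hd3]
  rw [hcard]
  have e1 : ∏ p ∈ P, (1 - ((Ω p).card : ℝ) / p) =
      ∏ p ∈ P, (1 - sieveCount (n₁ * n₂ * n₃) p / p) :=
    Finset.prod_congr rfl fun p hp => by rw [hΩcard p hp]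
  have e2 : ∏ p ∈ P, (1 + ((Ω p).card : ℝ)) ≤ 3 ^ P.card := by
    rw [← Finset.prod_const]
    refine Finset.prod_le_prod (fun p _ => by positivity) fun p hp => ?_
    rw [hΩcard p hp, sieveCount]
    split_ifs <;> norm_num
  rw [e1] at key
  linarith

end Count

/-! ### Counting the pairs by slices -/

theorem measurableSet_cubic_le (Y : ℝ) :
    MeasurableSet {p : ℝ × ℝ | |p.1 * p.2 * (p.1 + p.2)| ≤ Y} :=
  measurableSet_le measurable_cubic measurable_const

theorem pairRegion_eq (X Y : ℝ) : pairRegion X Y =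
    {p : ℝ × ℝ | |p.1 * p.2 * (p.1 + p.2)| ≤ Y} ∩ Set.Icc (-X) X ×ˢ Set.Icc (-X) X := by
  ext p
  simp only [pairRegion, Set.mem_ofPred_eq, Set.mem_inter_iff, Set.mem_prod, Set.mem_Icc, ← abs_le]
  tauto

theorem volume_real_slice (X Y c : ℝ) : volume.real (slice X Y c) =
    ∫ y in Set.Icc (-X) X, if |c * y * (c + y)| ≤ Y then (1 : ℝ) else 0 := by
  have hm : MeasurableSet {y : ℝ | |c * y * (c + y)| ≤ Y} :=
    measurableSet_le (by fun_prop) measurable_const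
  have e : (fun y => if |c * y * (c + y)| ≤ Y then (1 : ℝ) else 0) =
      {y : ℝ | |c * y * (c + y)| ≤ Y}.indicator 1 := by
    ext y; simp [Set.indicator_apply]
  rw [e, integral_indicator_one hm, measureReal_restrict_apply hm]
  congr 1
  ext y
  simp only [slice, Set.mem_ofPred_eq, Set.mem_inter_iff, Set.mem_Icc, ← abs_le]
  tauto

theorem integrableOn_cubic_le (X Y : ℝ) : IntegrableOn
    (fun p : ℝ × ℝ => if |p.1 * p.2 * (p.1 + p.2)| ≤ Y then (1 : ℝ) else 0)
    (Set.Icc (-X) X ×ˢ Set.Icc (-X) X) := by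
  have e : (fun p : ℝ × ℝ => if |p.1 * p.2 * (p.1 + p.2)| ≤ Y then (1 : ℝ) else 0) =
      {p : ℝ × ℝ | |p.1 * p.2 * (p.1 + p.2)| ≤ Y}.indicator 1 := by
    ext y; simp [Set.indicator_apply]
  have hfin : volume (Set.Icc (-X) X ×ˢ Set.Icc (-X) X) ≠ ⊤ := by
    rw [Measure.volume_eq_prod, Measure.prod_prod]
    exact ENNReal.mul_ne_top measure_Icc_lt_top.ne measure_Icc_lt_top.ne
  rw [e]
  exact ((integrableOn_const (C := (1 : ℝ)) hfin)).indicator (measurableSet_cubic_le Y)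

theorem integrableOn_volume_slice (X Y : ℝ) :
    IntegrableOn (fun y => volume.real (slice X Y y)) (Set.Icc (-X) X) := by
  have h := integrableOn_cubic_le X Y
  rw [IntegrableOn, Measure.volume_eq_prod, ← Measure.prod_restrict] at h
  have := h.integral_prod_left
  simpa only [IntegrableOn, volume_real_slice] using this

theorem volume_real_pairRegion (X Y : ℝ) :
    volume.real (pairRegion X Y) = ∫ x in Set.Icc (-X) X, volume.real (slice X Y x) := by
  simp only [volume_real_slice]
  rw [← setIntegral_prod _ (integrableOn_cubic_le X Y)]
  have e : (fun p : ℝ × ℝ => if |p.1 * p.2 * (p.1 + p.2)| ≤ Y then (1 : ℝ) else 0) =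
      {p : ℝ × ℝ | |p.1 * p.2 * (p.1 + p.2)| ≤ Y}.indicator 1 := by
    ext y; simp [Set.indicator_apply]
  rw [e, integral_indicator_one (measurableSet_cubic_le Y),
    measureReal_restrict_apply (measurableSet_cubic_le Y), pairRegion_eq, Measure.volume_eq_prod]

/-- Summing the lengths of the slices over `x = n a` with `a` coprime to `m`, by exchanging the
sum with the integral over `y` and sieving the `a`. -/
theorem abs_sum_slice_sub_le {X Y : ℝ} (hX : 0 ≤ X) (hY : 0 ≤ Y) {n m : ℕ} (hn : 0 < n)
    {A : Finset ℤ} (hA : ∀ a : ℤ, a ∈ A ↔ |(n : ℝ) * a| ≤ X ∧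
      ∀ p ∈ m.primeFactors, ¬ (p : ℤ) ∣ a) :
    |∑ a ∈ A, volume.real (slice X Y (n * a)) -
        volume.real (pairRegion X Y) / n * ∏ p ∈ m.primeFactors, (1 - 1 / (p : ℝ))| ≤
      4 * 2 ^ m.primeFactors.card * X := by
  have hn' : (0 : ℝ) < n := by exact_mod_cast hn
  set D := ∏ p ∈ m.primeFactors, (1 - 1 / (p : ℝ))
  set g : ℤ → ℝ → ℝ := fun a y => if |(n * a) * y * (n * a + y)| ≤ Y then (1 : ℝ) else 0 with hg
  have hgi : ∀ a ∈ A, Integrable (g a) (volume.restrict (Set.Icc (-X) X)) := by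
    intro a _
    have e : g a = {y : ℝ | |(n * a) * y * (n * a + y)| ≤ Y}.indicator 1 := by
      ext y; simp [hg, Set.indicator_apply]
    rw [e]
    exact (integrable_const (1 : ℝ)).indicator (measurableSet_le (by fun_prop) measurable_const)
  have h1 : ∑ a ∈ A, volume.real (slice X Y (n * a)) =
      ∫ y in Set.Icc (-X) X, ∑ a ∈ A, g a y := by
    rw [integral_finsetSum _ hgi]
    exact Finset.sum_congr rfl fun a _ => volume_real_slice _ _ _
  rw [h1, volume_real_pairRegion, div_mul_eq_mul_div, ← integral_mul_const, ← integral_div,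
    ← integral_sub (integrable_finsetSum _ hgi)
      (((integrableOn_volume_slice X Y).mul_const D).div_const _)]
  have hb : ∀ y ∈ Set.Icc (-X) X,
      ‖∑ a ∈ A, g a y - volume.real (slice X Y y) * D / n‖ ≤ 2 * 2 ^ m.primeFactors.card := by
    intro y hy
    set T := (finite_affine_slice (X := X) (Y := Y) y hn' 0).toFinset with hT
    have key := abs_card_slice_sieve_sub_le (X := X) hY y hn' 0 (T := T)
      (fun t => by simp [hT])
      (fun _ => {0}) m.primeFactors (fun p hp => Nat.prime_of_mem_primeFactors hp)
      (fun p _ ω hω ω' hω' _ => by simp_all)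
    have hc : ∑ a ∈ A, g a y =
        ((T.filter fun t => ∀ p ∈ m.primeFactors, ∀ ω ∈ ({0} : Finset ℤ), ¬ (p : ℤ) ∣ t - ω).card
          : ℝ) := by
      rw [hg, Finset.sum_boole]
      congr 2
      ext a
      simp only [Finset.mem_filter, hA, hT, Set.Finite.mem_toFinset, Set.mem_ofPred_eq,
        Finset.mem_singleton, forall_eq, sub_zero, zero_add, slice]
      rw [show y * (n * a) * (y + n * a) = (n * a) * y * (n * a + y) by ring]
      tauto
    rw [hc, Real.norm_eq_abs]
    simp only [Finset.card_singleton, Nat.cast_one, Finset.prod_const] at key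
    calc _ = _ := by rw [mul_div_right_comm]
      _ ≤ _ := key
      _ = _ := by norm_num
  have := norm_setIntegral_le_of_norm_le_const (μ := volume) measure_Icc_lt_top hb
  rw [Real.volume_real_Icc_of_le (by linarith), Real.norm_eq_abs] at this
  linarith

/-- The density is the product of the densities of the two sieves. -/
theorem prod_mul_prod_eq_density {s n₁ n₂ n₃ : ℕ} (hs : 0 < s) (h1 : 0 < n₁) (h2 : 0 < n₂)
    (h3 : 0 < n₃) (h12 : n₁.Coprime n₂) (h13 : n₁.Coprime n₃) (h23 : n₂.Coprime n₃) :
    (∏ p ∈ (s * n₁).primeFactors, (1 - sieveCount (n₁ * n₂ * n₃) p / p)) *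
      ∏ p ∈ (s * n₂ * n₃).primeFactors, (1 - 1 / (p : ℝ)) = density s n₁ n₂ n₃ := by
  have hne : s * n₁ * n₂ * n₃ ≠ 0 := by positivity
  have ext_prod : ∀ (m : ℕ) (f : ℕ → ℝ), m ∣ s * n₁ * n₂ * n₃ → ∏ p ∈ m.primeFactors, f p =
      ∏ p ∈ (s * n₁ * n₂ * n₃).primeFactors, if p ∣ m then f p else 1 := by
    intro m f hm
    rw [← Finset.prod_filter]
    refine Finset.prod_congr ?_ fun _ _ => rfl
    ext p
    simp only [Finset.mem_filter, Nat.mem_primeFactors_of_ne_zero hne,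
      Nat.mem_primeFactors_of_ne_zero (ne_zero_of_dvd_ne_zero hne hm)]
    constructor
    · rintro ⟨hp, hd⟩; exact ⟨⟨hp, hd.trans hm⟩, hd⟩
    · rintro ⟨⟨hp, _⟩, hd⟩; exact ⟨hp, hd⟩
  rw [ext_prod (s * n₁) _ ⟨n₂ * n₃, by ring⟩, ext_prod (s * n₂ * n₃) _ ⟨n₁, by ring⟩,
    ← Finset.prod_mul_distrib, density]
  refine Finset.prod_congr rfl fun p hp => ?_
  have hpp := Nat.prime_of_mem_primeFactors hp
  have hd := Nat.dvd_of_mem_primeFactors hp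
  have nd : ∀ {m n : ℕ}, m.Coprime n → p ∣ m → ¬ p ∣ n := fun hmn hm hn =>
    Nat.not_coprime_of_dvd_of_dvd hpp.one_lt hm hn hmn
  simp only [hpp.dvd_mul, sieveCount] at hd ⊢
  by_cases d0 : p ∣ s <;> by_cases d1 : p ∣ n₁ <;> by_cases d2 : p ∣ n₂ <;>
    by_cases d3 : p ∣ n₃ <;>
    first
      | exact absurd d2 (nd h12 d1)
      | exact absurd d3 (nd h13 d1)
      | exact absurd d3 (nd h23 d2)
      | (simp only [d0, d1, d2, d3, or_self, or_true, or_false, if_true, if_false,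
          decide_true, decide_false, locDensity] at hd ⊢
         try ring)

/-- If `n₁, n₂, n₃` are not coprime in pairs, the density is zero and there are no admissible pairs. -/
theorem density_eq_zero {s n₁ n₂ n₃ p : ℕ} (hne : s * n₁ * n₂ * n₃ ≠ 0) (hp : p.Prime)
    (h : p ∣ n₁ ∧ p ∣ n₂ ∨ p ∣ n₁ ∧ p ∣ n₃ ∨ p ∣ n₂ ∧ p ∣ n₃) : density s n₁ n₂ n₃ = 0 := by
  refine Finset.prod_eq_zero (i := p) ?_ ?_
  · rw [Nat.mem_primeFactors_of_ne_zero hne]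
    refine ⟨hp, ?_⟩
    simp only [hp.dvd_mul]
    tauto
  · by_cases d0 : p ∣ s <;> by_cases d1 : p ∣ n₁ <;> by_cases d2 : p ∣ n₂ <;>
      by_cases d3 : p ∣ n₃ <;> simp_all [locDensity]

theorem pairSet_eq_empty {s n₁ n₂ n₃ p : ℕ} {X Y : ℝ} (hp : p.Prime)
    (h : p ∣ n₁ ∧ p ∣ n₂ ∨ p ∣ n₁ ∧ p ∣ n₃ ∨ p ∣ n₂ ∧ p ∣ n₃) :
    pairSet s n₁ n₂ n₃ X Y = ∅ := by
  refine Set.eq_empty_of_forall_notMem fun w hw => ?_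
  obtain ⟨_, g1, g2, g3, hprim⟩ := hw
  set z := s * n₁ * n₂ * n₃ with hz
  have d1 : p ∣ n₁ → (p : ℤ) ∣ w.1 := fun h => (Int.natCast_dvd_natCast.2 h).trans
    (by simpa [g1] using Int.gcd_dvd_right (z : ℤ) w.1)
  have d2 : p ∣ n₂ → (p : ℤ) ∣ w.2 := fun h => (Int.natCast_dvd_natCast.2 h).trans
    (by simpa [g2] using Int.gcd_dvd_right (z : ℤ) w.2)
  have d3 : p ∣ n₃ → (p : ℤ) ∣ w.1 + w.2 := fun h => (Int.natCast_dvd_natCast.2 h).trans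
    (by simpa [g3] using Int.gcd_dvd_right (z : ℤ) (w.1 + w.2))
  have dz : p ∣ n₁ ∨ p ∣ n₂ → p ∣ z := by
    rintro (h | h) <;> simp [hz, hp.dvd_mul, h]
  rcases h with ⟨ha, hb⟩ | ⟨ha, hb⟩ | ⟨ha, hb⟩
  · exact hprim p hp (d1 ha) (d2 hb) (dz (Or.inl ha))
  · exact hprim p hp (d1 ha) ((dvd_add_right (d1 ha)).1 (d3 hb)) (dz (Or.inl ha))
  · exact hprim p hp ((dvd_add_left (d2 ha)).1 (d3 hb)) (d2 ha) (dz (Or.inr ha))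

/-- The number of admissible pairs is the density times the area, with a boundary error. -/
theorem abs_ncard_pairSet_sub_le {s n₁ n₂ n₃ : ℕ} (hs : 0 < s) (h1 : 0 < n₁) (h2 : 0 < n₂)
    (h3 : 0 < n₃) {X Y : ℝ} (hX : n₁ ≤ X) (hY : 0 ≤ Y) :
    |((pairSet s n₁ n₂ n₃ X Y).ncard : ℝ) -
        density s n₁ n₂ n₃ / (n₁ * n₂ * n₃) * volume.real (pairRegion X Y)| ≤
      6 * 3 ^ (s * n₁).primeFactors.card * (X / n₁) +
        4 * 2 ^ (s * n₂ * n₃).primeFactors.card * (X / (n₂ * n₃)) := by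
  have hX0 : 0 ≤ X := le_trans (by positivity) hX
  have hnn : (0 : ℝ) < n₁ := by exact_mod_cast h1
  have hnn2 : (0 : ℝ) < n₂ := by exact_mod_cast h2
  have hnn3 : (0 : ℝ) < n₃ := by exact_mod_cast h3
  by_cases hcop : n₁.Coprime n₂ ∧ n₁.Coprime n₃ ∧ n₂.Coprime n₃
  swap
  · obtain ⟨p, hp, h⟩ : ∃ p : ℕ, p.Prime ∧
        (p ∣ n₁ ∧ p ∣ n₂ ∨ p ∣ n₁ ∧ p ∣ n₃ ∨ p ∣ n₂ ∧ p ∣ n₃) := by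
      by_contra! hno
      exact hcop ⟨Nat.coprime_of_dvd fun p hp a b => (hno p hp).1 a b,
        Nat.coprime_of_dvd fun p hp a b => (hno p hp).2.1 a b,
        Nat.coprime_of_dvd fun p hp a b => (hno p hp).2.2 a b⟩
    rw [density_eq_zero (by positivity) hp h, pairSet_eq_empty hp h]
    simp only [Set.ncard_empty, Nat.cast_zero, zero_div, zero_mul, sub_zero, abs_zero]
    positivity
  obtain ⟨h12, h13, h23⟩ := hcop
  set F := (finite_pairSet s n₁ n₂ n₃ X Y).toFinset with hFdef
  have hF : ∀ w, w ∈ F ↔ w ∈ pairSet s n₁ n₂ n₃ X Y := fun w => by simp [hFdef]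
  set m := s * n₂ * n₃ with hm
  have hm0 : m ≠ 0 := by positivity
  obtain ⟨hAfin, hAcard⟩ := abs_ncard_affine_sub_le (S := Set.Icc (-X) X)
    Set.ordConnected_Icc subset_rfl hnn 0
  rw [Real.volume_real_Icc_of_le (by linarith)] at hAcard
  set A := hAfin.toFinset.filter fun a => ∀ p ∈ m.primeFactors, ¬ (p : ℤ) ∣ a with hAdef
  have hA : ∀ a : ℤ, a ∈ A ↔ |(n₁ : ℝ) * a| ≤ X ∧ ∀ p ∈ m.primeFactors, ¬ (p : ℤ) ∣ a := fun a => by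
    rw [hAdef, Finset.mem_filter, Set.Finite.mem_toFinset, abs_le, Set.mem_ofPred_eq, zero_add,
      Set.mem_Icc]
  have hA' : ∀ a : ℤ, a ∈ A ↔ |(n₁ : ℝ) * a| ≤ X ∧ ∀ p : ℕ, p.Prime → p ∣ m → ¬ (p : ℤ) ∣ a :=
    fun a => by simp only [hA, Nat.mem_primeFactors_of_ne_zero hm0, and_imp]
  have hAle : (A.card : ℝ) ≤ 3 * (X / n₁) := by
    have e1 : (A.card : ℝ) ≤ hAfin.toFinset.card := by
      rw [Nat.cast_le, hAdef]; exact Finset.card_le_card (Finset.filter_subset _ _)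
    rw [← Set.ncard_eq_toFinset_card _ hAfin] at e1
    have e2 : 1 ≤ X / n₁ := (one_le_div hnn).2 hX
    have e3 : (X - -X) / n₁ = 2 * (X / n₁) := by ring
    have := (abs_le.1 hAcard).2
    linarith
  have hsum : (pairSet s n₁ n₂ n₃ X Y).ncard =
      ∑ a ∈ A, (F.filter fun w => w.1 = n₁ * a).card := by
    rw [Set.ncard_eq_toFinset_card _ (finite_pairSet s n₁ n₂ n₃ X Y), ← hFdef]
    have hmaps : ∀ w ∈ F, ∃ a ∈ A, w.1 = n₁ * a := by
      intro w hw
      have hw' := (hF w).1 hw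
      have d1 : (n₁ : ℤ) ∣ w.1 := by
        have := Int.gcd_dvd_right ((s * n₁ * n₂ * n₃ : ℕ) : ℤ) w.1
        rwa [hw'.2.1] at this
      obtain ⟨a, ha⟩ := d1
      refine ⟨a, (hA' a).2 ⟨?_, ?_⟩, ha⟩
      · have := hw'.1.1
        simp only [ha] at this
        exact_mod_cast this
      · have := hw'.2.1
        rw [ha] at this
        exact (gcd_mul_eq_iff (show s * n₁ * n₂ * n₃ = n₁ * (s * n₂ * n₃) by ring) h1 a).1 this
    rw [Finset.card_eq_sum_card_fiberwise (f := fun w => w.1 / (n₁ : ℤ)) (t := A)]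
    · refine Finset.sum_congr rfl fun a ha => ?_
      congr 1
      refine Finset.filter_congr fun w hw => ?_
      obtain ⟨a', ha', he⟩ := hmaps w hw
      rw [he, Int.mul_ediv_cancel_left _ (by exact_mod_cast h1.ne')]
      constructor
      · rintro rfl; rfl
      · exact fun h => mul_left_cancel₀ (by exact_mod_cast h1.ne') h
    · intro w hw
      obtain ⟨a', ha', he⟩ := hmaps w hw
      simp only [he, Int.mul_ediv_cancel_left _ (show (n₁ : ℤ) ≠ 0 by exact_mod_cast h1.ne')]
      exact ha'
  set D₁ := ∏ p ∈ (s * n₁).primeFactors, (1 - sieveCount (n₁ * n₂ * n₃) p / p) with hD₁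
  set D₂ := ∏ p ∈ m.primeFactors, (1 - 1 / (p : ℝ)) with hD₂
  have hdens : D₁ * D₂ = density s n₁ n₂ n₃ := prod_mul_prod_eq_density hs h1 h2 h3 h12 h13 h23
  have hD₁0 : 0 ≤ D₁ ∧ D₁ ≤ 1 := by
    have : ∀ p ∈ (s * n₁).primeFactors, 0 ≤ sieveCount (n₁ * n₂ * n₃) p / p ∧
        sieveCount (n₁ * n₂ * n₃) p / p ≤ 1 := fun p hp => by
      have hp2 : (2 : ℝ) ≤ p := by exact_mod_cast (Nat.prime_of_mem_primeFactors hp).two_le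
      have : 0 ≤ sieveCount (n₁ * n₂ * n₃) p ∧ sieveCount (n₁ * n₂ * n₃) p ≤ 2 := by
        rw [sieveCount]; split_ifs <;> norm_num
      exact ⟨div_nonneg this.1 (by linarith), (div_le_one (by linarith)).2 (by linarith)⟩
    exact ⟨Finset.prod_nonneg fun p hp => by linarith [(this p hp).2],
      Finset.prod_le_one (fun p hp => by linarith [(this p hp).2])
        fun p hp => by linarith [(this p hp).1]⟩
  have hfib := fun a (ha : a ∈ A) => abs_card_fiber_sub_le hs h1 h2 h3 h12 h13 h23 hY hF
    ((hA' a).1 ha).1 ((hA' a).1 ha).2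
  have hsl := abs_sum_slice_sub_le hX0 hY h1 (m := m) hA
  set V := volume.real (pairRegion X Y)
  -- The first error comes from the sieve over `y` for each `x = n₁ a`, the second from the sieve
  -- over `a`.
  have hid : ((pairSet s n₁ n₂ n₃ X Y).ncard : ℝ) - density s n₁ n₂ n₃ / (n₁ * n₂ * n₃) * V =
      ∑ a ∈ A, (((F.filter fun w => w.1 = n₁ * a).card : ℝ) -
        volume.real (slice X Y (n₁ * a)) / (n₂ * n₃) * D₁) +
      D₁ / (n₂ * n₃) * (∑ a ∈ A, volume.real (slice X Y (n₁ * a)) - V / n₁ * D₂) := by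
    rw [hsum, ← hdens, Finset.sum_sub_distrib, ← Finset.sum_mul, ← Finset.sum_div]
    push_cast
    field_simp
    ring
  rw [hid]
  refine (abs_add_le _ _).trans (add_le_add ?_ ?_)
  · calc _ ≤ ∑ a ∈ A, 2 * (3 : ℝ) ^ (s * n₁).primeFactors.card :=
          (Finset.abs_sum_le_sum_abs _ _).trans (Finset.sum_le_sum hfib)
      _ = A.card * (2 * (3 : ℝ) ^ (s * n₁).primeFactors.card) := by
          rw [Finset.sum_const, nsmul_eq_mul]
      _ ≤ 3 * (X / n₁) * (2 * (3 : ℝ) ^ (s * n₁).primeFactors.card) := by gcongr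
      _ = _ := by ring
  · rw [abs_mul, abs_of_nonneg (div_nonneg hD₁0.1 (by positivity))]
    calc _ ≤ 1 / (n₂ * n₃ : ℝ) * (4 * 2 ^ m.primeFactors.card * X) := by
          gcongr
          exact hD₁0.2
      _ = _ := by ring

/-! ### Summing the boundary errors -/

/-- Since `3 ≤ √p` for `p ≥ 9`, and there are four smaller primes. -/
theorem three_pow_card_primeFactors_le {n : ℕ} (hn : n ≠ 0) :
    (3 : ℝ) ^ n.primeFactors.card ≤ 81 * √n := by
  have h1 : ∀ p ∈ n.primeFactors, (3 : ℝ) ≤ (if p < 9 then 3 else 1) * √p := by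
    intro p hp
    have hp1 : (1 : ℝ) ≤ p := by exact_mod_cast (Nat.prime_of_mem_primeFactors hp).one_le
    split_ifs with h
    · have : 1 ≤ √(p : ℝ) := one_le_sqrt.2 hp1
      linarith
    · rw [one_mul]
      refine le_sqrt_of_sq_le ?_
      have : (9 : ℝ) ≤ p := by exact_mod_cast not_lt.1 h
      linarith
  have h2 : ∏ p ∈ n.primeFactors, (if p < 9 then (3 : ℝ) else 1) ≤ 81 := by
    rw [Finset.prod_ite, Finset.prod_const_one, mul_one, Finset.prod_const]
    have hsub : n.primeFactors.filter (· < 9) ⊆ {2, 3, 5, 7} := by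
      intro p hp
      obtain ⟨hp, h9⟩ := Finset.mem_filter.1 hp
      have := Nat.prime_of_mem_primeFactors hp
      interval_cases p <;> first | decide | exact absurd this (by decide)
    have hc : (n.primeFactors.filter (· < 9)).card ≤ 4 := Finset.card_le_card hsub
    calc (3 : ℝ) ^ (n.primeFactors.filter (· < 9)).card ≤ 3 ^ 4 :=
          pow_le_pow_right₀ (by norm_num) hc
      _ = 81 := by norm_num
  have h3 : ∏ p ∈ n.primeFactors, √(p : ℝ) ≤ √n := by
    rw [← sqrt_prod _ (fun _ _ => by positivity)]
    refine sqrt_le_sqrt ?_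
    rw [← Nat.cast_prod, Nat.cast_le]
    exact Nat.le_of_dvd (Nat.pos_of_ne_zero hn) (Nat.prod_primeFactors_dvd n)
  calc (3 : ℝ) ^ n.primeFactors.card = ∏ p ∈ n.primeFactors, 3 := by rw [Finset.prod_const]
    _ ≤ ∏ p ∈ n.primeFactors, (if p < 9 then (3 : ℝ) else 1) * √p :=
        Finset.prod_le_prod (fun _ _ => by norm_num) h1
    _ = (∏ p ∈ n.primeFactors, (if p < 9 then (3 : ℝ) else 1)) * ∏ p ∈ n.primeFactors, √(p : ℝ) :=
        Finset.prod_mul_distrib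
    _ ≤ _ := by gcongr

theorem card_sq_le {B : ℝ} {s a b : ℕ} (hs : 1 ≤ s) (ha : 1 ≤ a) (hb : 1 ≤ b)
    (N : ℕ) : (((Finset.Icc 1 N).filter fun c : ℕ => (s : ℝ) ^ 3 * (a * b * c) ^ 2 ≤ B).card : ℝ) ≤
      √(B / s ^ 3) / (a * b) := by
  have hs' : (0 : ℝ) < s := by exact_mod_cast hs
  have ha' : (0 : ℝ) < a := by exact_mod_cast ha
  have hb' : (0 : ℝ) < b := by exact_mod_cast hb
  have hsub : ((Finset.Icc 1 N).filter fun c : ℕ => (s : ℝ) ^ 3 * (a * b * c) ^ 2 ≤ B) ⊆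
      Finset.Icc 1 ⌊√(B / s ^ 3) / (a * b)⌋₊ := by
    intro c hc
    obtain ⟨hc, h⟩ := Finset.mem_filter.1 hc
    rw [mem_Icc_floor (by positivity)]
    refine ⟨(Finset.mem_Icc.1 hc).1, ?_⟩
    rw [le_div_iff₀ (by positivity)]
    refine le_sqrt_of_sq_le ?_
    rw [le_div_iff₀ (by positivity)]
    linarith
  calc _ ≤ ((Finset.Icc 1 ⌊√(B / s ^ 3) / (a * b)⌋₊).card : ℝ) := by
        exact_mod_cast Finset.card_le_card hsub
    _ ≤ _ := by
        rw [Nat.card_Icc, Nat.add_sub_cancel]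
        exact Nat.floor_le (by positivity)

/-- Carrying out the sum over the last coordinate. -/
theorem sum_tuples_le {B : ℝ} {g : ℕ → ℕ → ℕ → ℝ} (hg : ∀ s a b, 0 ≤ g s a b) :
    ∑ v ∈ tuples B, g v.1 v.2.1 v.2.2.1 ≤ ∑ s ∈ Finset.Icc 1 ⌊B⌋₊, ∑ a ∈ Finset.Icc 1 ⌊B⌋₊,
      ∑ b ∈ Finset.Icc 1 ⌊B⌋₊, g s a b * (√(B / s ^ 3) / (a * b)) := by
  rw [tuples, Finset.sum_filter, Finset.sum_product]
  refine Finset.sum_le_sum fun s hs => ?_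
  rw [Finset.sum_product]
  refine Finset.sum_le_sum fun a ha => ?_
  rw [Finset.sum_product]
  refine Finset.sum_le_sum fun b hb => ?_
  rw [← Finset.sum_filter]
  dsimp only
  rw [Finset.sum_const, nsmul_eq_mul, mul_comm]
  exact mul_le_mul_of_nonneg_left (card_sq_le (Finset.mem_Icc.1 hs).1 (Finset.mem_Icc.1 ha).1
    (Finset.mem_Icc.1 hb).1 _) (hg _ _ _)

theorem sum_tuples_rotate {B : ℝ} (hB : 0 ≤ B) (F : ℕ → ℕ → ℕ → ℕ → ℝ) :
    ∑ v ∈ tuples B, F v.1 v.2.2.1 v.2.2.2 v.2.1 = ∑ v ∈ tuples B, F v.1 v.2.1 v.2.2.1 v.2.2.2 := by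
  refine Finset.sum_nbij' (fun v => (v.1, v.2.2.1, v.2.2.2, v.2.1))
    (fun v => (v.1, v.2.2.2, v.2.1, v.2.2.1)) ?_ ?_ (fun _ _ => rfl) (fun _ _ => rfl)
    (fun _ _ => rfl)
  · intro v hv
    rw [mem_tuples hB] at hv ⊢
    refine ⟨⟨hv.1.1, hv.1.2.2.1, hv.1.2.2.2, hv.1.2.1⟩, ?_⟩
    simp only
    rw [show ((v.2.2.1 : ℝ) * v.2.2.2 * v.2.1) = v.2.1 * v.2.2.1 * v.2.2.2 by ring]
    exact hv.2
  · intro v hv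
    rw [mem_tuples hB] at hv ⊢
    refine ⟨⟨hv.1.1, hv.1.2.2.2, hv.1.2.1, hv.1.2.2.1⟩, ?_⟩
    simp only
    rw [show ((v.2.2.2 : ℝ) * v.2.1 * v.2.2.1) = v.2.1 * v.2.2.1 * v.2.2.2 by ring]
    exact hv.2

theorem exists_sum_rpow_le : ∃ K : ℝ, 0 ≤ K ∧ ∀ N : ℕ,
    ∑ n ∈ Finset.Icc 1 N, 1 / ((n : ℝ) * √n) ≤ K := by
  have hs : Summable fun n : ℕ => 1 / ((n : ℝ) * √n) := by
    refine (Real.summable_one_div_nat_rpow (p := 3 / 2)).2 (by norm_num) |>.congr fun n => ?_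
    rcases Nat.eq_zero_or_pos n with rfl | hn
    · norm_num
    have : (0 : ℝ) < n := by exact_mod_cast hn
    rw [sqrt_eq_rpow, show (3 / 2 : ℝ) = 1 + 1 / 2 by norm_num, rpow_add this, rpow_one]
  exact ⟨∑' n : ℕ, 1 / ((n : ℝ) * √n), tsum_nonneg fun n => by positivity,
    fun N => hs.sum_le_tsum _ fun n _ => by positivity⟩

theorem recipSum_le {x : ℝ} (hx : 1 ≤ x) : recipSum x ≤ 1 + log x := by
  have hs : recipSum x = (harmonic ⌊x⌋₊ : ℝ) := by
    rw [recipSum, harmonic_eq_sum_Icc]; push_cast; simp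
  rw [hs]
  exact (harmonic_le_one_add_log _).trans (by linarith [(log_floor_bounds hx).2.1])

theorem sqrt_div_cube {B : ℝ} {s : ℕ} (hs : 0 < s) : √(B / s ^ 3) = √B * (1 / (s * √s)) := by
  have hs' : (0 : ℝ) < s := by exact_mod_cast hs
  rw [sqrt_div' _ (by positivity), show ((s : ℝ)) ^ 3 = s ^ 2 * s by ring,
    sqrt_mul (by positivity), sqrt_sq hs'.le]
  ring

theorem card_primeFactors_mul_le (a b : ℕ) (ha : a ≠ 0) (hb : b ≠ 0) :
    (a * b).primeFactors.card ≤ a.primeFactors.card + b.primeFactors.card := by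
  rw [Nat.primeFactors_mul ha hb]
  exact Finset.card_union_le _ _

/-- The total of the boundary errors in `abs_ncard_pairSet_sub_le`. -/
theorem exists_sum_error_le : ∃ C : ℝ, ∀ B : ℝ, 1 ≤ B →
    ∑ v ∈ tuples B, (6 * 3 ^ (v.1 * v.2.1).primeFactors.card * (√(B / v.1) / v.2.1) +
      4 * 2 ^ (v.1 * v.2.2.1 * v.2.2.2).primeFactors.card * (√(B / v.1) / (v.2.2.1 * v.2.2.2))) ≤
    C * (B * (1 + log B)) := by
  obtain ⟨K, hK0, hK⟩ := exists_sum_rpow_le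
  refine ⟨6 * 81 ^ 2 * K ^ 2 + 4 * 81 ^ 3 * K ^ 3, fun B hB => ?_⟩
  have hB0 : 0 ≤ B := by linarith
  have hlog : 0 ≤ log B := log_nonneg hB
  set S := ∑ n ∈ Finset.Icc 1 ⌊B⌋₊, 1 / ((n : ℝ) * √n) with hS
  have hS0 : 0 ≤ S := Finset.sum_nonneg fun n _ => by positivity
  have hSK : S ≤ K := hK _
  have hR := recipSum_le hB
  have hR0 := recipSum_nonneg B
  have cancel : ∀ {s : ℕ}, 0 < s → √(s : ℝ) * √(B / s) = √B := fun {s} hs => by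
    rw [← sqrt_mul (by positivity), mul_div_cancel₀ _ (by positivity)]
  have inv : ∀ {a : ℕ}, 0 < a → √(a : ℝ) / a = 1 / √a := fun {a} ha => by
    rw [sqrt_div_self', one_div]
  -- The factors `√s` and `√nᵢ` that bound the powers of `3` are absorbed by `√(B / s)` and `1 / nᵢ`.
  have p1 : ∀ v ∈ tuples B, 6 * 3 ^ (v.1 * v.2.1).primeFactors.card * (√(B / v.1) / v.2.1) ≤
      6 * 81 ^ 2 * √B * (1 / √(v.2.1 : ℝ)) := by
    intro v hv
    obtain ⟨⟨h0, h1, h2, h3⟩, _⟩ := (mem_tuples hB0).1 hv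
    have e : (3 : ℝ) ^ (v.1 * v.2.1).primeFactors.card ≤ (81 * √v.1) * (81 * √v.2.1) :=
      (pow_le_pow_right₀ (by norm_num) (card_primeFactors_mul_le _ _ (by omega) (by omega))).trans
        (by rw [pow_add]
            exact mul_le_mul (three_pow_card_primeFactors_le (by omega))
              (three_pow_card_primeFactors_le (by omega)) (by positivity) (by positivity))
    calc _ ≤ 6 * ((81 * √v.1) * (81 * √v.2.1)) * (√(B / v.1) / v.2.1) := by gcongr
      _ = 6 * 81 ^ 2 * (√v.1 * √(B / v.1)) * (√v.2.1 / v.2.1) := by ring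
      _ = _ := by rw [cancel h0, inv h1]
  have p2 : ∀ v ∈ tuples B, 4 * 2 ^ (v.1 * v.2.2.1 * v.2.2.2).primeFactors.card *
      (√(B / v.1) / (v.2.2.1 * v.2.2.2)) ≤
      4 * 81 ^ 3 * √B * (1 / (√(v.2.2.1 : ℝ) * √(v.2.2.2 : ℝ))) := by
    intro v hv
    obtain ⟨⟨h0, h1, h2, h3⟩, _⟩ := (mem_tuples hB0).1 hv
    have h02 : v.1 * v.2.2.1 ≠ 0 := (Nat.mul_pos h0 h2).ne'
    have e : (2 : ℝ) ^ (v.1 * v.2.2.1 * v.2.2.2).primeFactors.card ≤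
        (81 * √v.1) * (81 * √v.2.2.1) * (81 * √v.2.2.2) := by
      calc (2 : ℝ) ^ (v.1 * v.2.2.1 * v.2.2.2).primeFactors.card
          ≤ 3 ^ (v.1 * v.2.2.1 * v.2.2.2).primeFactors.card := by gcongr; norm_num
        _ ≤ 3 ^ (v.1.primeFactors.card + v.2.2.1.primeFactors.card +
            v.2.2.2.primeFactors.card) := by
            refine pow_le_pow_right₀ (by norm_num) ?_
            refine (card_primeFactors_mul_le _ _ h02 (by omega)).trans ?_
            gcongr
            exact card_primeFactors_mul_le _ _ (by omega) (by omega)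
        _ ≤ _ := by
            rw [pow_add, pow_add]
            gcongr <;> exact three_pow_card_primeFactors_le (by omega)
    calc _ ≤ 4 * ((81 * √v.1) * (81 * √v.2.2.1) * (81 * √v.2.2.2)) *
          (√(B / v.1) / (v.2.2.1 * v.2.2.2)) := by gcongr
      _ = 4 * 81 ^ 3 * (√v.1 * √(B / v.1)) * ((√v.2.2.1 / v.2.2.1) * (√v.2.2.2 / v.2.2.2)) := by
          ring
      _ = _ := by rw [cancel h0, inv h2, inv h3]; ring
  have q1 : ∑ v ∈ tuples B, 6 * 81 ^ 2 * √B * (1 / √(v.2.1 : ℝ)) ≤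
      6 * 81 ^ 2 * B * (S * S * recipSum B) := by
    refine (sum_tuples_le (g := fun _ a _ => 6 * 81 ^ 2 * √B * (1 / √(a : ℝ)))
      (fun _ _ _ => by positivity)).trans_eq ?_
    rw [hS, Finset.sum_mul_sum, Finset.sum_mul, Finset.mul_sum]
    refine Finset.sum_congr rfl fun s hs => ?_
    rw [recipSum, Finset.sum_mul_sum, Finset.mul_sum]
    refine Finset.sum_congr rfl fun a _ => ?_
    rw [Finset.mul_sum]
    refine Finset.sum_congr rfl fun b _ => ?_
    rw [sqrt_div_cube (Finset.mem_Icc.1 hs).1]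
    nth_rewrite 3 [← mul_self_sqrt hB0]
    ring
  have q2 : ∑ v ∈ tuples B, 4 * 81 ^ 3 * √B * (1 / (√(v.2.2.1 : ℝ) * √(v.2.2.2 : ℝ))) ≤
      4 * 81 ^ 3 * B * (S * S * S) := by
    rw [sum_tuples_rotate hB0 fun s a b _ => 4 * 81 ^ 3 * √B * (1 / (√(a : ℝ) * √(b : ℝ)))]
    refine (sum_tuples_le (g := fun _ a b => 4 * 81 ^ 3 * √B * (1 / (√(a : ℝ) * √(b : ℝ))))
      (fun _ _ _ => by positivity)).trans_eq ?_
    rw [hS, Finset.sum_mul_sum, Finset.sum_mul, Finset.mul_sum]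
    refine Finset.sum_congr rfl fun s hs => ?_
    rw [Finset.sum_mul_sum, Finset.mul_sum]
    refine Finset.sum_congr rfl fun a _ => ?_
    rw [Finset.mul_sum]
    refine Finset.sum_congr rfl fun b _ => ?_
    rw [sqrt_div_cube (Finset.mem_Icc.1 hs).1]
    nth_rewrite 3 [← mul_self_sqrt hB0]
    ring
  have r1 : S * S * recipSum B ≤ K ^ 2 * (1 + log B) := by
    rw [sq]; gcongr
  have r2 : S * S * S ≤ K ^ 3 * (1 + log B) := by
    calc S * S * S ≤ K * K * K := by gcongr
      _ = K ^ 3 * 1 := by ring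
      _ ≤ _ := by gcongr; linarith
  rw [Finset.sum_add_distrib]
  calc _ ≤ 6 * 81 ^ 2 * B * (S * S * recipSum B) + 4 * 81 ^ 3 * B * (S * S * S) :=
        add_le_add ((Finset.sum_le_sum p1).trans q1) ((Finset.sum_le_sum p2).trans q2)
    _ ≤ 6 * 81 ^ 2 * B * (K ^ 2 * (1 + log B)) + 4 * 81 ^ 3 * B * (K ^ 3 * (1 + log B)) := by
        gcongr
    _ = _ := by ring

/-! ### The number of admissible pairs, summed over the quadruples -/

open scoped Pointwise in
/-- The substitution `(x, y) = X • p` maps the square onto the box of half-width `X`. -/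
theorem volume_real_pairRegion_eq {X Y : ℝ} (hX : 0 < X) (hY : 0 ≤ Y) :
    volume.real (pairRegion X Y) = X ^ 2 * cubicArea ((Y / X ^ 3) ^ 2) := by
  have hset : pairRegion X Y = X • (square ∩ {p | cubic p ^ 2 ≤ (Y / X ^ 3) ^ 2}) := by
    ext p
    rw [Set.mem_smul_set_iff_inv_smul_mem₀ hX.ne']
    simp only [pairRegion, Set.mem_ofPred_eq, Set.mem_inter_iff, square, Set.mem_prod, Set.mem_Icc,
      ← abs_le, cubic, Prod.smul_fst, Prod.smul_snd, smul_eq_mul, abs_mul, abs_inv, abs_of_pos hX]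
    rw [sq_le_sq₀ (by positivity) (by positivity), ← mul_add, abs_mul, abs_inv, abs_of_pos hX,
      inv_mul_le_one₀ hX, inv_mul_le_one₀ hX, le_div_iff₀ (by positivity)]
    have : X⁻¹ * |p.1| * (X⁻¹ * |p.2|) * (X⁻¹ * |p.1 + p.2|) * X ^ 3 =
        |p.1| * |p.2| * |p.1 + p.2| := by field_simp
    rw [this]
    tauto
  rw [hset, measureReal_def, Measure.addHaar_smul, ENNReal.toReal_mul, cubicArea, measureReal_def]
  congr 1
  simp only [Module.finrank_prod, Module.finrank_self, Nat.reduceAdd, abs_pow, abs_of_pos hX]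
  exact ENNReal.toReal_ofReal (by positivity)

/-- The main terms of `abs_ncard_pairSet_sub_le` for `X = √(B / s)` and `Y = B n₁ n₂ n₃` have
`(Y / X³)² = s³ (n₁ n₂ n₃)² / B`, so that their sum is that of `sum_density_eq_tsum`. -/
theorem exists_sum_ncard_pairSet_asymp : ∃ C : ℝ, ∀ B : ℝ, 1 ≤ B →
    |∑ v ∈ tuples B, ((pairSet v.1 v.2.1 v.2.2.1 v.2.2.2 √(B / v.1)
        (B * (v.2.1 * v.2.2.1 * v.2.2.2))).ncard : ℝ) -
      B * ∑' m, coef m * weightedSum (B / partsHeight m)| ≤ C * (B * (1 + log B)) := by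
  obtain ⟨C, hC⟩ := exists_sum_error_le
  refine ⟨C, fun B hB => ?_⟩
  have hB0 : 0 < B := by linarith
  rw [← sum_density_eq_tsum hB0, Finset.mul_sum, ← Finset.sum_sub_distrib]
  refine (Finset.abs_sum_le_sum_abs _ _).trans ((Finset.sum_le_sum fun v hv => ?_).trans (hC B hB))
  obtain ⟨⟨h0, h1, h2, h3⟩, hv⟩ := (mem_tuples hB0.le).1 hv
  have hs : (0 : ℝ) < v.1 := by exact_mod_cast h0
  have hn1 : (1 : ℝ) ≤ v.2.1 := by exact_mod_cast h1
  have hn2 : (1 : ℝ) ≤ v.2.2.1 := by exact_mod_cast h2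
  have hn3 : (1 : ℝ) ≤ v.2.2.2 := by exact_mod_cast h3
  have hs1 : (1 : ℝ) ≤ v.1 := by exact_mod_cast h0
  have hX : (v.2.1 : ℝ) ≤ √(B / v.1) := by
    refine le_sqrt_of_sq_le ?_
    rw [le_div_iff₀ hs]
    refine le_trans ?_ hv
    have e1 : (v.2.1 : ℝ) ≤ v.2.1 * v.2.2.1 * v.2.2.2 := by
      nlinarith [mul_le_mul hn2 hn3 zero_le_one (by linarith)]
    calc (v.2.1 : ℝ) ^ 2 * v.1 ≤ (v.2.1 * v.2.2.1 * v.2.2.2) ^ 2 * (v.1) ^ 3 := by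
          gcongr
          nlinarith [mul_self_nonneg ((v.1 : ℝ) - 1), mul_nonneg hs.le hs.le]
      _ = _ := by ring
  have key := abs_ncard_pairSet_sub_le h0 h1 h2 h3 hX
    (Y := B * (v.2.1 * v.2.2.1 * v.2.2.2)) (by positivity)
  rw [volume_real_pairRegion_eq (by positivity) (by positivity), sq_sqrt (by positivity), div_pow,
    ← pow_mul, show 3 * 2 = 2 * 3 by rfl, pow_mul, sq_sqrt (by positivity)] at key
  have e1 : (B * (v.2.1 * v.2.2.1 * v.2.2.2 : ℝ)) ^ 2 / (B / v.1) ^ 3 =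
      (v.1 : ℝ) ^ 3 * (v.2.1 * v.2.2.1 * v.2.2.2) ^ 2 / B := by
    field_simp
  rw [e1] at key
  refine le_trans (le_of_eq ?_) key
  congr 2
  field_simp

/-! ### The lines on the surface -/

theorem isLineOnSurface_span {K : Type*} [Field K] {u : Fin 7 → K} (hu : u ≠ 0) (hu6 : u 6 = 0)
    (h : ∀ a b : K, OnSurface (a • u + b • Pi.single 6 1)) :
    IsLineOnSurface (Submodule.span K {u, Pi.single 6 (1 : K)}) := by
  constructor
  · have hli : LinearIndependent K ![u, Pi.single 6 (1 : K)] := by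
      rw [LinearIndependent.pair_iff]
      intro a b hab
      have h6 := congrFun hab 6
      simp [hu6] at h6
      subst h6
      simp only [zero_smul, add_zero, smul_eq_zero] at hab
      exact ⟨hab.resolve_right hu, rfl⟩
    have := finrank_span_eq_card hli
    rwa [Matrix.range_cons, Matrix.range_cons, Matrix.range_empty, Set.union_empty,
      Set.singleton_union, Fintype.card_fin] at this
  · intro x hx
    obtain ⟨a, b, rfl⟩ := Submodule.mem_span_pair.1 hx
    exact h a b

/-- The points of the surface with `x₆ = 0` lie on one of three lines of the surface. -/
theorem exists_line_of_eq_zero {K : Type*} [Field K] {x : Fin 7 → K} (hx : OnSurface x)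
    (h5 : x 5 = 0) : ∃ L : Submodule K (Fin 7 → K), IsLineOnSurface L ∧ x ∈ L := by
  obtain ⟨e1, -, -, -, e5, e6, e7, e8, -⟩ := hx
  simp only [h5] at e5 e6
  have h2 : x 2 = 0 := by
    have : x 2 ^ 2 = 0 := by linear_combination -e5
    exact pow_eq_zero_iff two_ne_zero |>.1 this
  have h4 : x 4 = 0 := by
    have : x 4 ^ 2 = 0 := by linear_combination -e6
    exact pow_eq_zero_iff two_ne_zero |>.1 this
  simp only [h2, h4, zero_mul, add_zero] at e7 e8
  by_cases h0 : x 0 = 0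
  · have h13 : x 1 = 0 ∨ x 3 = 0 := by
      rw [h0] at e1
      have : x 1 * x 3 = 0 := by linear_combination -e1
      exact mul_eq_zero.1 this
    rcases h13 with h | h
    · refine ⟨_, isLineOnSurface_span (u := Pi.single 3 1) ?_ ?_ ?_,
        Submodule.mem_span_pair.2 ⟨x 3, x 6, ?_⟩⟩
      · simp
      · simp
      · intro a b; simp [OnSurface]
      · ext i; fin_cases i <;> simp [*]
    · refine ⟨_, isLineOnSurface_span (u := Pi.single 1 1) ?_ ?_ ?_,
        Submodule.mem_span_pair.2 ⟨x 1, x 6, ?_⟩⟩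
      · simp
      · simp
      · intro a b; simp [OnSurface]
      · ext i; fin_cases i <;> simp [*]
  · have h3 : x 3 = -x 0 := by
      have : x 0 * (x 0 + x 3) = 0 := by linear_combination e7
      linear_combination (mul_eq_zero.1 this).resolve_left h0
    have h1 : x 1 = -x 0 := by
      have : x 0 * (x 0 + x 1) = 0 := by linear_combination e8
      linear_combination (mul_eq_zero.1 this).resolve_left h0
    refine ⟨_, isLineOnSurface_span (u := ![1, -1, 0, -1, 0, 0, 0]) ?_ ?_ ?_,
      Submodule.mem_span_pair.2 ⟨x 0, x 6, ?_⟩⟩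
    · intro h
      have := congrFun h 0
      simp at this
    · simp
    · intro a b
      simp only [OnSurface, Pi.add_apply, Pi.smul_apply, smul_eq_mul, Matrix.cons_val,
        Pi.single_apply, Fin.reduceEq, if_true, if_false]
      refine ⟨?_, ?_, ?_, ?_, ?_, ?_, ?_, ?_, ?_⟩ <;> ring
    · ext i; fin_cases i <;> simp [*]

/-- A line of the surface lies in the hyperplane `x₆ = 0`: otherwise it is spanned by a point with
`x₆ ≠ 0` and a vector `y` with `y₆ = 0`, and the equations force `y = 0`. -/
theorem eq_zero_of_mem_line {K : Type*} [Field K] {L : Submodule K (Fin 7 → K)}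
    (hL : IsLineOnSurface L) {x : Fin 7 → K} (hx : x ∈ L) : x 5 = 0 := by
  by_contra h5
  have hall : ∀ y ∈ L, y 5 = 0 → y = 0 := by
    intro y hy hy5
    obtain ⟨-, -, -, f4, f5, f6, -, -, f9⟩ := hL.2 x hx
    obtain ⟨-, -, -, -, g5, g6, -, -, -⟩ := hL.2 y hy
    obtain ⟨-, -, -, k4, k5, k6, -, -, k9⟩ := hL.2 (x + y) (L.add_mem hx hy)
    simp only [Pi.add_apply, hy5, add_zero] at g5 g6 k4 k5 k6 k9
    have y2 : y 2 = 0 := by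
      have : y 2 ^ 2 = 0 := by linear_combination -g5
      exact pow_eq_zero_iff two_ne_zero |>.1 this
    have y4 : y 4 = 0 := by
      have : y 4 ^ 2 = 0 := by linear_combination -g6
      exact pow_eq_zero_iff two_ne_zero |>.1 this
    simp only [y2, y4, add_zero] at k4 k5 k6 k9
    have y1 : y 1 = 0 := by
      have : y 1 * x 5 = 0 := by linear_combination k5 - f5
      exact (mul_eq_zero.1 this).resolve_right h5
    have y3 : y 3 = 0 := by
      have : y 3 * x 5 = 0 := by linear_combination k6 - f6
      exact (mul_eq_zero.1 this).resolve_right h5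
    have y0 : y 0 = 0 := by
      have : y 0 * x 5 = 0 := by linear_combination k4 - f4
      exact (mul_eq_zero.1 this).resolve_right h5
    simp only [y0, add_zero] at k9
    have y6 : y 6 = 0 := by
      have : x 5 * y 6 = 0 := by linear_combination k9 - f9
      exact (mul_eq_zero.1 this).resolve_left h5
    ext i; fin_cases i <;> simp [*]
  have hle : L ≤ Submodule.span K {x} := by
    intro z hz
    have := hall (z - (z 5 / x 5) • x) (L.sub_mem hz (L.smul_mem _ hx)) (by
      simp [div_mul_cancel₀ _ h5])
    rw [Submodule.mem_span_singleton]
    exact ⟨z 5 / x 5, (sub_eq_zero.1 this).symm⟩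
  have h1 := Submodule.finrank_mono hle
  have h2 := finrank_span_singleton (K := K) (v := x) (fun h => h5 (by simp [h]))
  have h3 := hL.1
  omega

theorem onSurface_map_iff {K K' : Type*} [Field K] [Field K'] (f : K →+* K') (x : Fin 7 → K) :
    OnSurface (fun i => f (x i)) ↔ OnSurface x := by
  have h0 : ∀ a : K, f a = 0 ↔ a = 0 := fun a => map_eq_zero f
  simp only [OnSurface, ← h0, map_add, map_sub, map_mul, map_pow]

theorem mem_U_iff (P : ℙ ℚ (Fin 7 → ℚ)) : P ∈ U ↔ P ∈ surface ℚ ∧ P.rep 5 ≠ 0 := by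
  refine and_congr_right fun hP => ⟨fun h h5 => ?_, fun h L hL hmem => ?_⟩
  · obtain ⟨L, hL, hmem⟩ := exists_line_of_eq_zero
      (x := fun i => algebraMap ℚ (AlgebraicClosure ℚ) (P.rep i))
      ((onSurface_map_iff _ _).2 hP) (by simp [h5])
    exact h L hL hmem
  · have := eq_zero_of_mem_line hL hmem
    exact h ((map_eq_zero _).1 this)

theorem mk_mem_U_iff (x : Fin 7 → ℚ) (hx : x ≠ 0) :
    Projectivization.mk ℚ x hx ∈ U ↔ OnSurface x ∧ x 5 ≠ 0 := by
  rw [mem_U_iff, mk_mem_surface_iff]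
  obtain ⟨a, ha⟩ := Projectivization.exists_smul_eq_mk_rep ℚ x hx
  rw [← ha]
  refine and_congr_right fun _ => not_congr ?_
  change (a : ℚ) * x 5 = 0 ↔ _
  simp

/-! ### The parametrization of the rational points -/

/-- The birational parametrization `ℙ² ⇢ S` by the cubics `z x y, z x², z² x, z y², z² y, z³` and
`-x y (x + y)`. -/
def param {R : Type*} [CommRing R] (x y z : R) : Fin 7 → R :=
  ![z * x * y, z * x ^ 2, z ^ 2 * x, z * y ^ 2, z ^ 2 * y, z ^ 3, -(x * y * (x + y))]

theorem onSurface_param {R : Type*} [CommRing R] (x y z : R) : OnSurface (param x y z) := by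
  simp only [OnSurface, param, Matrix.cons_val]
  refine ⟨?_, ?_, ?_, ?_, ?_, ?_, ?_, ?_, ?_⟩ <;> ring

theorem param_ne_zero {x y z : ℚ} (hz : z ≠ 0) : param x y z ≠ 0 := fun h => by
  have := congrFun h 5
  simp [param, hz] at this

/-- The inverse of `param` on the surface is the projection to `[x₃ : x₅ : x₆]`. -/
theorem param_eq_smul {K : Type*} [Field K] {x : Fin 7 → K} (hx : OnSurface x) :
    param (x 2) (x 4) (x 5) = (x 5) ^ 2 • x := by
  obtain ⟨-, -, -, e4, e5, e6, -, -, e9⟩ := hx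
  ext i
  fin_cases i <;> simp [param]
  · linear_combination -(x 5) * e4
  · linear_combination -(x 5) * e5
  · linear_combination -(x 5) * e6
  · ring
  · linear_combination (x 2 + x 4) * e4 - (x 5) * e9

theorem param_smul {R : Type*} [CommRing R] (c x y z : R) :
    param (c * x) (c * y) (c * z) = c ^ 3 • param x y z := by
  ext i
  fin_cases i <;> simp [param] <;> ring

/-- The triple `(x, y, z)` is primitive. -/
def Primitive (x y z : ℤ) : Prop :=
  ∀ p : ℕ, p.Prime → (p : ℤ) ∣ x → (p : ℤ) ∣ y → ¬ (p : ℤ) ∣ z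

/-- A point of the affine plane in primitive homogeneous coordinates with positive denominator. -/
theorem exists_primitive (r t : ℚ) : ∃ x y z : ℤ, 0 < z ∧ Primitive x y z ∧
    r = x / z ∧ t = y / z := by
  set f : Fin 3 → ℤ := ![r.num * t.den, t.num * r.den, r.den * t.den] with hf
  obtain ⟨g, hg, hg1⟩ := Finset.extract_gcd f (s := Finset.univ) Finset.univ_nonempty
  set d := Finset.univ.gcd f with hd
  have hf2 : 0 < f 2 := by simp [hf, r.den_pos, t.den_pos]
  have hd0 : 0 ≤ d := by
    rw [hd, ← Finset.normalize_gcd]; exact Int.nonneg_of_normalize_eq_self (normalize_idem _)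
  have h0 := hg 0 (Finset.mem_univ _)
  have h1 := hg 1 (Finset.mem_univ _)
  have h2 := hg 2 (Finset.mem_univ _)
  have hg2 : 0 < g 2 := by
    rw [h2] at hf2
    exact pos_of_mul_pos_right hf2 hd0
  have hdp : d ≠ 0 := by rintro h; rw [h2, h] at hf2; simp at hf2
  have hdq : (d : ℚ) ≠ 0 := by exact_mod_cast hdp
  have hgq : (g 2 : ℚ) ≠ 0 := by exact_mod_cast hg2.ne'
  have hrd : (r.den : ℚ) ≠ 0 := by exact_mod_cast r.den_pos.ne'
  have htd : (t.den : ℚ) ≠ 0 := by exact_mod_cast t.den_pos.ne'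
  have q0 : (r.num * t.den : ℚ) = d * g 0 := by
    have : r.num * t.den = d * g 0 := h0
    exact_mod_cast this
  have q1 : (t.num * r.den : ℚ) = d * g 1 := by
    have : t.num * r.den = d * g 1 := h1
    exact_mod_cast this
  have q2 : (r.den * t.den : ℚ) = d * g 2 := by
    have : (r.den * t.den : ℤ) = d * g 2 := h2
    exact_mod_cast this
  refine ⟨g 0, g 1, g 2, hg2, fun p hp d0 d1 d2 => ?_, ?_, ?_⟩
  · have : (p : ℤ) ∣ Finset.univ.gcd g := Finset.dvd_gcd fun i _ => by fin_cases i <;> assumption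
    rw [hg1] at this
    exact hp.one_lt.ne' (by exact_mod_cast Int.eq_one_of_dvd_one (by positivity) this)
  · rw [eq_div_iff hgq]
    refine mul_left_cancel₀ hdq ?_
    nth_rewrite 1 [← Rat.num_div_den r]
    rw [← q0, mul_left_comm, ← q2]; field_simp
  · rw [eq_div_iff hgq]
    refine mul_left_cancel₀ hdq ?_
    nth_rewrite 1 [← Rat.num_div_den t]
    rw [← q1, mul_left_comm, ← q2]; field_simp

theorem Primitive.dvd_of_mul {x y z z' : ℤ} (h : Primitive x y z) (hx : z ∣ x * z')
    (hy : z ∣ y * z') : z ∣ z' := by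
  have hco : IsCoprime z (Int.gcd x y : ℤ) := by
    rw [Int.isCoprime_iff_gcd_eq_one, Int.gcd, Int.natAbs_natCast]
    refine Nat.coprime_of_dvd fun p hp h1 h2 => ?_
    have h3 : (p : ℤ) ∣ (Int.gcd x y : ℤ) := Int.natCast_dvd_natCast.2 h2
    exact h p hp (h3.trans (Int.gcd_dvd_left _ _)) (h3.trans (Int.gcd_dvd_right _ _))
      (Int.natCast_dvd.2 h1)
  refine hco.dvd_of_dvd_mul_left ?_
  rw [Int.gcd_eq_gcd_ab, add_mul]
  exact dvd_add ((hx.mul_right (Int.gcdA x y)).trans (dvd_of_eq (by ring)))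
    ((hy.mul_right (Int.gcdB x y)).trans (dvd_of_eq (by ring)))

theorem Primitive.eq_of_mul_eq {x y z x' y' z' : ℤ} (h : Primitive x y z) (h' : Primitive x' y' z')
    (hz : 0 < z) (hz' : 0 < z') (hx : x * z' = x' * z) (hy : y * z' = y' * z) :
    x = x' ∧ y = y' ∧ z = z' := by
  have e : z = z' := Int.dvd_antisymm hz.le hz'.le
    (h.dvd_of_mul (hx ▸ dvd_mul_left _ _) (hy ▸ dvd_mul_left _ _))
    (h'.dvd_of_mul (hx ▸ dvd_mul_left _ _) (hy ▸ dvd_mul_left _ _))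
  subst e
  exact ⟨mul_right_cancel₀ hz.ne' hx, mul_right_cancel₀ hz.ne' hy, rfl⟩

/-! ### The height in terms of the parametrization -/

theorem gcd_eq_one_of_forall_prime {ι : Type*} [Fintype ι] {f : ι → ℤ}
    (h : ∀ p : ℕ, p.Prime → ¬ ∀ i, (p : ℤ) ∣ f i) : Finset.univ.gcd f = 1 := by
  have h0 : 0 ≤ Finset.univ.gcd f := by
    rw [← Finset.normalize_gcd]; exact Int.nonneg_of_normalize_eq_self (normalize_idem _)
  by_contra hne
  have hne' : (Finset.univ.gcd f).natAbs ≠ 1 := by omega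
  obtain ⟨p, hp, hd⟩ := Nat.exists_prime_and_dvd hne'
  exact h p hp fun i => (Int.natCast_dvd.2 hd).trans (Finset.gcd_dvd (Finset.mem_univ i))

theorem iSup_abs_le_iff {ι : Type*} [Finite ι] [Nonempty ι] (f : ι → ℤ) (B : ℝ) :
    ((⨆ i, |f i| : ℤ) : ℝ) ≤ B ↔ ∀ i, |(f i : ℝ)| ≤ B := by
  constructor
  · intro h i
    have : |f i| ≤ ⨆ i, |f i| := le_ciSup (f := fun i => |f i|) (Set.finite_range _).bddAbove i
    calc |(f i : ℝ)| = ((|f i| : ℤ) : ℝ) := by push_cast; rfl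
      _ ≤ ((⨆ i, |f i| : ℤ) : ℝ) := by exact_mod_cast this
      _ ≤ B := h
  · intro h
    obtain ⟨i, hi⟩ := exists_eq_ciSup_of_finite (f := fun i => |f i|)
    rw [← hi]
    push_cast
    exact h i

/-- For a primitive triple with `gcd(z, x) = n₁`, `gcd(z, y) = n₂`, `gcd(z, x + y) = n₃`, the
content of `param x y z` is `n₁ n₂ n₃`, which gives the height. -/
theorem mulHeight_param_le_iff {s n₁ n₂ n₃ : ℕ} (hs : 0 < s) (h1 : 0 < n₁) (h2 : 0 < n₂)
    (h3 : 0 < n₃) {x y : ℤ} (hprim : Primitive x y (s * n₁ * n₂ * n₃ : ℕ))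
    (g1 : Int.gcd (s * n₁ * n₂ * n₃ : ℕ) x = n₁) (g2 : Int.gcd (s * n₁ * n₂ * n₃ : ℕ) y = n₂)
    (g3 : Int.gcd (s * n₁ * n₂ * n₃ : ℕ) (x + y) = n₃) {B : ℝ}
    (hB : 0 ≤ B) (h0 : param (x : ℚ) y (s * n₁ * n₂ * n₃ : ℕ) ≠ 0) :
    (Projectivization.mk ℚ _ h0).mulHeight ≤ B ↔
      (s : ℝ) ^ 3 * (n₁ * n₂ * n₃) ^ 2 ≤ B ∧
        ((x : ℝ), (y : ℝ)) ∈ pairRegion √(B / s) (B * (n₁ * n₂ * n₃)) := by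
  set z : ℕ := s * n₁ * n₂ * n₃ with hz
  obtain ⟨a, ha⟩ : (n₁ : ℤ) ∣ x := by
    have := Int.gcd_dvd_right (z : ℤ) x
    rwa [g1] at this
  obtain ⟨b, hb⟩ : (n₂ : ℤ) ∣ y := by
    have := Int.gcd_dvd_right (z : ℤ) y
    rwa [g2] at this
  obtain ⟨c, hc⟩ : (n₃ : ℤ) ∣ x + y := by
    have := Int.gcd_dvd_right (z : ℤ) (x + y)
    rwa [g3] at this
  rw [ha, gcd_mul_eq_iff (show z = n₁ * (s * n₂ * n₃) by rw [hz]; ring) h1] at g1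
  rw [hb, gcd_mul_eq_iff (show z = n₂ * (s * n₁ * n₃) by rw [hz]; ring) h2] at g2
  rw [hc, gcd_mul_eq_iff (show z = n₃ * (s * n₁ * n₂) by rw [hz]; ring) h3] at g3
  -- The vector `param x y z` divided by `n₁ n₂ n₃`, where `z = s n₁ n₂ n₃` and `x = n₁ a`, `y = n₂ b`,
  -- `x + y = n₃ c`.
  set w : Fin 7 → ℤ := ![s * (x * y), s * x ^ 2, s * (z * x), s * y ^ 2, s * (z * y), s * z ^ 2,
    -(a * b * c)] with hw
  have hn : ((n₁ * n₂ * n₃ : ℕ) : ℚ) ≠ 0 := by positivity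
  have hxy : x * y * (x + y) = (n₁ * n₂ * n₃ : ℕ) * (a * b * c) := by
    rw [hc, ha, hb]; push_cast; ring
  have hpw : param (x : ℚ) y z = ((n₁ * n₂ * n₃ : ℕ) : ℚ) • (Int.cast ∘ w : Fin 7 → ℚ) := by
    have hxy' : (x * y * (x + y) : ℚ) = (n₁ * n₂ * n₃ : ℕ) * (a * b * c) := by exact_mod_cast hxy
    have hz' : (z : ℚ) = s * (n₁ * n₂ * n₃ : ℕ) := by rw [hz]; push_cast; ring
    ext i
    fin_cases i <;> simp only [param, hw, Pi.smul_apply, smul_eq_mul, Function.comp_apply,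
      Matrix.cons_val, Fin.reduceFinMk, Fin.zero_eta, Fin.mk_one, Int.cast_mul, Int.cast_pow,
      Int.cast_natCast, Int.cast_neg] <;> try (rw [hz']; ring)
    linear_combination -hxy'
  have hgcd : Finset.univ.gcd w = 1 := by
    refine gcd_eq_one_of_forall_prime fun p hp hall => ?_
    have hpp := Nat.prime_iff_prime_int.1 hp
    have e1 : (p : ℤ) ∣ s * x ^ 2 := hall 1
    have e3 : (p : ℤ) ∣ s * y ^ 2 := hall 3
    have e5 : (p : ℤ) ∣ s * (z : ℤ) ^ 2 := hall 5
    have e6 : (p : ℤ) ∣ -(a * b * c) := hall 6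
    -- A prime dividing `s` is prime to `a b c` because the gcds are exactly `n₁, n₂, n₃`.
    by_cases hps : (p : ℤ) ∣ s
    · have hps' : p ∣ s := Int.natCast_dvd_natCast.1 hps
      rw [dvd_neg] at e6
      rcases hpp.dvd_or_dvd e6 with e | e
      · rcases hpp.dvd_or_dvd e with e | e
        · exact g1 p hp ((hps'.mul_right _).mul_right _) e
        · exact g2 p hp ((hps'.mul_right _).mul_right _) e
      · exact g3 p hp ((hps'.mul_right _).mul_right _) e
    · exact hprim p hp (hpp.dvd_of_dvd_pow ((hpp.dvd_or_dvd e1).resolve_left hps))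
        (hpp.dvd_of_dvd_pow ((hpp.dvd_or_dvd e3).resolve_left hps))
        (hpp.dvd_of_dvd_pow ((hpp.dvd_or_dvd e5).resolve_left hps))
  rw [Projectivization.mulHeight_mk, hpw, Height.mulHeight_smul_eq_mulHeight _ hn,
    Rat.mulHeight_eq_max_abs_of_gcd_eq_one hgcd, iSup_abs_le_iff]
  have hs' : (0 : ℝ) < s := by exact_mod_cast hs
  have hnpos : (0 : ℝ) < n₁ * n₂ * n₃ := by positivity
  have hzr : (z : ℝ) = s * (n₁ * n₂ * n₃) := by rw [hz]; push_cast; ring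
  have hz0 : (0 : ℝ) ≤ z := by positivity
  have hxyr : (x * y * (x + y) : ℝ) = n₁ * n₂ * n₃ * (a * b * c) := by exact_mod_cast hxy
  have hreg : ((x : ℝ), (y : ℝ)) ∈ pairRegion √(B / s) (B * (n₁ * n₂ * n₃)) ↔
      (s : ℝ) * x ^ 2 ≤ B ∧ (s : ℝ) * y ^ 2 ≤ B ∧ |(a * b * c : ℝ)| ≤ B := by
    have hsq : ∀ t : ℝ, |t| ≤ √(B / s) ↔ (s : ℝ) * t ^ 2 ≤ B := fun t => by
      rcases eq_or_ne t 0 with rfl | ht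
      · exact iff_of_true (by rw [abs_zero]; positivity) (by simpa using hB)
      · rw [Real.le_sqrt' (abs_pos.2 ht), sq_abs, le_div_iff₀ hs', mul_comm]
    simp only [pairRegion, Set.mem_ofPred_eq, hsq, hxyr]
    rw [abs_mul, abs_of_pos hnpos, mul_comm B, mul_le_mul_iff_right₀ hnpos]
  have h6 : (s : ℝ) * (z : ℝ) ^ 2 = s ^ 3 * (n₁ * n₂ * n₃) ^ 2 := by rw [hzr]; ring
  rw [hreg, ← h6]
  have hcoord : (∀ i, |(w i : ℝ)| ≤ B) ↔ |(s * (x * y) : ℝ)| ≤ B ∧ |(s * x ^ 2 : ℝ)| ≤ B ∧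
      |(s * (z * x) : ℝ)| ≤ B ∧ |(s * y ^ 2 : ℝ)| ≤ B ∧ |(s * (z * y) : ℝ)| ≤ B ∧
      |(s * z ^ 2 : ℝ)| ≤ B ∧ |(-(a * b * c) : ℝ)| ≤ B := by
    simp only [hw, Fin.forall_fin_succ, Matrix.cons_val_zero,
      Matrix.cons_val_succ]
    push_cast
    simp
  rw [hcoord]
  have hpos : ∀ t : ℝ, |(s * t ^ 2 : ℝ)| = s * t ^ 2 := fun t => abs_of_nonneg (by positivity)
  -- The mixed monomials impose no condition: `|t u| ≤ max (t²) (u²)`.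
  have hmix : ∀ t u : ℝ, (s : ℝ) * t ^ 2 ≤ B → (s : ℝ) * u ^ 2 ≤ B → |(s * (t * u) : ℝ)| ≤ B := by
    intro t u ht hu
    rw [abs_le]
    constructor
    · linarith [mul_nonneg hs'.le (sq_nonneg (t + u))]
    · linarith [mul_nonneg hs'.le (sq_nonneg (t - u))]
  rw [hpos, hpos, hpos, abs_neg]
  constructor
  · rintro ⟨-, k2, -, k4, -, k6, k7⟩
    exact ⟨k6, k2, k4, k7⟩
  · rintro ⟨k6, k2, k4, k7⟩
    exact ⟨hmix _ _ k2 k4, k2, hmix _ _ k6 k2, k4, hmix _ _ k6 k4, k6, k7⟩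

theorem Primitive.not_dvd_two_gcd {x y : ℤ} {z : ℕ} (h : Primitive x y z) {p : ℕ} (hp : p.Prime) :
    ¬ (p ∣ Int.gcd z x ∧ p ∣ Int.gcd z y) ∧ ¬ (p ∣ Int.gcd z x ∧ p ∣ Int.gcd z (x + y)) ∧
      ¬ (p ∣ Int.gcd z y ∧ p ∣ Int.gcd z (x + y)) := by
  have hd : ∀ {t : ℤ}, p ∣ Int.gcd z t → (p : ℤ) ∣ z ∧ (p : ℤ) ∣ t := fun h =>
    ⟨(Int.natCast_dvd_natCast.2 h).trans (Int.gcd_dvd_left _ _),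
      (Int.natCast_dvd_natCast.2 h).trans (Int.gcd_dvd_right _ _)⟩
  refine ⟨fun ⟨a, b⟩ => ?_, fun ⟨a, b⟩ => ?_, fun ⟨a, b⟩ => ?_⟩
  · exact h p hp (hd a).2 (hd b).2 (hd a).1
  · exact h p hp (hd a).2 ((dvd_add_right (hd a).2).1 (hd b).2) (hd a).1
  · exact h p hp ((dvd_add_left (hd a).2).1 (hd b).2) (hd a).2 (hd a).1

/-- The three gcds of a primitive triple are coprime in pairs, so their product divides `z`. -/
theorem Primitive.exists_eq_mul {x y : ℤ} {z : ℕ} (hz : 0 < z) (h : Primitive x y z) :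
    ∃ s : ℕ, 0 < s ∧ 0 < Int.gcd z x ∧ 0 < Int.gcd z y ∧ 0 < Int.gcd z (x + y) ∧
      z = s * Int.gcd z x * Int.gcd z y * Int.gcd z (x + y) := by
  have hd : ∀ t : ℤ, Int.gcd z t ∣ z := fun t =>
    Int.natCast_dvd_natCast.1 (Int.gcd_dvd_left _ _)
  have c12 : Nat.Coprime (Int.gcd z x) (Int.gcd z y) :=
    Nat.coprime_of_dvd fun p hp a b => (h.not_dvd_two_gcd hp).1 ⟨a, b⟩
  have c13 : Nat.Coprime (Int.gcd z x) (Int.gcd z (x + y)) :=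
    Nat.coprime_of_dvd fun p hp a b => (h.not_dvd_two_gcd hp).2.1 ⟨a, b⟩
  have c23 : Nat.Coprime (Int.gcd z y) (Int.gcd z (x + y)) :=
    Nat.coprime_of_dvd fun p hp a b => (h.not_dvd_two_gcd hp).2.2 ⟨a, b⟩
  obtain ⟨s, hs⟩ := (c13.mul_left c23).mul_dvd_of_dvd_of_dvd
    (c12.mul_dvd_of_dvd_of_dvd (hd x) (hd y)) (hd (x + y))
  refine ⟨s, Nat.pos_of_ne_zero ?_, Nat.pos_of_dvd_of_pos (hd _) hz,
    Nat.pos_of_dvd_of_pos (hd _) hz, Nat.pos_of_dvd_of_pos (hd _) hz, ?_⟩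
  · rintro rfl
    exact hz.ne' hs
  · conv_lhs => rw [hs]
    ring

/-- A point of `U` determines the primitive triple, as `[x₃ : x₅ : x₆] = [x : y : z]`. -/
theorem eq_of_mk_param_eq {x y x' y' : ℤ} {z z' : ℕ} (hz : 0 < z) (hz' : 0 < z')
    (h : Primitive x y z) (h' : Primitive x' y' z') (h0 : param (x : ℚ) y z ≠ 0)
    (h0' : param (x' : ℚ) y' z' ≠ 0)
    (he : Projectivization.mk ℚ _ h0 = Projectivization.mk ℚ _ h0') :
    x = x' ∧ y = y' ∧ z = z' := by
  obtain ⟨a, ha⟩ := (Projectivization.mk_eq_mk_iff' ℚ _ _ h0 h0').1 he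
  have e2 : a * (z' ^ 2 * x' : ℚ) = z ^ 2 * x := by simpa [param] using congrFun ha 2
  have e4 : a * (z' ^ 2 * y' : ℚ) = z ^ 2 * y := by simpa [param] using congrFun ha 4
  have e5 : a * (z' ^ 3 : ℚ) = z ^ 3 := by simpa [param] using congrFun ha 5
  have hzq : (z : ℚ) ≠ 0 := by exact_mod_cast hz.ne'
  have hzq' : (z' : ℚ) ≠ 0 := by exact_mod_cast hz'.ne'
  have k1 : (x * z' : ℚ) = x' * z := by
    have : (z : ℚ) ^ 2 * (x * z') = z ^ 2 * (x' * z) := by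
      linear_combination (-(z' : ℚ)) * e2 + (x' : ℚ) * e5
    exact mul_left_cancel₀ (pow_ne_zero 2 hzq) this
  have k2 : (y * z' : ℚ) = y' * z := by
    have : (z : ℚ) ^ 2 * (y * z') = z ^ 2 * (y' * z) := by
      linear_combination (-(z' : ℚ)) * e4 + (y' : ℚ) * e5
    exact mul_left_cancel₀ (pow_ne_zero 2 hzq) this
  have := h.eq_of_mul_eq h' (by exact_mod_cast hz) (by exact_mod_cast hz')
    (by exact_mod_cast k1) (by exact_mod_cast k2)
  exact_mod_cast this

/-- Every point of `U` comes from a primitive triple with `z > 0`. -/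
theorem exists_mk_param_eq {P : ℙ ℚ (Fin 7 → ℚ)} (hP : P ∈ U) :
    ∃ (x y : ℤ) (z : ℕ) (h0 : param (x : ℚ) y z ≠ 0), 0 < z ∧ Primitive x y z ∧
      Projectivization.mk ℚ _ h0 = P := by
  induction P using Projectivization.ind with
  | h v hv =>
    obtain ⟨hS, h5⟩ := (mk_mem_U_iff v hv).1 hP
    obtain ⟨x, y, z, hz, hprim, hx, hy⟩ := exists_primitive (v 2 / v 5) (v 4 / v 5)
    lift z to ℕ using hz.le
    have hz' : 0 < z := by exact_mod_cast hz
    have hzq : (z : ℚ) ≠ 0 := by exact_mod_cast hz'.ne'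
    have h0 : param (x : ℚ) y z ≠ 0 := param_ne_zero hzq
    refine ⟨x, y, z, h0, hz', hprim, ?_⟩
    rw [Projectivization.mk_eq_mk_iff']
    refine ⟨(z / v 5) ^ 3 * v 5 ^ 2, ?_⟩
    rw [mul_smul, ← param_eq_smul hS, ← param_smul]
    rw [Int.cast_natCast] at hx hy
    congr 1
    · rw [div_eq_div_iff h5 hzq] at hx
      field_simp
      linear_combination hx
    · rw [div_eq_div_iff h5 hzq] at hy
      field_simp
      linear_combination hy
    · field_simp

/-- The rational points of bounded height are counted by the pairs in the sets `pairSet`. -/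
theorem finite_pointsUpTo_and_countU_eq {B : ℝ} (hB : 0 ≤ B) : (pointsUpTo B).Finite ∧
    countU B = ∑ v ∈ tuples B, (pairSet v.1 v.2.1 v.2.2.1 v.2.2.2 √(B / v.1)
        (B * (v.2.1 * v.2.2.1 * v.2.2.2))).ncard := by
  set E : Finset (Σ _ : ℕ × ℕ × ℕ × ℕ, ℤ × ℤ) := (tuples B).sigma fun v =>
    (finite_pairSet v.1 v.2.1 v.2.2.1 v.2.2.2 √(B / v.1)
        (B * (v.2.1 * v.2.2.1 * v.2.2.2))).toFinset with hE
  have hmem : ∀ e, e ∈ E ↔ e.1 ∈ tuples B ∧ e.2 ∈ pairSet e.1.1 e.1.2.1 e.1.2.2.1 e.1.2.2.2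
      √(B / e.1.1) (B * (e.1.2.1 * e.1.2.2.1 * e.1.2.2.2)) := fun e => by
    simp [hE, Finset.mem_sigma]
  have hpos : ∀ e ∈ E, 0 < e.1.1 ∧ 0 < e.1.2.1 ∧ 0 < e.1.2.2.1 ∧ 0 < e.1.2.2.2 := fun e he =>
    ((mem_tuples hB).1 ((hmem e).1 he).1).1
  have hz0 : ∀ e ∈ E, 0 < e.1.1 * e.1.2.1 * e.1.2.2.1 * e.1.2.2.2 := fun e he => by
    obtain ⟨h0, h1, h2, h3⟩ := hpos e he
    positivity
  have hprim : ∀ e ∈ E, Primitive e.2.1 e.2.2 (e.1.1 * e.1.2.1 * e.1.2.2.1 * e.1.2.2.2 : ℕ) :=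
    fun e he p hp h1 h2 h3 =>
      ((hmem e).1 he).2.2.2.2.2 p hp h1 h2 (Int.natCast_dvd_natCast.1 h3)
  have hne : ∀ e ∈ E,
      param (e.2.1 : ℚ) e.2.2 (e.1.1 * e.1.2.1 * e.1.2.2.1 * e.1.2.2.2 : ℕ) ≠ 0 :=
    fun e he => param_ne_zero (by exact_mod_cast (hz0 e he).ne')
  have hU : ∀ e (he : e ∈ E), Projectivization.mk ℚ _ (hne e he) ∈ pointsUpTo B := by
    intro e he
    obtain ⟨h0, h1, h2, h3⟩ := hpos e he
    obtain ⟨hv, hreg, g1, g2, g3, -⟩ := (hmem e).1 he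
    refine ⟨(mk_mem_U_iff _ _).2 ⟨onSurface_param _ _ _, ?_⟩,
      (mulHeight_param_le_iff h0 h1 h2 h3 (hprim e he) g1 g2 g3 hB _).2
        ⟨((mem_tuples hB).1 hv).2, hreg⟩⟩
    exact pow_ne_zero 3 (by exact_mod_cast (hz0 e he).ne')
  let f : E → pointsUpTo B := fun e => ⟨_, hU e.1 e.2⟩
  have hbij : Function.Bijective f := by
    constructor
    · rintro ⟨⟨⟨s, n₁, n₂, n₃⟩, x, y⟩, he⟩ ⟨⟨⟨s', n₁', n₂', n₃'⟩, x', y'⟩, he'⟩ hff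
      have heq := congrArg Subtype.val hff
      obtain ⟨rfl, rfl, hz⟩ := eq_of_mk_param_eq (hz0 _ he) (hz0 _ he') (hprim _ he) (hprim _ he')
        (hne _ he) (hne _ he') heq
      obtain ⟨-, -, g1, g2, g3, -⟩ := (hmem _).1 he
      obtain ⟨-, -, g1', g2', g3', -⟩ := (hmem _).1 he'
      simp only at hz g1 g2 g3 g1' g2' g3'
      rw [← hz] at g1' g2' g3'
      obtain rfl := g1.symm.trans g1'
      obtain rfl := g2.symm.trans g2'
      obtain rfl := g3.symm.trans g3'
      obtain ⟨h0, h1, h2, h3⟩ := hpos _ he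
      simp only at h1 h2 h3
      have hs : s = s' := Nat.eq_of_mul_eq_mul_right h1
        (Nat.eq_of_mul_eq_mul_right h2 (Nat.eq_of_mul_eq_mul_right h3 hz))
      subst hs
      rfl
    · rintro ⟨P, hPU, hPB⟩
      obtain ⟨x, y, z, h0, hz, hp, rfl⟩ := exists_mk_param_eq hPU
      obtain ⟨s, hs, h1, h2, h3, hsz⟩ := hp.exists_eq_mul hz
      set n₁ := Int.gcd z x with g1
      set n₂ := Int.gcd z y with g2
      set n₃ := Int.gcd z (x + y) with g3
      clear_value n₁ n₂ n₃
      subst hsz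
      obtain ⟨hv, hreg⟩ :=
        (mulHeight_param_le_iff hs h1 h2 h3 hp g1.symm g2.symm g3.symm hB h0).1 hPB
      have he : (⟨(s, n₁, n₂, n₃), x, y⟩ : Σ _ : ℕ × ℕ × ℕ × ℕ, ℤ × ℤ) ∈ E :=
        (hmem _).2 ⟨(mem_tuples hB).2 ⟨⟨hs, h1, h2, h3⟩, hv⟩, hreg, g1.symm, g2.symm, g3.symm,
          fun p hpp a b c => hp p hpp a b (Int.natCast_dvd_natCast.2 c)⟩
      exact ⟨⟨_, he⟩, rfl⟩
  refine ⟨Set.finite_coe_iff.1 (Finite.of_surjective f hbij.2), ?_⟩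
  rw [countU, ← Nat.card_coe_set_eq, ← Nat.card_eq_of_bijective f hbij, Nat.card_eq_fintype_card,
    Fintype.card_coe, hE, Finset.card_sigma]
  exact Finset.sum_congr rfl fun v _ => (Set.ncard_eq_toFinset_card _ _).symm

/-! ### Integrals of powers of the logarithm -/

/-- The positive part of `-log |t|`. -/
noncomputable def negLog (t : ℝ) : ℝ := max (-log t) 0

theorem negLog_nonneg (t : ℝ) : 0 ≤ negLog t := le_max_right _ _

theorem neg_log_le_negLog (t : ℝ) : -log t ≤ negLog t := le_max_left _ _

theorem negLog_abs (t : ℝ) : negLog |t| = negLog t := by rw [negLog, log_abs, negLog]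

theorem negLog_of_abs_le_one {t : ℝ} (h : |t| ≤ 1) : negLog t = -log t := by
  rw [negLog, ← log_abs]
  exact max_eq_left (neg_nonneg.2 (log_nonpos (abs_nonneg t) h))

theorem negLog_of_one_le_abs {t : ℝ} (h : 1 ≤ |t|) : negLog t = 0 := by
  rw [negLog, ← log_abs]
  exact max_eq_right (neg_nonpos.2 (log_nonneg h))

theorem continuousOn_mul_log_pow {j : ℕ} (hj : j ≠ 0) :
    ContinuousOn (fun x : ℝ => x * log x ^ j) (Set.Icc 0 1) := by
  have hj' : (j : ℝ) ≠ 0 := by exact_mod_cast hj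
  have h1 : Continuous fun x : ℝ =>
      (j : ℝ) ^ j * (x ^ (1 / j : ℝ) * log (x ^ (1 / j : ℝ))) ^ j := by
    have hc : Continuous fun x : ℝ => x ^ (1 / j : ℝ) :=
      continuous_id.rpow_const fun x => Or.inr (by positivity)
    exact continuous_const.mul ((continuous_mul_log.comp hc).pow j)
  refine h1.continuousOn.congr fun x hx => ?_
  rcases eq_or_lt_of_le hx.1 with rfl | h
  · simp [hj]
  · simp only
    rw [log_rpow h, mul_pow, ← rpow_natCast (x ^ (1 / j : ℝ)), ← rpow_mul h.le,
      one_div_mul_cancel hj', rpow_one, mul_pow,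
      mul_left_comm, ← mul_assoc ((j : ℝ) ^ j), ← mul_pow, mul_one_div_cancel hj', one_pow, one_mul]

/-- Integration by means of an antiderivative `F` of `(-log x)^k` on `(0, 1)`, continuous at the ends. -/
theorem integral_Ioi_negLog_pow {k : ℕ} (hk : k ≠ 0) {F : ℝ → ℝ}
    (hF : ContinuousOn F (Set.Icc 0 1))
    (hd : ∀ x ∈ Set.Ioo (0 : ℝ) 1, HasDerivAt F ((-log x) ^ k) x) :
    ∫ t in Set.Ioi (0 : ℝ), negLog t ^ k = F 1 - F 0 := by
  have hint : IntegrableOn (fun x => (-log x) ^ k) (Set.Ioc 0 1) :=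
    intervalIntegral.integrableOn_deriv_of_nonneg hF hd fun x hx =>
      pow_nonneg (neg_nonneg.2 (log_nonpos hx.1.le hx.2.le)) k
  have h1 := intervalIntegral.integral_eq_sub_of_hasDerivAt_of_le zero_le_one hF hd
    ((intervalIntegrable_iff_integrableOn_Ioc_of_le zero_le_one).2 hint)
  rw [intervalIntegral.integral_of_le zero_le_one] at h1
  rw [← h1, ← integral_indicator measurableSet_Ioi, ← integral_indicator measurableSet_Ioc]
  congr 1
  ext t
  simp only [Set.indicator_apply, Set.mem_Ioi, Set.mem_Ioc]
  by_cases h0 : 0 < t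
  · by_cases ht : t ≤ 1
    · rw [if_pos h0, if_pos ⟨h0, ht⟩, negLog_of_abs_le_one (by rwa [abs_of_pos h0])]
    · rw [if_pos h0, if_neg fun h => ht h.2,
        negLog_of_one_le_abs (by rw [abs_of_pos h0]; exact (not_le.1 ht).le), zero_pow hk]
  · rw [if_neg h0, if_neg fun h => h0 h.1]

theorem integral_negLog_pow_eq {k : ℕ} (hk : k ≠ 0) {F : ℝ → ℝ}
    (hF : ContinuousOn F (Set.Icc 0 1))
    (hd : ∀ x ∈ Set.Ioo (0 : ℝ) 1, HasDerivAt F ((-log x) ^ k) x) :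
    ∫ t, negLog t ^ k = 2 * (F 1 - F 0) := by
  rw [← integral_Ioi_negLog_pow hk hF hd, ← integral_comp_abs (f := fun t => negLog t ^ k)]
  simp only [negLog_abs]

theorem integral_negLog : ∫ t, negLog t = 2 := by
  have := integral_negLog_pow_eq (k := 1) one_ne_zero (F := fun x => x - x * log x ^ 1)
    (continuousOn_id.sub (continuousOn_mul_log_pow one_ne_zero)) (fun x hx => by
      have h := (hasDerivAt_id x).sub ((hasDerivAt_id x).mul (hasDerivAt_log hx.1.ne'))
      simp only [pow_one]
      refine h.congr_deriv ?_
      have := hx.1.ne'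
      simp only [id]; field_simp; ring)
  simpa using this

theorem integral_negLog_sq : ∫ t, negLog t ^ 2 = 4 := by
  have := integral_negLog_pow_eq (k := 2) two_ne_zero
    (F := fun x => 2 * x - 2 * (x * log x ^ 1) + x * log x ^ 2)
    (((continuousOn_const.mul continuousOn_id).sub
      (continuousOn_const.mul (continuousOn_mul_log_pow one_ne_zero))).add
      (continuousOn_mul_log_pow two_ne_zero)) (fun x hx => by
      have hl := hasDerivAt_log hx.1.ne'
      have hx' := hasDerivAt_id x
      have h := ((hx'.const_mul 2).sub ((hx'.mul (hl.pow 1)).const_mul 2)).add (hx'.mul (hl.pow 2))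
      refine h.congr_deriv ?_
      have := hx.1.ne'
      simp only [id, Nat.cast_ofNat, Nat.cast_one, Pi.pow_apply]; field_simp; ring)
  rw [this]; norm_num

theorem integral_negLog_cube : ∫ t, negLog t ^ 3 = 12 := by
  have := integral_negLog_pow_eq (k := 3) three_ne_zero
    (F := fun x => 6 * x - 6 * (x * log x ^ 1) + 3 * (x * log x ^ 2) - x * log x ^ 3)
    ((((continuousOn_const.mul continuousOn_id).sub
      (continuousOn_const.mul (continuousOn_mul_log_pow one_ne_zero))).add
      (continuousOn_const.mul (continuousOn_mul_log_pow two_ne_zero))).sub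
      (continuousOn_mul_log_pow three_ne_zero)) (fun x hx => by
      have hl := hasDerivAt_log hx.1.ne'
      have hx' := hasDerivAt_id x
      have h := (((hx'.const_mul 6).sub ((hx'.mul (hl.pow 1)).const_mul 6)).add
        ((hx'.mul (hl.pow 2)).const_mul 3)).sub (hx'.mul (hl.pow 3))
      refine h.congr_deriv ?_
      have := hx.1.ne'
      simp only [id, Nat.cast_ofNat, Nat.cast_one, Pi.pow_apply]; field_simp; ring)
  rw [this]; norm_num

-- a function with nonzero Bochner integral is integrable
theorem integrable_negLog : Integrable negLog := by
  by_contra h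
  have := integral_undef h
  rw [integral_negLog] at this
  norm_num at this

theorem integrable_negLog_sq : Integrable fun t => negLog t ^ 2 := by
  by_contra h
  have := integral_undef h
  rw [integral_negLog_sq] at this
  norm_num at this

theorem integrable_negLog_cube : Integrable fun t => negLog t ^ 3 := by
  by_contra h
  have := integral_undef h
  rw [integral_negLog_cube] at this
  norm_num at this

/-! ### Integrals of the logarithm of the cubic form -/

/-- The shear `(x, y) ↦ (x, x + y)` preserves the measure. -/
theorem integrable_and_integral_mul_add {u v : ℝ → ℝ} (hu : Integrable u) (hv : Integrable v) :
    Integrable (fun p : ℝ × ℝ => u p.1 * v (p.1 + p.2)) ∧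
      ∫ p : ℝ × ℝ, u p.1 * v (p.1 + p.2) = (∫ t, u t) * ∫ t, v t := by
  have hmp := measurePreserving_prod_add (volume : Measure ℝ) (volume : Measure ℝ)
  have hme : MeasurableEmbedding fun z : ℝ × ℝ => (z.1, z.1 + z.2) :=
    (MeasurableEquiv.shearAddRight ℝ).measurableEmbedding
  constructor
  · exact (hmp.integrable_comp_emb hme (g := fun p : ℝ × ℝ => u p.1 * v p.2)).2 (hu.mul_prod hv)
  · rw [← integral_prod_mul u v]
    exact hmp.integral_comp hme fun p : ℝ × ℝ => u p.1 * v p.2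

theorem integrable_and_integral_mul_add' {u v : ℝ → ℝ} (hu : Integrable u) (hv : Integrable v) :
    Integrable (fun p : ℝ × ℝ => u p.2 * v (p.1 + p.2)) ∧
      ∫ p : ℝ × ℝ, u p.2 * v (p.1 + p.2) = (∫ t, u t) * ∫ t, v t := by
  obtain ⟨h1, h2⟩ := integrable_and_integral_mul_add hu hv
  have hmp : MeasurePreserving (Prod.swap : ℝ × ℝ → ℝ × ℝ) := Measure.measurePreserving_swap
  have hme : MeasurableEmbedding (Prod.swap : ℝ × ℝ → ℝ × ℝ) :=
    MeasurableEquiv.prodComm.measurableEmbedding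
  have e : (fun p : ℝ × ℝ => u p.2 * v (p.1 + p.2)) =
      (fun p : ℝ × ℝ => u p.1 * v (p.1 + p.2)) ∘ Prod.swap := by
    ext p; simp [add_comm]
  rw [e, ← h2]
  exact ⟨(hmp.integrable_comp_emb hme).2 h1,
    hmp.integral_comp hme fun p : ℝ × ℝ => u p.1 * v (p.1 + p.2)⟩

theorem integrable_and_integral_mul {u v : ℝ → ℝ} (hu : Integrable u) (hv : Integrable v) :
    Integrable (fun p : ℝ × ℝ => u p.1 * v p.2) ∧
      ∫ p : ℝ × ℝ, u p.1 * v p.2 = (∫ t, u t) * ∫ t, v t :=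
  ⟨hu.mul_prod hv, integral_prod_mul u v⟩

theorem integrable_and_integral_add {f g : ℝ × ℝ → ℝ} {μ : Measure (ℝ × ℝ)} {c d : ℝ}
    (hf : Integrable f μ ∧ ∫ p, f p ∂μ = c) (hg : Integrable g μ ∧ ∫ p, g p ∂μ = d) :
    Integrable (fun p => f p + g p) μ ∧ ∫ p, (f p + g p) ∂μ = c + d :=
  ⟨hf.1.add hg.1, by rw [integral_add hf.1 hg.1, hf.2, hg.2]⟩

/-- The indicator function of `[-1, 1]`. -/
noncomputable def unitInd : ℝ → ℝ := (Set.Icc (-1) 1).indicator 1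

theorem unitInd_nonneg (t : ℝ) : 0 ≤ unitInd t := Set.indicator_nonneg (fun _ _ => zero_le_one) t

theorem unitInd_of_mem {t : ℝ} (h : t ∈ Set.Icc (-1 : ℝ) 1) : unitInd t = 1 :=
  Set.indicator_of_mem h 1

theorem integrable_unitInd : Integrable unitInd :=
  (integrable_indicator_iff measurableSet_Icc).2
    (integrableOn_const (C := (1 : ℝ)) measure_Icc_lt_top.ne)

theorem integral_unitInd : ∫ t, unitInd t = 2 := by
  rw [unitInd, integral_indicator_one measurableSet_Icc, Real.volume_real_Icc_of_le (by norm_num)]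
  norm_num

theorem log_cubic {p : ℝ × ℝ} (hp : 0 < cubic p) :
    log (cubic p) = log p.1 + log p.2 + log (p.1 + p.2) := by
  have h := abs_pos.1 hp
  rw [cubic, log_abs, log_mul (left_ne_zero_of_mul h) (right_ne_zero_of_mul h),
    log_mul (left_ne_zero_of_mul (left_ne_zero_of_mul h))
      (right_ne_zero_of_mul (left_ne_zero_of_mul h))]

theorem neg_log_cubic_bounds {p : ℝ × ℝ} (hp : p ∈ cubicRegion) :
    0 ≤ -log (cubic p) ∧
      -log (cubic p) ≤ negLog p.1 + negLog p.2 + negLog (p.1 + p.2) := by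
  obtain ⟨-, h0, h1⟩ := hp
  refine ⟨neg_nonneg.2 (log_nonpos h0.le h1), ?_⟩
  rw [log_cubic h0]
  linarith [neg_log_le_negLog p.1, neg_log_le_negLog p.2, neg_log_le_negLog (p.1 + p.2)]

theorem integrable_one_sub_log_cubic_cube :
    Integrable (fun p => (1 - log (cubic p)) ^ 3) (volume.restrict cubicRegion) := by
  have h1 : Integrable fun p : ℝ × ℝ => unitInd p.1 * unitInd p.2 :=
    integrable_unitInd.mul_prod integrable_unitInd
  have h2 : Integrable fun p : ℝ × ℝ => negLog p.1 ^ 3 * unitInd p.2 :=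
    integrable_negLog_cube.mul_prod integrable_unitInd
  have h3 : Integrable fun p : ℝ × ℝ => unitInd p.1 * negLog p.2 ^ 3 :=
    integrable_unitInd.mul_prod integrable_negLog_cube
  have h4 := (integrable_and_integral_mul_add integrable_unitInd integrable_negLog_cube).1
  have hG := (((h1.add h2).add (h3.add h4)).const_mul 16).restrict (s := cubicRegion)
  refine Integrable.mono' hG ?_ ?_
  · exact ((measurable_const.sub (measurable_log.comp measurable_cubic)).pow_const
      3).aestronglyMeasurable
  · refine (ae_restrict_iff' measurableSet_cubicRegion).2 (ae_of_all _ fun p hp => ?_)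
    obtain ⟨k0, k1⟩ := neg_log_cubic_bounds hp
    have e1 := unitInd_of_mem hp.1.1
    have e2 := unitInd_of_mem hp.1.2
    simp only [Pi.add_apply, e1, e2, one_mul, mul_one]
    rw [norm_of_nonneg (pow_nonneg (by linarith) 3)]
    have n1 := negLog_nonneg p.1
    have n2 := negLog_nonneg p.2
    have n3 := negLog_nonneg (p.1 + p.2)
    have c1 := add_pow_le (show (0 : ℝ) ≤ 1 + negLog p.1 by linarith)
      (show 0 ≤ negLog p.2 + negLog (p.1 + p.2) by linarith) 3
    have c2 := add_pow_le zero_le_one n1 3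
    have c3 := add_pow_le n2 n3 3
    have c4 : (1 - log (cubic p)) ^ 3 ≤
        (1 + negLog p.1 + (negLog p.2 + negLog (p.1 + p.2))) ^ 3 :=
      pow_le_pow_left₀ (by linarith) (by linarith) 3
    norm_num at c1 c2 c3
    linarith

theorem integrable_neg_log_cubic :
    Integrable (fun p => -log (cubic p)) (volume.restrict cubicRegion) := by
  refine Integrable.mono' integrable_one_sub_log_cubic_cube
    (measurable_log.comp measurable_cubic).neg.aestronglyMeasurable
    ((ae_restrict_iff' measurableSet_cubicRegion).2 (ae_of_all _ fun p hp => ?_))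
  have h := (neg_log_cubic_bounds hp).1
  rw [norm_of_nonneg h]
  nlinarith [pow_nonneg h 3, pow_nonneg h 2]

/-- The square of `negLog X + negLog Y + negLog (X + Y)` has three squares, of integral at most
`4 · 2` each over the square, and three mixed products, of integral at most `2 · 2 · 2` each with
the factor two. -/
theorem integral_neg_log_cubic_sq_le : ∫ p in cubicRegion, (-log (cubic p)) ^ 2 ≤ 48 := by
  have i1 := integrable_and_integral_mul integrable_negLog_sq integrable_unitInd
  have i2 := integrable_and_integral_mul integrable_unitInd integrable_negLog_sq
  have i3 := integrable_and_integral_mul_add integrable_unitInd integrable_negLog_sq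
  have i4 := integrable_and_integral_mul integrable_negLog integrable_negLog
  have i5 := integrable_and_integral_mul_add integrable_negLog integrable_negLog
  have i6 := integrable_and_integral_mul_add' integrable_negLog integrable_negLog
  rw [integral_negLog_sq, integral_unitInd] at i1 i2 i3
  rw [integral_negLog] at i4 i5 i6
  have i7 := integrable_and_integral_add (integrable_and_integral_add i4 i5) i6
  obtain ⟨hGi, hGv⟩ := integrable_and_integral_add
    (integrable_and_integral_add (integrable_and_integral_add i1 i2) i3)
    (integrable_and_integral_add i7 i7)
  norm_num at hGv
  set G : ℝ × ℝ → ℝ := fun p => (negLog p.1 ^ 2 * unitInd p.2 + unitInd p.1 * negLog p.2 ^ 2 +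
    unitInd p.1 * negLog (p.1 + p.2) ^ 2) + ((negLog p.1 * negLog p.2 +
    negLog p.1 * negLog (p.1 + p.2) + negLog p.2 * negLog (p.1 + p.2)) + (negLog p.1 * negLog p.2 +
    negLog p.1 * negLog (p.1 + p.2) + negLog p.2 * negLog (p.1 + p.2))) with hG
  have hG0 : ∀ p, 0 ≤ G p := fun p => by
    have n1 := negLog_nonneg p.1
    have n2 := negLog_nonneg p.2
    have n3 := negLog_nonneg (p.1 + p.2)
    have m1 := unitInd_nonneg p.1
    have m2 := unitInd_nonneg p.2
    positivity
  calc ∫ p in cubicRegion, (-log (cubic p)) ^ 2 ≤ ∫ p in cubicRegion, G p := by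
        refine integral_mono_of_nonneg (ae_of_all _ fun p => sq_nonneg _) hGi.restrict
          ((ae_restrict_iff' measurableSet_cubicRegion).2 (ae_of_all _ fun p hp => ?_))
        obtain ⟨k0, k1⟩ := neg_log_cubic_bounds hp
        simp only [hG, unitInd_of_mem hp.1.1, unitInd_of_mem hp.1.2]
        refine (pow_le_pow_left₀ k0 k1 2).trans_eq ?_
        ring
    _ ≤ ∫ p, G p := setIntegral_le_integral hGi (ae_of_all _ hG0)
    _ = 48 := hGv

theorem integrableOn_log_add : IntegrableOn (fun p : ℝ × ℝ => log (p.1 + p.2)) square := by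
  have h1 := (integrable_and_integral_mul_add integrable_unitInd integrable_negLog).1
  have h2 : Integrable fun p : ℝ × ℝ => unitInd p.1 * unitInd p.2 :=
    integrable_unitInd.mul_prod integrable_unitInd
  refine Integrable.mono' (h1.add h2).restrict
    (measurable_log.comp (measurable_fst.add measurable_snd)).aestronglyMeasurable
    ((ae_restrict_iff' measurableSet_square).2 (ae_of_all _ fun p hp => ?_))
  simp only [Pi.add_apply, unitInd_of_mem hp.1, unitInd_of_mem hp.2, one_mul]
  rw [Real.norm_eq_abs, abs_le]
  have n3 := negLog_nonneg (p.1 + p.2)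
  constructor
  · linarith [neg_log_le_negLog (p.1 + p.2)]
  · have h3 : |p.1 + p.2| ≤ 2 := by
      rw [abs_le]; constructor <;> linarith [hp.1.1, hp.1.2, hp.2.1, hp.2.2]
    have h4 : log (p.1 + p.2) ≤ 1 := by
      rcases eq_or_ne (p.1 + p.2) 0 with h | h
      · rw [h, log_zero]; norm_num
      · rw [← log_abs]
        linarith [log_le_sub_one_of_pos (abs_pos.2 h)]
    linarith

/-- From the bound `t log t ≤ t (t - 1)` for the inner integral. -/
theorem integral_log_add_le : ∫ p in square, log (p.1 + p.2) ≤ -8 / 3 := by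
  have hint := integrableOn_log_add
  rw [square, Measure.volume_eq_prod, setIntegral_prod _ hint]
  have hin : ∀ X ∈ Set.Icc (-1 : ℝ) 1, ∫ Y in Set.Icc (-1 : ℝ) 1, log (X + Y) ≤ 2 * X ^ 2 - 2 := by
    intro X hX
    rw [integral_Icc_eq_integral_Ioc, ← intervalIntegral.integral_of_le (by norm_num),
      intervalIntegral.integral_comp_add_left (fun x => log x), integral_log]
    have hl : ∀ t : ℝ, 0 ≤ t → t * log t ≤ t * (t - 1) := fun t ht => by
      rcases eq_or_lt_of_le ht with rfl | h
      · simp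
      · exact mul_le_mul_of_nonneg_left (log_le_sub_one_of_pos h) ht
    have e1 := hl (X + 1) (by linarith [hX.1])
    have e2 := hl (1 - X) (by linarith [hX.2])
    have e3 : log (X + -1) = log (1 - X) := by
      rw [← log_neg_eq_log]; congr 1; ring
    rw [e3]
    linarith
  have hprod := hint
  rw [IntegrableOn, square, Measure.volume_eq_prod, ← Measure.prod_restrict] at hprod
  calc _ ≤ ∫ X in Set.Icc (-1 : ℝ) 1, (2 * X ^ 2 - 2) :=
        setIntegral_mono_on hprod.integral_prod_left
          ((by fun_prop : Continuous fun X : ℝ => 2 * X ^ 2 - 2).integrableOn_Icc)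
          measurableSet_Icc hin
    _ = -8 / 3 := by
        rw [integral_Icc_eq_integral_Ioc, ← intervalIntegral.integral_of_le (by norm_num)]
        rw [intervalIntegral.integral_sub
          ((by fun_prop : Continuous fun X : ℝ => 2 * X ^ 2).intervalIntegrable _ _)
          (continuous_const.intervalIntegrable _ _),
          intervalIntegral.integral_const_mul, integral_pow]
        norm_num

/-- The integral of `-log (cubic p)` over the whole square is at least `4 + 4 + 8 / 3`; leaving out
the part with `cubic p > 1` makes it larger. -/
theorem le_integral_neg_log_cubic : 32 / 3 ≤ ∫ p in cubicRegion, -log (cubic p) := by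
  have i1 := integrable_and_integral_mul integrable_negLog integrable_unitInd
  have i2 := integrable_and_integral_mul integrable_unitInd integrable_negLog
  rw [integral_negLog, integral_unitInd] at i1 i2
  have hsq : ∀ u : ℝ × ℝ → ℝ, (∀ p ∉ square, u p = 0) → ∫ p in square, u p = ∫ p, u p :=
    fun u hu => setIntegral_eq_integral_of_forall_compl_eq_zero hu
  have z1 : ∀ p ∉ square, negLog p.1 * unitInd p.2 = 0 := fun p hp => by
    by_cases h : p.2 ∈ Set.Icc (-1 : ℝ) 1
    · rw [negLog_of_one_le_abs, zero_mul]
      by_contra hlt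
      exact hp ⟨abs_le.1 (not_le.1 hlt).le, h⟩
    · rw [unitInd, Set.indicator_of_notMem h, mul_zero]
  have z2 : ∀ p ∉ square, unitInd p.1 * negLog p.2 = 0 := fun p hp => by
    by_cases h : p.1 ∈ Set.Icc (-1 : ℝ) 1
    · rw [negLog_of_one_le_abs, mul_zero]
      by_contra hlt
      exact hp ⟨h, abs_le.1 (not_le.1 hlt).le⟩
    · rw [unitInd, Set.indicator_of_notMem h, zero_mul]
  set D : ℝ × ℝ → ℝ := fun p => negLog p.1 * unitInd p.2 + unitInd p.1 * negLog p.2 -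
    log (p.1 + p.2) with hD
  have i3 := integrable_and_integral_add (μ := volume.restrict square)
    ⟨i1.1.restrict, (hsq _ z1).trans i1.2⟩ ⟨i2.1.restrict, (hsq _ z2).trans i2.2⟩
  have hDi : IntegrableOn D square := i3.1.sub integrableOn_log_add
  have hDv : ∫ p in square, D p = 2 * 2 + 2 * 2 - ∫ p in square, log (p.1 + p.2) := by
    rw [← i3.2]
    exact integral_sub i3.1 integrableOn_log_add
  have hle : ∫ p in square, D p ≤
      ∫ p in square, cubicRegion.indicator (fun p => -log (cubic p)) p := by
    refine setIntegral_mono_ae_restrict hDi ((integrable_indicator_iff measurableSet_cubicRegion).2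
      integrable_neg_log_cubic).restrict ((ae_restrict_iff' measurableSet_square).2 ?_)
    have h1 : ∀ᵐ p : ℝ × ℝ, cubic p ≠ 0 := by
      rw [ae_iff]; simpa using volume_cubic_eq 0
    filter_upwards [h1] with p hp hpS
    have hpos : 0 < cubic p := lt_of_le_of_ne (cubic_nonneg p) (Ne.symm hp)
    have hDp : D p = -log (cubic p) := by
      simp only [hD, unitInd_of_mem hpS.1, unitInd_of_mem hpS.2, log_cubic hpos,
        negLog_of_abs_le_one (abs_le.2 hpS.1), negLog_of_abs_le_one (abs_le.2 hpS.2)]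
      ring
    rw [hDp]
    by_cases hle : cubic p ≤ 1
    · rw [Set.indicator_of_mem (show p ∈ cubicRegion from ⟨hpS, hpos, hle⟩)]
    · rw [Set.indicator_of_notMem fun h => hle h.2.2]
      exact neg_nonpos.2 (log_nonneg (not_le.1 hle).le)
  rw [setIntegral_indicator measurableSet_cubicRegion,
    show square ∩ cubicRegion = cubicRegion from
      Set.inter_eq_self_of_subset_right Set.inter_subset_left, hDv] at hle
  linarith [integral_log_add_le]

/-- This is the inequality that makes the second constant nonnegative; `48 = 9 · (1/2) · (32/3)` is
exactly what the bounds for the two integrals and `γ > 1/2` give. -/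
theorem integral_log_cubic_sq_le :
    ∫ p in cubicRegion, (-log (cubic p)) ^ 2 ≤ 9 * γ * ∫ p in cubicRegion, -log (cubic p) := by
  have h1 := integral_neg_log_cubic_sq_le
  have h2 := le_integral_neg_log_cubic
  have h3 := one_half_lt_eulerMascheroniConstant
  nlinarith

/-! ### The real density -/

theorem measurableSet_sigmaRegion : MeasurableSet sigmaRegion := by
  exact (measurableSet_lt (g := fun z : ℝ × ℝ × ℝ => z.1) measurable_const (by fun_prop)).inter
    ((measurableSet_lt (g := fun z : ℝ × ℝ × ℝ => z.2.1) measurable_const (by fun_prop)).inter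
    ((measurableSet_le (f := fun z : ℝ × ℝ × ℝ => z.2.1) (by fun_prop) measurable_const).inter
    ((measurableSet_le (f := fun z : ℝ × ℝ × ℝ => z.2.1 * z.1 ^ 2) (by fun_prop)
      measurable_const).inter
    ((measurableSet_le (f := fun z : ℝ × ℝ × ℝ => z.2.1 * z.2.2 ^ 2) (by fun_prop)
      measurable_const).inter
    (measurableSet_le (f := fun z : ℝ × ℝ × ℝ => |z.1 * z.2.2 * (z.1 - z.2.2)|) (by fun_prop)
      measurable_const)))))

/-- Slicing a set of triples by the middle coordinate. -/
theorem volume_eq_lintegral_middle {S : Set (ℝ × ℝ × ℝ)} (hS : MeasurableSet S) :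
    volume S = ∫⁻ u, volume {p : ℝ × ℝ | (p.1, u, p.2) ∈ S} := by
  have hm1 : ∀ t : ℝ, MeasurableSet (Prod.mk t ⁻¹' S) := fun t => measurable_prodMk_left hS
  have hm2 : MeasurableSet {q : (ℝ × ℝ) × ℝ | (q.1.1, q.1.2, q.2) ∈ S} :=
    hS.preimage (f := fun q : (ℝ × ℝ) × ℝ => (q.1.1, q.1.2, q.2)) (by fun_prop)
  have hm3 : ∀ u : ℝ, MeasurableSet {p : ℝ × ℝ | (p.1, u, p.2) ∈ S} := fun u =>
    hS.preimage (f := fun p : ℝ × ℝ => (p.1, u, p.2)) (by fun_prop)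
  have hswap := lintegral_lintegral_swap (μ := (volume : Measure ℝ)) (ν := (volume : Measure ℝ))
    (f := fun t u => volume {v : ℝ | (t, u, v) ∈ S})
    (measurable_measure_prodMk_left (ν := (volume : Measure ℝ)) hm2).aemeasurable
  calc volume S = ∫⁻ t, volume (Prod.mk t ⁻¹' S) := by
        rw [Measure.volume_eq_prod, Measure.prod_apply hS]
    _ = ∫⁻ t, ∫⁻ u, volume {v : ℝ | (t, u, v) ∈ S} := by
        refine lintegral_congr fun t => ?_
        rw [Measure.volume_eq_prod, Measure.prod_apply (hm1 t)]
        rfl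
    _ = ∫⁻ u, ∫⁻ t, volume {v : ℝ | (t, u, v) ∈ S} := hswap
    _ = _ := by
        refine lintegral_congr fun u => ?_
        rw [Measure.volume_eq_prod, Measure.prod_apply (hm3 u)]
        rfl

/-- The half of the square with `X > 0`, cut by `|X Y (X + Y)|² ≤ r`. -/
def halfRegion (r : ℝ) : Set (ℝ × ℝ) := {p | p ∈ square ∧ 0 < p.1 ∧ cubic p ^ 2 ≤ r}

theorem measurableSet_halfRegion (r : ℝ) : MeasurableSet (halfRegion r) :=
  measurableSet_square.inter ((measurableSet_lt measurable_const measurable_fst).inter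
    (measurableSet_le (measurable_cubic.pow_const 2) measurable_const))

/-- The region is symmetric about the origin, and its part with `X = 0` is a null set. -/
theorem volume_inter_cubic_eq (r : ℝ) :
    volume (square ∩ {p | cubic p ^ 2 ≤ r}) = 2 * volume (halfRegion r) := by
  have hneg : MeasurePreserving (fun p : ℝ × ℝ => -p) volume volume :=
    Measure.measurePreserving_neg volume
  have h0 : ∀ᵐ p : ℝ × ℝ, p.1 ≠ 0 := by
    rw [ae_iff]
    have e : {p : ℝ × ℝ | ¬ p.1 ≠ 0} = {0} ×ˢ Set.univ := by ext p; simp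
    rw [e, Measure.volume_eq_prod, Measure.prod_prod]
    simp
  have hae : (square ∩ {p | cubic p ^ 2 ≤ r} : Set (ℝ × ℝ)) =ᵐ[volume]
      (halfRegion r ∪ (fun p => -p) ⁻¹' halfRegion r : Set (ℝ × ℝ)) := by
    filter_upwards [h0] with p hp
    have hc : cubic (-p) = cubic p := by
      simp only [cubic, Prod.fst_neg, Prod.snd_neg]
      rw [← abs_neg]; congr 1; ring
    have hs : -p ∈ square ↔ p ∈ square := by
      simp only [square, Set.mem_prod, Set.mem_Icc, Prod.fst_neg, Prod.snd_neg]
      constructor <;> rintro ⟨⟨a, b⟩, c, d⟩ <;> refine ⟨⟨?_, ?_⟩, ?_, ?_⟩ <;> linarith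
    apply propext
    change (p ∈ square ∧ cubic p ^ 2 ≤ r) ↔
      (p ∈ square ∧ 0 < p.1 ∧ cubic p ^ 2 ≤ r) ∨ (-p ∈ square ∧ 0 < (-p).1 ∧ cubic (-p) ^ 2 ≤ r)
    rw [hc, hs, Prod.fst_neg, neg_pos]
    rcases lt_or_gt_of_ne hp with h | h
    · have := not_lt.2 h.le; tauto
    · have := not_lt.2 h.le; tauto
  rw [measure_congr hae, measure_union ?_ (hneg.measurable (measurableSet_halfRegion r)),
    hneg.measure_preimage (measurableSet_halfRegion r).nullMeasurableSet, two_mul]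
  rw [Set.disjoint_left]
  rintro p ⟨_, h1, _⟩ ⟨_, h2, _⟩
  simp only [Prod.fst_neg] at h2
  linarith

open scoped Pointwise in
/-- The section of `sigmaRegion` at height `u` is, up to a reflection, a dilate of `halfRegion`. -/
theorem volume_section_sigmaRegion {u : ℝ} (hu : u ∈ Set.Ioc (0 : ℝ) 1) :
    volume {p : ℝ × ℝ | (p.1, u, p.2) ∈ sigmaRegion} =
      ENNReal.ofReal (1 / u) * volume (halfRegion (u ^ 3)) := by
  have hu0 := hu.1
  have hr : 0 < √u := sqrt_pos.2 hu0
  have hsq : √u ^ 2 = u := sq_sqrt hu0.le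
  have hmp : MeasurePreserving (Prod.map id (fun v : ℝ => -v) : ℝ × ℝ → ℝ × ℝ) volume volume :=
    (MeasurePreserving.id volume).prod (Measure.measurePreserving_neg volume)
  have hset : {p : ℝ × ℝ | (p.1, u, p.2) ∈ sigmaRegion} =
      Prod.map id (fun v : ℝ => -v) ⁻¹' ((√u)⁻¹ • halfRegion (u ^ 3)) := by
    ext p
    rw [Set.mem_preimage, Set.mem_smul_set_iff_inv_smul_mem₀ (inv_ne_zero hr.ne'), inv_inv]
    simp only [sigmaRegion, halfRegion, square, cubic, Set.mem_ofPred_eq, Set.mem_prod, Set.mem_Icc,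
      ← abs_le, Prod.map_fst, Prod.map_snd, Prod.smul_fst, Prod.smul_snd, smul_eq_mul, id]
    have hb : ∀ t : ℝ, u * t ^ 2 ≤ 1 ↔ |√u * t| ≤ 1 := fun t => by
      rw [← sq_le_one_iff_abs_le_one, mul_pow, hsq]
    have hc : |√u * p.1 * (√u * -p.2) * (√u * p.1 + √u * -p.2)| ^ 2 ≤ u ^ 3 ↔
        |p.1 * p.2 * (p.1 - p.2)| ≤ 1 := by
      have e : |√u * p.1 * (√u * -p.2) * (√u * p.1 + √u * -p.2)| ^ 2 =
          u ^ 3 * (p.1 * p.2 * (p.1 - p.2)) ^ 2 := by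
        rw [sq_abs, show √u * p.1 * (√u * -p.2) * (√u * p.1 + √u * -p.2) =
          -(√u ^ 2 * √u * (p.1 * p.2 * (p.1 - p.2))) by ring, neg_sq, mul_pow, mul_pow, hsq]
        ring
      rw [e, mul_le_iff_le_one_right (by positivity), sq_le_one_iff_abs_le_one]
    rw [hc, hb, hb, mul_pos_iff_of_pos_left hr, mul_neg, abs_neg]
    have := hu.2
    tauto
  have hm : MeasurableSet ((√u)⁻¹ • halfRegion (u ^ 3)) :=
    (measurableSet_halfRegion _).const_smul₀ _
  rw [hset, hmp.measure_preimage hm.nullMeasurableSet, Measure.addHaar_smul]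
  congr 2
  simp only [Module.finrank_prod, Module.finrank_self, Nat.reduceAdd, inv_pow, hsq]
  rw [abs_of_pos (by positivity), one_div]

theorem lintegral_one_div_eq {c : ℝ} (hc : 0 < c) :
    ∫⁻ u in Set.Ioc (0 : ℝ) 1, {u : ℝ | c ^ 2 ≤ u ^ 3}.indicator (fun u => ENNReal.ofReal (1 / u)) u =
      ENNReal.ofReal (2 / 3 * -log c) := by
  set r := exp (2 / 3 * log c) with hr
  have hr0 : 0 < r := exp_pos _
  have hiff : ∀ u : ℝ, 0 < u → (c ^ 2 ≤ u ^ 3 ↔ r ≤ u) := fun u hu => by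
    rw [hr, ← le_log_iff_exp_le hu, ← log_le_log_iff (by positivity) (by positivity), log_pow,
      log_pow]
    push_cast
    constructor <;> intro h <;> linarith
  have hm : MeasurableSet {u : ℝ | c ^ 2 ≤ u ^ 3} :=
    measurableSet_le measurable_const (by fun_prop)
  rw [lintegral_indicator hm, Measure.restrict_restrict hm]
  have hset : {u : ℝ | c ^ 2 ≤ u ^ 3} ∩ Set.Ioc (0 : ℝ) 1 = Set.Icc r 1 := by
    ext u
    constructor
    · rintro ⟨h, h0, h1⟩; exact ⟨(hiff u h0).1 h, h1⟩
    · rintro ⟨h, h1⟩; exact ⟨(hiff u (hr0.trans_le h)).2 h, hr0.trans_le h, h1⟩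
  rw [hset]
  rcases le_or_gt r 1 with h1 | h1
  · have hcont : ContinuousOn (fun u : ℝ => 1 / u) (Set.Icc r 1) :=
      continuousOn_const.div continuousOn_id fun u hu => (hr0.trans_le hu.1).ne'
    rw [← ofReal_integral_eq_lintegral_ofReal hcont.integrableOn_Icc
      ((ae_restrict_iff' measurableSet_Icc).2 (ae_of_all _ fun u hu =>
        one_div_nonneg.2 (hr0.trans_le hu.1).le)), integral_Icc_eq_integral_Ioc,
      ← intervalIntegral.integral_of_le h1, integral_one_div_of_pos hr0 one_pos,
      log_div one_ne_zero hr0.ne', log_one, hr, log_exp]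
    congr 1; ring
  · rw [Set.Icc_eq_empty (not_le.2 h1), Measure.restrict_empty, lintegral_zero_measure,
      ENNReal.ofReal_of_nonpos]
    have := log_pos h1
    rw [hr, log_exp] at this
    linarith

/-- After integrating over `t, v` for fixed `u`, the order is exchanged: for a point `p` of the square,
the integral of `1 / u` over `cubic p ^ 2 ≤ u³ ≤ 1` is `-(2/3) log (cubic p)`. -/
theorem two_mul_volume_sigmaRegion :
    2 * volume sigmaRegion = ENNReal.ofReal (2 / 3 * ∫ p in cubicRegion, -log (cubic p)) := by
  have h1 : volume sigmaRegion = ∫⁻ u in Set.Ioc (0 : ℝ) 1,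
      ENNReal.ofReal (1 / u) * volume (halfRegion (u ^ 3)) := by
    rw [volume_eq_lintegral_middle measurableSet_sigmaRegion, ← lintegral_indicator measurableSet_Ioc]
    refine lintegral_congr fun u => ?_
    by_cases hu : u ∈ Set.Ioc (0 : ℝ) 1
    · rw [Set.indicator_of_mem hu, volume_section_sigmaRegion hu]
    · rw [Set.indicator_of_notMem hu]
      convert measure_empty (μ := (volume : Measure (ℝ × ℝ)))
      ext p
      simp only [sigmaRegion, Set.mem_ofPred_eq, Set.mem_empty_iff_false, iff_false]
      exact fun h => hu ⟨h.2.1, h.2.2.1⟩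
  set D : Set (ℝ × ℝ × ℝ) := {q | cubic q.2 ^ 2 ≤ q.1 ^ 3} with hD
  have hDm : MeasurableSet D :=
    measurableSet_le ((measurable_cubic.comp measurable_snd).pow_const 2) (by fun_prop)
  have h2 : 2 * volume sigmaRegion = ∫⁻ u in Set.Ioc (0 : ℝ) 1, ∫⁻ p in square,
      D.indicator (fun q => ENNReal.ofReal (1 / q.1)) (u, p) := by
    rw [h1, ← lintegral_const_mul' _ _ (by norm_num)]
    refine lintegral_congr fun u => ?_
    have hm : MeasurableSet {p : ℝ × ℝ | cubic p ^ 2 ≤ u ^ 3} :=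
      measurableSet_le (measurable_cubic.pow_const 2) measurable_const
    have e : ∀ p : ℝ × ℝ, D.indicator (fun q => ENNReal.ofReal (1 / q.1)) (u, p) =
        {p : ℝ × ℝ | cubic p ^ 2 ≤ u ^ 3}.indicator (fun _ => ENNReal.ofReal (1 / u)) p := fun p => rfl
    simp only [e]
    rw [lintegral_indicator hm, Measure.restrict_restrict hm, setLIntegral_const, mul_left_comm,
      ← volume_inter_cubic_eq, Set.inter_comm]
  rw [h2, lintegral_lintegral_swap]
  swap
  · exact (Measurable.indicator (by fun_prop) hDm).aemeasurable
  have h3 : ∀ᵐ p : ℝ × ℝ, cubic p ≠ 0 := by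
    rw [ae_iff]; simpa using volume_cubic_eq 0
  calc _ = ∫⁻ p in square, cubicRegion.indicator
        (fun p => ENNReal.ofReal (2 / 3 * -log (cubic p))) p := by
        refine lintegral_congr_ae ((ae_restrict_iff' measurableSet_square).2 ?_)
        filter_upwards [h3] with p hp hpS
        have hpos : 0 < cubic p := lt_of_le_of_ne (cubic_nonneg p) (Ne.symm hp)
        refine (lintegral_one_div_eq hpos).trans ?_
        by_cases hle : cubic p ≤ 1
        · rw [Set.indicator_of_mem (show p ∈ cubicRegion from ⟨hpS, hpos, hle⟩)]
        · rw [Set.indicator_of_notMem fun h => hle h.2.2, ENNReal.ofReal_of_nonpos]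
          have := log_nonneg (not_le.1 hle).le
          linarith
    _ = ∫⁻ p in cubicRegion, ENNReal.ofReal (2 / 3 * -log (cubic p)) := by
        rw [lintegral_indicator measurableSet_cubicRegion,
          Measure.restrict_restrict measurableSet_cubicRegion,
          show cubicRegion ∩ square = cubicRegion from
            Set.inter_eq_self_of_subset_left Set.inter_subset_left]
    _ = _ := by
        rw [← integral_const_mul, ofReal_integral_eq_lintegral_ofReal
          (integrable_neg_log_cubic.const_mul _)]
        exact (ae_restrict_iff' measurableSet_cubicRegion).2 (ae_of_all _ fun p hp =>
          mul_nonneg (by norm_num) (neg_log_cubic_bounds hp).1)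

theorem volume_sigmaRegion_lt_top : volume sigmaRegion < ⊤ := by
  have h : 2 * volume sigmaRegion < ⊤ := by
    rw [two_mul_volume_sigmaRegion]; exact ENNReal.ofReal_lt_top
  exact lt_of_le_of_lt (by rw [two_mul]; exact le_self_add) h

theorem sigmaInfty_eq : sigmaInfty = 2 * ∫ p in cubicRegion, -log (cubic p) := by
  have h := congrArg ENNReal.toReal two_mul_volume_sigmaRegion
  have h0 : 0 ≤ ∫ p in cubicRegion, -log (cubic p) := by linarith [le_integral_neg_log_cubic]
  rw [ENNReal.toReal_mul, ENNReal.toReal_ofReal (by positivity)] at h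
  rw [sigmaInfty, setIntegral_const, smul_eq_mul, mul_one, measureReal_def]
  norm_num at h
  linarith

/-! ### The asymptotic formula -/

/-- The asymptotic formula, with both constants in terms of integrals of powers of `-log` of the
cubic form and of sums over the coefficients of the density. -/
theorem exists_countU_sub_le : ∃ C : ℝ, ∀ B : ℝ, 1 ≤ B →
    |(countU B : ℝ) -
      ((∫ p in cubicRegion, -log (cubic p)) / 72 * (∑' m, coef m) * B * log B ^ 3 +
      ((9 * γ * (∫ p in cubicRegion, -log (cubic p)) -
          ∫ p in cubicRegion, (-log (cubic p)) ^ 2) / 24 * (∑' m, coef m) -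
        3 * ((∫ p in cubicRegion, -log (cubic p)) / 72) * ∑' m, coef m * log (partsHeight m)) *
        B * log B ^ 2)| ≤ C * (B * (1 + log B)) := by
  obtain ⟨C₁, -, h₁⟩ := exists_integral_recipSum₃_sub_asymp (volume.restrict cubicRegion) cubic
    measurable_cubic ((ae_restrict_iff' measurableSet_cubicRegion).2 (ae_of_all _ fun p hp => hp.2))
    integrable_one_sub_log_cubic_cube
  obtain ⟨C₂, h₂⟩ := exists_tsum_coef_asymp (W := weightedSum) (fun Q hQ => weightedSum_of_lt_one hQ)
    (fun Q hQ => by rw [weightedSum_eq (by linarith)]; exact h₁ Q hQ)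
  obtain ⟨C₃, h₃⟩ := exists_sum_ncard_pairSet_asymp
  refine ⟨C₃ + C₂, fun B hB => ?_⟩
  have k₂ := h₂ B hB
  have k₃ := h₃ B hB
  rw [← Nat.cast_sum, ← (finite_pointsUpTo_and_countU_eq (B := B) (by linarith)).2] at k₃
  have k₄ := mul_le_mul_of_nonneg_left k₂ (show 0 ≤ B by linarith)
  have habs : ∀ t : ℝ, B * |t| = |B * t| := fun t => by
    rw [abs_mul, abs_of_nonneg (show 0 ≤ B by linarith)]
  rw [habs] at k₄
  refine le_trans (le_of_eq_of_le ?_ (abs_add_le _ _)) ((add_le_add k₃ k₄).trans_eq ?_)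
  · congr 1
    ring
  · ring

end A1DelPezzo

theorem theoremt :
    (∀ B : ℝ, (A1DelPezzo.pointsUpTo B).Finite) ∧
    volume A1DelPezzo.sigmaRegion < ⊤ ∧
    Multipliable A1DelPezzo.eulerFactor ∧
    ∃ c₁ c₂ : ℝ, 0 ≤ c₁ ∧ 0 ≤ c₂ ∧
      c₁ = A1DelPezzo.sigmaInfty / 144 * ∏' p : Nat.Primes, A1DelPezzo.eulerFactor p ∧
      (fun B : ℝ => (A1DelPezzo.countU B : ℝ) -
          (c₁ * B * Real.log B ^ 3 + c₂ * B * Real.log B ^ 2))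
        =O[atTop] fun B : ℝ => B * Real.log B := by
  have hI := A1DelPezzo.le_integral_neg_log_cubic
  have hI2 := A1DelPezzo.integral_log_cubic_sq_le
  have hE := A1DelPezzo.tsum_coef_nonneg
  refine ⟨fun B => ?_, A1DelPezzo.volume_sigmaRegion_lt_top,
    A1DelPezzo.tsum_coef_eq.multipliable,
    (∫ p in A1DelPezzo.cubicRegion, -Real.log (A1DelPezzo.cubic p)) / 72 * ∑' m, A1DelPezzo.coef m,
    (9 * Real.eulerMascheroniConstant *
          (∫ p in A1DelPezzo.cubicRegion, -Real.log (A1DelPezzo.cubic p)) -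
        ∫ p in A1DelPezzo.cubicRegion, (-Real.log (A1DelPezzo.cubic p)) ^ 2) / 24 *
          (∑' m, A1DelPezzo.coef m) -
      3 * ((∫ p in A1DelPezzo.cubicRegion, -Real.log (A1DelPezzo.cubic p)) / 72) *
        ∑' m, A1DelPezzo.coef m * Real.log (A1DelPezzo.partsHeight m), ?_, ?_, ?_, ?_⟩
  · exact (A1DelPezzo.finite_pointsUpTo_and_countU_eq (B := max B 0) (le_max_right _ _)).1.subset
      fun P hP => ⟨hP.1, hP.2.trans (le_max_left _ _)⟩
  · positivity
  -- Both summands of the second constant are nonnegative.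
  · have hT := A1DelPezzo.tsum_coef_mul_log_nonpos
    refine le_trans ?_ (sub_le_sub_left (mul_nonpos_of_nonneg_of_nonpos (by positivity) hT) _)
    rw [sub_zero]
    refine mul_nonneg (div_nonneg ?_ (by norm_num)) hE
    linarith
  · rw [A1DelPezzo.sigmaInfty_eq, A1DelPezzo.tsum_coef_eq.tprod_eq]
    ring
  · obtain ⟨C, hC⟩ := A1DelPezzo.exists_countU_sub_le
    refine IsBigO.of_bound (2 * |C|) ?_
    filter_upwards [eventually_ge_atTop (Real.exp 1)] with B hB
    have hB1 : 1 ≤ B := le_trans (by linarith [Real.add_one_le_exp (1 : ℝ)]) hB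
    have hlog : 1 ≤ Real.log B := (Real.le_log_iff_exp_le (by linarith)).2 hB
    rw [Real.norm_eq_abs, Real.norm_of_nonneg (mul_nonneg (by linarith) (by linarith))]
    refine (hC B hB1).trans ?_
    calc C * (B * (1 + Real.log B)) ≤ |C| * (B * (1 + Real.log B)) := by
          gcongr
          exact le_abs_self C
      _ ≤ |C| * (B * (Real.log B + Real.log B)) := by gcongr
      _ = _ := by ring
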